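/- **Definitions.** Groups are written additively but need not be commutative, and $[a,b]=-a-b+a+b$. A *square group* $X=(X_e\rightleftarrows X_{ee})$ consists of a group $X_e$, an abelian group $X_{ee}$, a homomorphism $P\colon X_{ee}\to X_e$ and a function $H\colon X_e\to X_{ee}$ whose cross effect $(a|b)_H=H(a+b)-H(b)-H(a)$ is linear in $a$ and $b$, such that $(Px|b)_H=0=(a|Py)_H$, $P(a|b)_H=[a,b]$ and $PHP(x)=P(x)+P(x)$. Morphisms are pairs of homomorphisms commuting with $P$ and $H$. Then $\operatorname{Coker}P$ is abelian, and $X$ is *good* if the map $(-|-)_H\colon \operatorname{Coker}P\otimes\operatorname{Coker}P\to X_{ee}$ is an isomorphism. Put $T=HP-1$ and $\Delta(x)=(x|x)_H-H(x)+TH(x)$. Let $\mathbb Z_{nil}$ be the square group $\mathbb Z\rightleftarrows\mathbb Z$ with $P=0$, $H(n)=\binom n2$. The *tensor product* $X\odot Y$ has $(X\odot Y)_{ee}=X_{ee}\otimes Y_{ee}$, and $(X\odot Y)_e$ is generated by symbols $x\,\underline{\circledcirc}\,y$, $x\circledcirc y$ ($x\in X_e$, $y\in Y_e$) and $a\bar\otimes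 b$ ($a\in X_{ee}$, $b\in Y_{ee}$), subject to: $a\bar\otimes b$ is bilinear and central; $x\,\underline\circledcirc\,y$ is linear in $y$; $x\circledcirc y$ is linear in $x$; $P(a)\,\underline\circledcirc\,y=a\bar\otimes\Delta(y)$; $x\circledcirc P(b)=\Delta(x)\bar\otimes b$; $T(a)\bar\otimes T(b)=-a\bar\otimes b$; $x\,\underline\circledcirc\,y-x\circledcirc y=H(x)\bar\otimes TH(y)$. Here $P(a\otimes b)=a\bar\otimes b$, and $H$ is the function with $H(x\,\underline\circledcirc\,y)=(x|x)_H\otimes H(y)+H(x)\otimes\Delta(y)$, $H(x\circledcirc y)=\Delta(x)\otimes H(y)+H(x)\otimes(y|y)_H$, $H(a\bar\otimes b)=a\otimes b-T(a)\otimes T(b)$, whose cross effect is bilinear, vanishes on the $a\bar\otimes b$, and is $(x|x')_H\otimes(y|y')_H$ on symbols of the first two kinds built from $x,y$ and from $x',y'$. A *quadratic pair module* $C$ is a morphism of square groups $\partial\colon C_{(1)}\to C_{(0)}$, $C_{(i)}=(C_i\rightleftarrows C_{ee})$, with $\partial_{ee}=1$; a morphism $C\to D$ consists of homomorphisms $C_0\to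 D_0$, $C_1\to D_1$, $C_{ee}\to D_{ee}$ commuting with $P$, $\partial$ and $H$. They form a category $\mathbf{qpm}$. $C$ is *$0$-good* if $C_{(0)}$ is good; $\mathbf{qpm}_0\subset\mathbf{qpm}$ is the full subcategory of $0$-good objects. For a morphism $f\colon D\to C$ of square groups, $\Phi(f)$ is the quadratic pair module with $\Phi(f)_{(0)}=C$ and $\Phi(f)_1=(D_e\times C_{ee})/\!\sim$, where $(0,f_{ee}(d))\sim(P(d),0)$ and $(0,HP(c))\sim(0,2c)$, with $P(c)=(0,c)$ and $\partial(d,c)=f_e(d)+P(c)$. The *tensor product* is $C\odot D=\Phi(\bar\partial\colon C\bar\odot D\to C_{(0)}\odot D_{(0)})$, where $C\bar\odot D$ is the push-out of square groups of $C_{(1)}\odot D_{(0)}\xleftarrow{1\odot\partial}C_{(1)}\odot D_{(1)}\xrightarrow{\partial\odot1}C_{(0)}\odot D_{(1)}$ and $\bar\partial$ is induced by $\partial\odot1$ and $1\odot\partial$. So elements of $C_{(1)}\odot D_{(0)}$ and of $C_{(0)}\odot D_{(1)}$ have images in $(C\odot D)_1$. Put $\overline{\mathbb Z}_{nil}=\Phi(0\to\mathbb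 Z_{nil})$. For an additive (not necessarily commutative) monoid $M$, $\mathbf{qpm}_0^M$ is the category of families $(D_n)_{n\in M}$ of $0$-good quadratic pair modules. **Proposition.** (a) $\mathbf{qpm}$ has all (small) coproducts, and if $C$ is $0$-good, then the functor $C\odot-\colon\mathbf{qpm}\to\mathbf{qpm}$ preserves them. (b) For $0$-good $C,D,E$ there are isomorphisms $(C\odot D)\odot E\cong C\odot(D\odot E)$, $\overline{\mathbb Z}_{nil}\odot C\cong C$ and $C\odot\overline{\mathbb Z}_{nil}\cong C$ in $\mathbf{qpm}$. The first is given by $(x\,\underline\circledcirc\,y)\,\underline\circledcirc\,z\mapsto x\,\underline\circledcirc\,(y\,\underline\circledcirc\,z)$ on level $0$ (all three elements from the $0$-levels) and on level $1$ (exactly one of $x,y,z$ from a $1$-level, the others from $0$-levels), and by $(a\otimes b)\otimes c\mapsto a\otimes(b\otimes c)$ on level $ee$. The second is given by $n\circledcirc x\mapsto n\cdot x$ and the third by $x\,\underline\circledcirc\,n\mapsto n\cdot x$ ($n\in\mathbb Z$, $x\in C_0$ or $x\in C_1$), and by $n\otimes a\mapsto n\cdot a$, respectively $a\otimes n\mapsto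 n\cdot a$, on level $ee$. (c) For every additive monoid $M$ the category $\mathbf{qpm}_0^M$ is a monoidal category with tensor product $$(D\odot E)_n=\bigvee_{p+q=n}D_p\odot E_q$$ (the coproduct in $\mathbf{qpm}$, which is again $0$-good; $f\odot g$ is induced by the $f_p\odot g_q$), with unit object $\overline{\mathbb Z}_{nil}$ in degree $0$ and the initial (zero) quadratic pair module in all other degrees, and with the associativity and unit isomorphisms whose restrictions to the summands $(D_p\odot E_q)\odot F_s$, $\overline{\mathbb Z}_{nil}\odot D_n$ and $D_n\odot\overline{\mathbb Z}_{nil}$ are given by those of (b). -/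

import Mathlib

open CategoryTheory Limits

universe u

section

open scoped TensorProduct

/-! ### Square groups -/

/-- The cross effect `(a|b)_H = H(a+b) - H(b) - H(a)` of a function `H`. -/
def crossEffect {G A : Type*} [AddGroup G] [AddCommGroup A] (H : G → A) (a b : G) : A :=
  H (a + b) - H b - H a

/-- The axioms of a square group, for a homomorphism `P : A → G` and a function `H : G → A`. -/
structure IsSquareGroup {G A : Type*} [AddGroup G] [AddCommGroup A] (P : A →+ G) (H : G → A) :
    Prop where
  cross_add_left : ∀ a a' b, crossEffect H (a + a') b = crossEffect H a b + crossEffect H a' b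
  cross_add_right : ∀ a b b', crossEffect H a (b + b') = crossEffect H a b + crossEffect H a b'
  cross_P_left : ∀ x b, crossEffect H (P x) b = 0
  cross_P_right : ∀ a y, crossEffect H a (P y) = 0
  P_cross : ∀ a b, P (crossEffect H a b) = -a - b + a + b
  P_H_P : ∀ x, P (H (P x)) = P x + P x

/-- A square group `X = (X_e ⇄ X_ee)`. The group `X_e` is written additively, but it need not be
commutative. -/
structure SquareGroup : Type (u + 1) where
  e : Type u
  ee : Type u
  [addGroup : AddGroup e]
  [addCommGroup : AddCommGroup ee]
  P : ee →+ e
  H : e → ee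
  isSq : IsSquareGroup P H

namespace SquareGroup

attribute [instance] addGroup addCommGroup

/-- A morphism of square groups. -/
@[ext]
structure Hom (X Y : SquareGroup.{u}) : Type u where
  e : X.e →+ Y.e
  ee : X.ee →+ Y.ee
  map_P : ∀ a, e (X.P a) = Y.P (ee a)
  map_H : ∀ x, ee (X.H x) = Y.H (e x)

instance : Category SquareGroup.{u} where
  Hom := Hom
  id X := { e := AddMonoidHom.id _, ee := AddMonoidHom.id _,
            map_P := fun _ => rfl, map_H := fun _ => rfl }
  comp f g :=
    { e := g.e.comp f.e, ee := g.ee.comp f.ee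
      map_P := fun a => by simp [f.map_P, g.map_P]
      map_H := fun a => by simp [f.map_H, g.map_H] }

@[ext]
theorem hom_ext {X Y : SquareGroup.{u}} {f g : X ⟶ Y} (h₁ : ∀ x, f.e x = g.e x)
    (h₂ : ∀ a, f.ee a = g.ee a) : f = g :=
  Hom.ext (AddMonoidHom.ext h₁) (AddMonoidHom.ext h₂)

@[simp] theorem id_e (X : SquareGroup.{u}) (x : X.e) : (𝟙 X : X ⟶ X).e x = x := rfl
@[simp] theorem id_ee (X : SquareGroup.{u}) (x : X.ee) : (𝟙 X : X ⟶ X).ee x = x := rfl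
@[simp] theorem comp_e {X Y Z : SquareGroup.{u}} (f : X ⟶ Y) (g : Y ⟶ Z) (x : X.e) :
    (f ≫ g).e x = g.e (f.e x) := rfl
@[simp] theorem comp_ee {X Y Z : SquareGroup.{u}} (f : X ⟶ Y) (g : Y ⟶ Z) (x : X.ee) :
    (f ≫ g).ee x = g.ee (f.ee x) := rfl

section basic

variable (X : SquareGroup.{u})

/-- The cross effect `(a|b)_H`. -/
def cr (a b : X.e) : X.ee := crossEffect X.H a b

theorem cr_add_left (a a' b : X.e) : X.cr (a + a') b = X.cr a b + X.cr a' b :=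
  X.isSq.cross_add_left a a' b
theorem cr_add_right (a b b' : X.e) : X.cr a (b + b') = X.cr a b + X.cr a b' :=
  X.isSq.cross_add_right a b b'
@[simp] theorem cr_P_left (x : X.ee) (b : X.e) : X.cr (X.P x) b = 0 := X.isSq.cross_P_left x b
@[simp] theorem cr_P_right (a : X.e) (y : X.ee) : X.cr a (X.P y) = 0 := X.isSq.cross_P_right a y
theorem P_cr (a b : X.e) : X.P (X.cr a b) = -a - b + a + b := X.isSq.P_cross a b
theorem P_H_P (x : X.ee) : X.P (X.H (X.P x)) = X.P x + X.P x := X.isSq.P_H_P x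

theorem H_add (a b : X.e) : X.H (a + b) = X.H a + X.H b + X.cr a b := by
  simp only [cr, crossEffect]; abel

@[simp] theorem H_zero : X.H 0 = 0 := by
  have := X.cr_P_left 0 0
  simpa [cr, crossEffect] using this

theorem P_comm (a : X.ee) (x : X.e) : X.P a + x = x + X.P a := by
  have h := X.P_cr x (X.P a)
  rw [cr_P_right, map_zero] at h
  have h2 : X.P a + x + 0 = X.P a + x + (-x - X.P a + x + X.P a) := by rw [← h]
  rw [add_zero] at h2
  rw [h2]
  simp [sub_eq_add_neg, add_assoc]

/-- The cross effect as a biadditive map. -/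
def crHom : X.e →+ X.e →+ X.ee :=
  AddMonoidHom.mk' (fun a => AddMonoidHom.mk' (X.cr a) (X.cr_add_right a))
    fun a a' => AddMonoidHom.ext fun b => X.cr_add_left a a' b

@[simp] theorem crHom_apply (a b : X.e) : X.crHom a b = X.cr a b := rfl

/-- The homomorphism `T = HP - 1`. -/
def T : X.ee →+ X.ee :=
  AddMonoidHom.mk' (fun a => X.H (X.P a) - a) fun a b => by
    rw [map_add, H_add, cr_P_left]; abel

theorem T_apply (a : X.ee) : X.T a = X.H (X.P a) - a := rfl

theorem H_P (a : X.ee) : X.H (X.P a) = a + X.T a := by rw [T_apply]; abel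

@[simp] theorem P_T (a : X.ee) : X.P (X.T a) = X.P a := by
  rw [T_apply, map_sub, P_H_P]; simp

@[simp] theorem T_T (a : X.ee) : X.T (X.T a) = a := by
  rw [T_apply, P_T, H_P]; abel

theorem cr_self_swap (a b : X.e) : X.T (X.cr a b) = - X.cr b a := by
  have h : a + b = b + a + X.P (X.cr a b) := by
    rw [P_cr]; simp [sub_eq_add_neg, add_assoc]
  have h2 := congrArg X.H h
  rw [H_add, H_add, H_add, cr_P_right, H_P] at h2
  have h3 : X.T (X.cr a b) = (X.H a + X.H b + X.cr a b) - (X.H b + X.H a) - X.cr b a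
      - X.cr a b := by rw [h2]; abel
  rw [h3]; abel

/-- The homomorphism `Δ(x) = (x|x)_H - H(x) + TH(x)`. -/
def Δ : X.e →+ X.ee :=
  AddMonoidHom.mk' (fun x => X.cr x x - X.H x + X.T (X.H x)) fun a b => by
    simp only [H_add, cr_add_left, cr_add_right, map_add, cr_self_swap]; abel

theorem Δ_apply (x : X.e) : X.Δ x = X.cr x x - X.H x + X.T (X.H x) := rfl

theorem T_Δ (x : X.e) : X.T (X.Δ x) = - X.Δ x := by
  simp only [Δ_apply, map_add, map_sub, cr_self_swap, T_T]; abel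

/-- The image of `P` is a normal subgroup of `X_e`. -/
instance normal_range : X.P.range.Normal where
  conj_mem := by
    rintro _ ⟨a, rfl⟩ g
    exact ⟨a, by rw [← P_comm]; simp [add_assoc]⟩

/-- The cokernel of `P`, which is an abelian group since `P(a|b)_H = [a,b]`. -/
def cokerP : Type u := X.e ⧸ X.P.range

instance : AddCommGroup X.cokerP :=
  { (inferInstance : AddGroup (X.e ⧸ X.P.range)) with
    add_comm := by
      intro a b
      induction a using QuotientAddGroup.induction_on with | H a => ?_
      induction b using QuotientAddGroup.induction_on with | H b => ?_
      change ((a + b : X.e) : X.e ⧸ X.P.range) = ((b + a : X.e) : X.e ⧸ X.P.range)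
      rw [QuotientAddGroup.eq]
      exact ⟨X.cr b a, by rw [P_cr]; simp [sub_eq_add_neg, add_assoc]⟩ }

/-- The projection `X_e → Coker P`. -/
def toCokerP : X.e →+ X.cokerP := QuotientAddGroup.mk' X.P.range

@[simp] theorem toCokerP_P (a : X.ee) : X.toCokerP (X.P a) = 0 :=
  (QuotientAddGroup.eq_zero_iff _).2 ⟨a, rfl⟩

/-- The biadditive map induced by the cross effect on `Coker P`. -/
def crCokerP : X.cokerP →+ X.cokerP →+ X.ee :=
  QuotientAddGroup.lift X.P.range
    (AddMonoidHom.mk' (fun a => QuotientAddGroup.lift X.P.range (X.crHom a) (by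
        rintro _ ⟨b, rfl⟩; exact X.cr_P_right a b)) (by
      intro a a'
      apply AddMonoidHom.ext
      intro b
      induction b using QuotientAddGroup.induction_on with | H b => ?_
      exact X.cr_add_left a a' b))
    (by
      rintro _ ⟨a, rfl⟩
      apply AddMonoidHom.ext
      intro b
      induction b using QuotientAddGroup.induction_on with | H b => ?_
      exact X.cr_P_left a b)

@[simp] theorem crCokerP_apply (a b : X.e) :
    X.crCokerP (X.toCokerP a) (X.toCokerP b) = X.cr a b := rfl

/-- The bilinear form of the previous definition. -/
def crLin : X.cokerP →ₗ[ℤ] X.cokerP →ₗ[ℤ] X.ee :=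
  LinearMap.mk₂ ℤ (fun a b => X.crCokerP a b) (by simp) (by simp) (by simp) (by simp)

/-- The homomorphism `(-|-)_H : Coker P ⊗ Coker P → X_ee`. -/
def crTensor : X.cokerP ⊗[ℤ] X.cokerP →ₗ[ℤ] X.ee := TensorProduct.lift X.crLin

/-- A square group is good if `(-|-)_H : Coker P ⊗ Coker P → X_ee` is an isomorphism. -/
def IsGood : Prop := Function.Bijective X.crTensor

end basic

/-- The square group `ℤ_nil`, with `P = 0` and `H(n) = n(n-1)/2`. -/
def Znil : SquareGroup.{u} where
  e := ULift.{u} ℤ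
  ee := ULift.{u} ℤ
  P := 0
  H n := ⟨n.down * (n.down - 1) / 2⟩
  isSq := by
    have key : ∀ a b : ULift.{u} ℤ, crossEffect (fun n : ULift.{u} ℤ =>
        (⟨n.down * (n.down - 1) / 2⟩ : ULift.{u} ℤ)) a b = ⟨a.down * b.down⟩ := by
      rintro ⟨a⟩ ⟨b⟩
      have h : (a + b) * (a + b - 1) = a * (a - 1) + b * (b - 1) + 2 * (a * b) := by ring
      obtain ⟨k, hk⟩ := Int.even_mul_pred_self a
      obtain ⟨l, hl⟩ := Int.even_mul_pred_self b
      simp only [crossEffect]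
      apply ULift.ext
      simp only [ULift.sub_down, ULift.add_down]
      rw [h, hk, hl]
      omega
    constructor
    · intro a a' b; simp only [key]; exact ULift.ext _ _ (add_mul _ _ _)
    · intro a a' b; simp only [key]; exact ULift.ext _ _ (mul_add _ _ _)
    · intro a b; rw [key]; exact ULift.ext _ _ (zero_mul _)
    · intro a b; rw [key]; exact ULift.ext _ _ (mul_zero _)
    · intro a b; rw [AddMonoidHom.zero_apply]; abel
    · intro a; simp

/-- The zero square group. -/
def zeroObj : SquareGroup.{u} where
  e := PUnit
  ee := PUnit
  P := 0
  H _ := 0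
  isSq := by constructor <;> intros <;> rfl

/-- The morphism from the zero square group. -/
def fromZero (X : SquareGroup.{u}) : zeroObj.{u} ⟶ X where
  e := 0
  ee := 0
  map_P _ := by simp
  map_H _ := by simp

theorem map_cr {X Y : SquareGroup.{u}} (f : X ⟶ Y) (a b : X.e) :
    f.ee (X.cr a b) = Y.cr (f.e a) (f.e b) := by
  simp [cr, crossEffect, f.map_H]

theorem map_T {X Y : SquareGroup.{u}} (f : X ⟶ Y) (a : X.ee) : f.ee (X.T a) = Y.T (f.ee a) := by
  simp [T_apply, f.map_H, f.map_P]

theorem map_Δ {X Y : SquareGroup.{u}} (f : X ⟶ Y) (a : X.e) : f.ee (X.Δ a) = Y.Δ (f.e a) := by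
  simp [Δ_apply, f.map_H, map_T, map_cr]

end SquareGroup

/-! ### The tensor product of square groups -/

namespace SquareGroup

/-- The generators `x ⊚̲ y` (`circU x y`), `x ⊚ y` (`circ x y`), `a ⊗̄ b` (`bar a b`). -/
inductive TensorGen (X Y : SquareGroup.{u}) : Type u
  | circU (x : X.e) (y : Y.e)
  | circ (x : X.e) (y : Y.e)
  | bar (a : X.ee) (b : Y.ee)

section presentation

variable (X Y : SquareGroup.{u})

/-- The word `x ⊚̲ y` in the free group on the generators. -/
def wCircU (x : X.e) (y : Y.e) : FreeAddGroup (TensorGen X Y) := FreeAddGroup.of (.circU x y)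
/-- The word `x ⊚ y` in the free group on the generators. -/
def wCirc (x : X.e) (y : Y.e) : FreeAddGroup (TensorGen X Y) := FreeAddGroup.of (.circ x y)
/-- The word `a ⊗̄ b` in the free group on the generators. -/
def wBar (a : X.ee) (b : Y.ee) : FreeAddGroup (TensorGen X Y) := FreeAddGroup.of (.bar a b)

/-- The defining relations of `(X ⊙ Y)_e`. -/
inductive TensorRel : FreeAddGroup (TensorGen X Y) → FreeAddGroup (TensorGen X Y) → Prop
  | bar_add_left (a a' b) : TensorRel (wBar X Y (a + a') b) (wBar X Y a b + wBar X Y a' b)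
  | bar_add_right (a b b') : TensorRel (wBar X Y a (b + b')) (wBar X Y a b + wBar X Y a b')
  | bar_central (a b g) : TensorRel (wBar X Y a b + g) (g + wBar X Y a b)
  | circU_add (x y y') : TensorRel (wCircU X Y x (y + y')) (wCircU X Y x y + wCircU X Y x y')
  | add_circ (x x' y) : TensorRel (wCirc X Y (x + x') y) (wCirc X Y x y + wCirc X Y x' y)
  | P_circU (a y) : TensorRel (wCircU X Y (X.P a) y) (wBar X Y a (Y.Δ y))
  | circ_P (x b) : TensorRel (wCirc X Y x (Y.P b)) (wBar X Y (X.Δ x) b)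
  | bar_T (a b) : TensorRel (wBar X Y (X.T a) (Y.T b)) (- wBar X Y a b)
  | circU_sub_circ (x y) :
      TensorRel (wCircU X Y x y - wCirc X Y x y) (wBar X Y (X.H x) (Y.T (Y.H y)))

/-- The group `(X ⊙ Y)_e`, given by generators and relations. -/
abbrev TensorE : Type u := (addConGen (TensorRel X Y)).Quotient

variable {X Y}

/-- The projection from the free group. -/
def tmk : FreeAddGroup (TensorGen X Y) →+ TensorE X Y := (addConGen (TensorRel X Y)).mk'

theorem tmk_rel {v w : FreeAddGroup (TensorGen X Y)} (h : TensorRel X Y v w) : tmk v = tmk w :=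
  Quotient.sound (s := (addConGen (TensorRel X Y)).toSetoid) (AddConGen.Rel.of _ _ h)

/-- The element `x ⊚̲ y`. -/
def circU (x : X.e) (y : Y.e) : TensorE X Y := tmk (wCircU X Y x y)
/-- The element `x ⊚ y`. -/
def circ (x : X.e) (y : Y.e) : TensorE X Y := tmk (wCirc X Y x y)
/-- The element `a ⊗̄ b`. -/
def bar (a : X.ee) (b : Y.ee) : TensorE X Y := tmk (wBar X Y a b)

theorem tmk_surjective : Function.Surjective (tmk (X := X) (Y := Y)) := AddCon.mk'_surjective

theorem bar_add_left (a a' : X.ee) (b : Y.ee) : bar (a + a') b = bar a b + bar a' b :=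
  (tmk_rel (.bar_add_left a a' b)).trans (map_add _ _ _)
theorem bar_add_right (a : X.ee) (b b' : Y.ee) : bar a (b + b') = bar a b + bar a b' :=
  (tmk_rel (.bar_add_right a b b')).trans (map_add _ _ _)
theorem bar_comm (a : X.ee) (b : Y.ee) (g : TensorE X Y) : bar a b + g = g + bar a b := by
  obtain ⟨w, rfl⟩ := tmk_surjective g
  have := tmk_rel (.bar_central a b w)
  rwa [map_add, map_add] at this
theorem circU_add (x : X.e) (y y' : Y.e) : circU x (y + y') = circU x y + circU x y' :=
  (tmk_rel (.circU_add x y y')).trans (map_add _ _ _)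
theorem add_circ (x x' : X.e) (y : Y.e) : circ (x + x') y = circ x y + circ x' y :=
  (tmk_rel (.add_circ x x' y)).trans (map_add _ _ _)
theorem P_circU (a : X.ee) (y : Y.e) : circU (X.P a) y = bar a (Y.Δ y) := tmk_rel (.P_circU a y)
theorem circ_P (x : X.e) (b : Y.ee) : circ x (Y.P b) = bar (X.Δ x) b := tmk_rel (.circ_P x b)
theorem bar_T (a : X.ee) (b : Y.ee) : bar (X.T a) (Y.T b) = - bar a b :=
  (tmk_rel (.bar_T a b)).trans (map_neg _ _)
theorem circU_sub_circ (x : X.e) (y : Y.e) :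
    circU x y - circ x y = bar (X.H x) (Y.T (Y.H y)) :=
  (map_sub _ _ _).symm.trans (tmk_rel (.circU_sub_circ x y))

@[elab_as_elim]
theorem tensorE_induction {p : TensorE X Y → Prop} (h0 : p 0) (hneg : ∀ g, p g → p (-g))
    (hadd : ∀ g h, p g → p h → p (g + h)) (hu : ∀ x y, p (circU x y)) (ho : ∀ x y, p (circ x y))
    (hb : ∀ a b, p (bar a b)) (g : TensorE X Y) : p g := by
  obtain ⟨w, rfl⟩ := tmk_surjective g
  have hof : ∀ s, p (tmk (FreeAddGroup.of s)) := by
    rintro (⟨x, y⟩ | ⟨x, y⟩ | ⟨a, b⟩)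
    exacts [hu x y, ho x y, hb a b]
  induction w using FreeAddGroup.induction_on with
  | C1 => rw [map_zero]; exact h0
  | of s => exact hof s
  | neg_of s _ => rw [map_neg]; exact hneg _ (hof s)
  | add v w hv hw => rw [map_add]; exact hadd _ _ hv hw

/-- The universal property of `(X ⊙ Y)_e` given by its presentation. -/
def tensorELift {G : Type*} [AddGroup G] (F : TensorGen X Y → G)
    (hF : ∀ v w, TensorRel X Y v w → FreeAddGroup.lift F v = FreeAddGroup.lift F w) :
    TensorE X Y →+ G :=
  (addConGen (TensorRel X Y)).lift (FreeAddGroup.lift F) (AddCon.addConGen_le.2 hF)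

section lift
variable {G : Type*} [AddGroup G] (F : TensorGen X Y → G)
    (hF : ∀ v w, TensorRel X Y v w → FreeAddGroup.lift F v = FreeAddGroup.lift F w)
@[simp] theorem tensorELift_circU (x : X.e) (y : Y.e) :
    tensorELift F hF (circU x y) = F (.circU x y) := FreeAddGroup.lift_apply_of ..
@[simp] theorem tensorELift_circ (x : X.e) (y : Y.e) :
    tensorELift F hF (circ x y) = F (.circ x y) := FreeAddGroup.lift_apply_of ..
@[simp] theorem tensorELift_bar (a : X.ee) (b : Y.ee) :
    tensorELift F hF (bar a b) = F (.bar a b) := FreeAddGroup.lift_apply_of ..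
end lift

instance : AddCommGroup (AddSubgroup.center (TensorE X Y)) :=
  { (inferInstance : AddGroup (AddSubgroup.center (TensorE X Y))) with
    add_comm := fun a b => Subtype.ext (AddSubgroup.mem_center_iff.1 b.2 a) }

/-- The element `a ⊗̄ b`, as a biadditive function with values in the centre of `(X ⊙ Y)_e`. -/
def barCenter : X.ee →ₗ[ℤ] Y.ee →ₗ[ℤ] AddSubgroup.center (TensorE X Y) :=
  (AddMonoidHom.mk' (fun a => (AddMonoidHom.mk' (fun b => (⟨bar a b,
      AddSubgroup.mem_center_iff.2 fun g => (bar_comm a b g).symm⟩ :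
        AddSubgroup.center (TensorE X Y)))
      fun b b' => Subtype.ext (bar_add_right a b b')).toIntLinearMap)
    fun a a' => LinearMap.ext fun b => Subtype.ext (bar_add_left a a' b)).toIntLinearMap

/-- The homomorphism `P : X_ee ⊗ Y_ee → (X ⊙ Y)_e` with `P(a ⊗ b) = a ⊗̄ b`. -/
def tensorP : X.ee ⊗[ℤ] Y.ee →+ TensorE X Y :=
  (AddSubgroup.center (TensorE X Y)).subtype.comp
    (TensorProduct.lift (barCenter (X := X) (Y := Y))).toAddMonoidHom

@[simp] theorem tensorP_tmul (a : X.ee) (b : Y.ee) : tensorP (a ⊗ₜ[ℤ] b) = bar a b := rfl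

theorem tensorP_comm (t : X.ee ⊗[ℤ] Y.ee) (g : TensorE X Y) :
    tensorP t + g = g + tensorP t :=
  (AddSubgroup.mem_center_iff.1 (TensorProduct.lift (barCenter (X := X) (Y := Y)) t).2 g).symm

theorem zero_bar (b : Y.ee) : bar (0 : X.ee) b = 0 := by
  rw [← tensorP_tmul, TensorProduct.zero_tmul, map_zero]

theorem bar_zero (a : X.ee) : bar a (0 : Y.ee) = 0 := by
  rw [← tensorP_tmul, TensorProduct.tmul_zero, map_zero]

theorem neg_bar (a : X.ee) (b : Y.ee) : bar (-a) b = - bar a b := by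
  rw [← tensorP_tmul, TensorProduct.neg_tmul, map_neg, tensorP_tmul]

theorem bar_neg (a : X.ee) (b : Y.ee) : bar a (-b) = - bar a b := by
  rw [← tensorP_tmul, TensorProduct.tmul_neg, map_neg, tensorP_tmul]

theorem circU_eq (x : X.e) (y : Y.e) :
    circU x y = circ x y + bar (X.H x) (Y.T (Y.H y)) := by
  rw [← bar_comm, ← circU_sub_circ, sub_add_cancel]

theorem add_circU (x x' : X.e) (y : Y.e) :
    circU (x + x') y = circU x y + circU x' y + bar (X.cr x' x) (Y.H y) := by
  have h : bar (X.cr x x') (Y.T (Y.H y)) = bar (X.cr x' x) (Y.H y) := by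
    have h1 : X.cr x x' = - X.T (X.cr x' x) := by rw [cr_self_swap, neg_neg]
    rw [h1, neg_bar, bar_T, neg_neg]
  rw [circU_eq, circU_eq x, circU_eq x', add_circ, H_add, bar_add_left, bar_add_left, h]
  have c := bar_comm (X.H x) (Y.T (Y.H y)) (circ x' y)
  generalize bar (X.H x) (Y.T (Y.H y)) = p at c ⊢
  generalize bar (X.H x') (Y.T (Y.H y)) = q
  calc circ x y + circ x' y + (p + q + bar (X.cr x' x) (Y.H y))
      = circ x y + (circ x' y + p) + q + bar (X.cr x' x) (Y.H y) := by simp only [add_assoc]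
    _ = circ x y + p + (circ x' y + q) + bar (X.cr x' x) (Y.H y) := by
      rw [← c]; simp only [add_assoc]

theorem central_cancel {G : Type*} [AddGroup G] {A B C D p q r : G} (hp : ∀ g, p + g = g + p)
    (hr : ∀ g, r + g = g + r)
    (h : A + B + p + (C + D + q) = A + C + (B + D) + (p + q + r)) : B + C = C + B + r := by
  have h1 : A + (B + C) + (D + (p + q)) = A + (C + B + r) + (D + (p + q)) := by
    calc A + (B + C) + (D + (p + q)) = A + B + (C + D + (p + q)) := by simp only [add_assoc]
      _ = A + B + p + (C + D + q) := by
        rw [← add_assoc (C + D), ← hp (C + D)]; simp only [add_assoc]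
      _ = A + C + (B + D) + (p + q + r) := h
      _ = A + (C + B) + (D + (p + q) + r) := by simp only [add_assoc]
      _ = A + (C + B + r) + (D + (p + q)) := by rw [← hr]; simp only [add_assoc]
  exact add_left_cancel (add_right_cancel h1)

theorem circU_add_circU_comm (x x' : X.e) (y y' : Y.e) :
    circU x y + circU x' y' =
      circU x' y' + circU x y + bar (X.cr x x') (Y.cr y y') := by
  have h : circU (x' + x) (y + y') = circU (x' + x) (y + y') := rfl
  conv_lhs at h => rw [circU_add, add_circU, add_circU]
  conv_rhs at h => rw [add_circU, circU_add, circU_add, H_add, bar_add_right, bar_add_right]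
  exact central_cancel (bar_comm _ _) (bar_comm _ _) h

/-- The projection of `(X ⊙ Y)_e` onto `Coker P ⊗ Coker P`. -/
def tensorProj : TensorE X Y →+ X.cokerP ⊗[ℤ] Y.cokerP :=
  tensorELift (fun s => match s with
    | .circU x y => X.toCokerP x ⊗ₜ Y.toCokerP y
    | .circ x y => X.toCokerP x ⊗ₜ Y.toCokerP y
    | .bar _ _ => 0) (by
      intro v w h
      cases h <;> simp [wCircU, wCirc, wBar, TensorProduct.tmul_add, TensorProduct.add_tmul])

/-- The bilinear form `(x ⊗ y, x' ⊗ y') ↦ (x|x')_H ⊗ (y|y')_H`. -/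
def tensorForm : X.cokerP ⊗[ℤ] Y.cokerP →ₗ[ℤ] X.cokerP ⊗[ℤ] Y.cokerP →ₗ[ℤ] X.ee ⊗[ℤ] Y.ee :=
  TensorProduct.map₂ X.crLin Y.crLin

/-- The cross effect of the quadratic map `H` on `(X ⊙ Y)_e`. -/
def tensorCr : TensorE X Y →+ TensorE X Y →+ X.ee ⊗[ℤ] Y.ee :=
  AddMonoidHom.mk' (fun g => (tensorForm (tensorProj g)).toAddMonoidHom.comp tensorProj)
    fun g g' => AddMonoidHom.ext fun h => by simp

end presentation

/-- For a biadditive `β`, the set `G × A` with the group law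
`(g, a) + (h, b) = (g + h, a + b + β(g, h))`. Homomorphic sections of the projection to `G` are the
functions `G → A` with cross effect `β`. -/
@[ext]
structure QuadExt {G A : Type u} [AddGroup G] [AddCommGroup A] (β : G →+ G →+ A) : Type u where
  fst : G
  snd : A

namespace QuadExt

variable {G A : Type u} [AddGroup G] [AddCommGroup A] (β : G →+ G →+ A)

instance : Add (QuadExt β) := ⟨fun p q => ⟨p.fst + q.fst, p.snd + q.snd + β p.fst q.fst⟩⟩
instance : Zero (QuadExt β) := ⟨⟨0, 0⟩⟩
instance : Neg (QuadExt β) := ⟨fun p => ⟨-p.fst, -p.snd + β p.fst p.fst⟩⟩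

@[simp] theorem add_fst (p q : QuadExt β) : (p + q).fst = p.fst + q.fst := rfl
@[simp] theorem add_snd (p q : QuadExt β) :
    (p + q).snd = p.snd + q.snd + β p.fst q.fst := rfl
@[simp] theorem zero_fst : (0 : QuadExt β).fst = 0 := rfl
@[simp] theorem zero_snd : (0 : QuadExt β).snd = 0 := rfl
@[simp] theorem neg_fst (p : QuadExt β) : (-p).fst = -p.fst := rfl
@[simp] theorem neg_snd (p : QuadExt β) : (-p).snd = -p.snd + β p.fst p.fst := rfl

instance : AddGroup (QuadExt β) :=
  AddGroup.ofLeftAxioms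
    (fun p q r => QuadExt.ext (by simp [add_assoc]) (by simp; abel))
    (fun p => QuadExt.ext (by simp) (by simp))
    (fun p => QuadExt.ext (by simp) (by simp))

/-- The projection to `G`. -/
def fstHom : QuadExt β →+ G := AddMonoidHom.mk' QuadExt.fst fun _ _ => rfl

@[simp] theorem fstHom_apply (p : QuadExt β) : fstHom β p = p.fst := rfl

end QuadExt

section tensorH

variable {X Y : SquareGroup.{u}}

@[simp] theorem tensorProj_circU (x : X.e) (y : Y.e) :
    tensorProj (circU x y) = X.toCokerP x ⊗ₜ Y.toCokerP y := by simp [tensorProj]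
@[simp] theorem tensorProj_circ (x : X.e) (y : Y.e) :
    tensorProj (circ x y) = X.toCokerP x ⊗ₜ Y.toCokerP y := by simp [tensorProj]
@[simp] theorem tensorProj_bar (a : X.ee) (b : Y.ee) :
    tensorProj (bar a b) = 0 := by simp [tensorProj]

theorem tensorCr_apply (g h : TensorE X Y) :
    tensorCr g h = tensorForm (tensorProj g) (tensorProj h) := rfl

@[simp] theorem tensorForm_tmul (x x' : X.e) (y y' : Y.e) :
    tensorForm (X.toCokerP x ⊗ₜ[ℤ] Y.toCokerP y) (X.toCokerP x' ⊗ₜ[ℤ] Y.toCokerP y') =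
      X.cr x x' ⊗ₜ[ℤ] Y.cr y y' := rfl

/-- The values of `H` on the generators of `(X ⊙ Y)_e`. -/
def tensorHGen : TensorGen X Y → X.ee ⊗[ℤ] Y.ee
  | .circU x y => X.cr x x ⊗ₜ Y.H y + X.H x ⊗ₜ Y.Δ y
  | .circ x y => X.Δ x ⊗ₜ Y.H y + X.H x ⊗ₜ Y.cr y y
  | .bar a b => a ⊗ₜ b - X.T a ⊗ₜ Y.T b

/-- The homomorphic section `g ↦ (g, H(g))`. -/
def tensorHLift : TensorE X Y →+ QuadExt (tensorCr (X := X) (Y := Y)) :=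
  tensorELift (fun s => ⟨tmk (FreeAddGroup.of s), tensorHGen s⟩) (by
    intro v w h
    have hfst : ∀ v : FreeAddGroup (TensorGen X Y),
        (FreeAddGroup.lift (fun s => (⟨tmk (FreeAddGroup.of s), tensorHGen s⟩ :
          QuadExt (tensorCr (X := X) (Y := Y)))) v).fst = tmk v := by
      intro v
      have : (QuadExt.fstHom _).comp (FreeAddGroup.lift (fun s =>
          (⟨tmk (FreeAddGroup.of s), tensorHGen s⟩ :
          QuadExt (tensorCr (X := X) (Y := Y))))) = tmk := by
        ext s; simp
      exact DFunLike.congr_fun this v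
    apply QuadExt.ext
    · rw [hfst, hfst]; exact tmk_rel h
    · clear hfst
      have hu : ∀ x y, tmk (FreeAddGroup.of (TensorGen.circU x y)) = circU (X := X) (Y := Y) x y :=
        fun _ _ => rfl
      have ho : ∀ x y, tmk (FreeAddGroup.of (TensorGen.circ x y)) = circ (X := X) (Y := Y) x y :=
        fun _ _ => rfl
      have hb : ∀ x y, tmk (FreeAddGroup.of (TensorGen.bar x y)) = bar (X := X) (Y := Y) x y :=
        fun _ _ => rfl
      cases h <;> simp only [wCircU, wCirc, wBar, FreeAddGroup.lift_apply_of, map_add, map_neg,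
        sub_eq_add_neg, QuadExt.add_snd, QuadExt.neg_snd, QuadExt.neg_fst,
        hu, ho, hb, tensorHGen, tensorCr_apply, tensorProj_bar, tensorProj_circU,
        tensorProj_circ, map_zero, LinearMap.zero_apply, tensorForm_tmul, 
        H_add, H_P, T_Δ, T_T, cr_P_left, TensorProduct.zero_tmul, TensorProduct.tmul_zero, TensorProduct.add_tmul, TensorProduct.tmul_add,
        TensorProduct.neg_tmul, TensorProduct.tmul_neg, add_zero, zero_add, neg_neg]
      case circU_sub_circ => simp only [Δ_apply, sub_eq_add_neg, TensorProduct.add_tmul,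
        TensorProduct.tmul_add, TensorProduct.neg_tmul, TensorProduct.tmul_neg]; abel
      all_goals abel)

theorem tensorHLift_fst (g : TensorE X Y) : (tensorHLift g).fst = g := by
  have : ((QuadExt.fstHom _).comp (tensorHLift (X := X) (Y := Y))).comp tmk = tmk := by
    ext s; rcases s with _ | _ | _ <;> rfl
  obtain ⟨w, rfl⟩ := tmk_surjective g
  exact DFunLike.congr_fun this w

/-- The quadratic map `H : (X ⊙ Y)_e → X_ee ⊗ Y_ee`. -/
def tensorH (g : TensorE X Y) : X.ee ⊗[ℤ] Y.ee := (tensorHLift g).snd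

@[simp] theorem tensorH_circU (x : X.e) (y : Y.e) :
    tensorH (circU x y) = X.cr x x ⊗ₜ Y.H y + X.H x ⊗ₜ Y.Δ y := by
  simp [tensorH, tensorHLift, tensorHGen]
@[simp] theorem tensorH_circ (x : X.e) (y : Y.e) :
    tensorH (circ x y) = X.Δ x ⊗ₜ Y.H y + X.H x ⊗ₜ Y.cr y y := by
  simp [tensorH, tensorHLift, tensorHGen]
@[simp] theorem tensorH_bar (a : X.ee) (b : Y.ee) :
    tensorH (bar a b) = a ⊗ₜ b - X.T a ⊗ₜ Y.T b := by
  simp [tensorH, tensorHLift, tensorHGen]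

theorem tensorH_add (g h : TensorE X Y) :
    tensorH (g + h) = tensorH g + tensorH h + tensorCr g h := by
  simp [tensorH, tensorHLift_fst]

theorem crossEffect_tensorH (g h : TensorE X Y) : crossEffect tensorH g h = tensorCr g h := by
  rw [crossEffect, tensorH_add]; abel

@[simp] theorem tensorProj_tensorP (t : X.ee ⊗[ℤ] Y.ee) : tensorProj (tensorP t) = 0 := by
  induction t using TensorProduct.induction_on with
  | zero => simp
  | tmul a b => simp
  | add s t hs ht => rw [map_add, map_add, hs, ht, add_zero]

/-- The statement `[g, h] = P(g|h)_H`, in a form that is convenient for induction. -/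
def TComm (g h : TensorE X Y) : Prop := g + h = h + g + tensorP (tensorCr g h)

theorem TComm.add_right {g h h' : TensorE X Y} (H : TComm g h) (H' : TComm g h') :
    TComm g (h + h') := by
  unfold TComm at *
  calc g + (h + h') = h + g + (tensorP (tensorCr g h) + h') := by
        rw [← add_assoc, H, add_assoc]
    _ = h + (g + h') + tensorP (tensorCr g h) := by rw [tensorP_comm]; simp only [add_assoc]
    _ = h + h' + g + tensorP (tensorCr g (h + h')) := by
      rw [H', map_add, map_add, tensorP_comm (tensorCr g h) (tensorP (tensorCr g h'))]
      simp only [add_assoc]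

theorem TComm.neg_right {g h : TensorE X Y} (H : TComm g h) : TComm g (-h) := by
  unfold TComm at *
  rw [map_neg, map_neg]
  apply add_right_cancel (b := tensorP (tensorCr g h) + h)
  calc g + -h + (tensorP (tensorCr g h) + h) = g + tensorP (tensorCr g h) := by
        rw [tensorP_comm]; simp [add_assoc]
    _ = -h + (h + g + tensorP (tensorCr g h)) := by simp [add_assoc]
    _ = -h + g + -tensorP (tensorCr g h) + (tensorP (tensorCr g h) + h) := by
      rw [← H]; simp [add_assoc]

theorem TComm.add_left {g g' h : TensorE X Y} (H : TComm g h) (H' : TComm g' h) :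
    TComm (g + g') h := by
  unfold TComm at *
  calc g + g' + h = (g + h) + g' + tensorP (tensorCr g' h) := by
        rw [add_assoc, H']; simp only [add_assoc]
    _ = h + g + (tensorP (tensorCr g h) + g') + tensorP (tensorCr g' h) := by
        rw [H]; simp only [add_assoc]
    _ = h + (g + g') + tensorP (tensorCr (g + g') h) := by
      rw [tensorP_comm, map_add, AddMonoidHom.add_apply, map_add]
      simp only [add_assoc]

theorem TComm.neg_left {g h : TensorE X Y} (H : TComm g h) : TComm (-g) h := by
  unfold TComm at *
  rw [map_neg, AddMonoidHom.neg_apply, map_neg]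
  apply add_left_cancel (a := g)
  calc g + (-g + h) = (h + g + tensorP (tensorCr g h)) + (-g + -tensorP (tensorCr g h)) := by
        rw [add_assoc, ← add_assoc (tensorP _) (-g), tensorP_comm]; simp [add_assoc]
    _ = g + (h + -g + -tensorP (tensorCr g h)) := by rw [← H]; simp only [add_assoc]

theorem TComm.bar_right (g : TensorE X Y) (a : X.ee) (b : Y.ee) : TComm g (bar a b) := by
  simp [TComm, tensorCr_apply, bar_comm]

theorem TComm.bar_left (a : X.ee) (b : Y.ee) (g : TensorE X Y) : TComm (bar a b) g := by
  simp [TComm, tensorCr_apply, bar_comm]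

theorem TComm.zero_right (g : TensorE X Y) : TComm g 0 := by simp [TComm]

theorem TComm.zero_left (g : TensorE X Y) : TComm 0 g := by simp [TComm]

theorem circ_eq (x : X.e) (y : Y.e) :
    circ x y = circU x y + - bar (X.H x) (Y.T (Y.H y)) := by
  rw [circU_eq, add_assoc, add_neg_cancel, add_zero]

theorem tComm (g h : TensorE X Y) : TComm g h := by
  have hU : ∀ g : TensorE X Y, (∀ x y, TComm g (circU x y)) → ∀ h, TComm g h := by
    intro g hg h
    induction h using tensorE_induction with
    | h0 => exact .zero_right g
    | hneg h ih => exact ih.neg_right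
    | hadd h h' ih ih' => exact ih.add_right ih'
    | hu x y => exact hg x y
    | ho x y => rw [circ_eq]; exact (hg x y).add_right (TComm.bar_right _ _ _).neg_right
    | hb a b => exact .bar_right g a b
  refine hU g (fun x' y' => ?_) h
  have hb : ∀ x y, TComm (circU x y) (circU (X := X) (Y := Y) x' y') := by
    intro x y
    simpa [TComm, tensorCr_apply] using circU_add_circU_comm x x' y y'
  clear h
  induction g using tensorE_induction with
  | h0 => exact .zero_left _
  | hneg h ih => exact ih.neg_left
  | hadd h h' ih ih' => exact ih.add_left ih'
  | hu x y => exact hb x y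
  | ho x y => rw [circ_eq]; exact (hb x y).add_left (TComm.bar_left _ _ _).neg_left
  | hb a b => exact .bar_left a b _

theorem tensorP_tensorH_tensorP (t : X.ee ⊗[ℤ] Y.ee) :
    tensorP (tensorH (tensorP t)) = tensorP t + tensorP t := by
  induction t using TensorProduct.induction_on with
  | zero =>
    have : tensorH (0 : TensorE X Y) = 0 := by simp [tensorH]
    simp [this]
  | tmul a b => simp [bar_T]
  | add s t hs ht =>
    have hst : tensorCr (tensorP s) (tensorP t) = 0 := by simp [tensorCr_apply]
    rw [map_add, tensorH_add, hst, add_zero, map_add, hs, ht]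
    simp only [← map_add]
    congr 1
    abel

variable (X Y)

/-- The tensor product `X ⊙ Y` of square groups. -/
def tensor : SquareGroup.{u} where
  e := TensorE X Y
  ee := X.ee ⊗[ℤ] Y.ee
  P := tensorP
  H := tensorH
  isSq :=
    { cross_add_left := fun a a' b => by simp [crossEffect_tensorH]
      cross_add_right := fun a b b' => by simp [crossEffect_tensorH]
      cross_P_left := fun x b => by simp [crossEffect_tensorH, tensorCr_apply]
      cross_P_right := fun a y => by simp [crossEffect_tensorH, tensorCr_apply]
      P_cross := fun a b => by
        have := tComm a b
        rw [TComm] at this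
        rw [crossEffect_tensorH, add_assoc _ a b, this]
        simp [sub_eq_add_neg, add_assoc]
      P_H_P := tensorP_tensorH_tensorP }

/-- `x ⊚̲ y` as an element of the square group `X ⊙ Y`. -/
def tU (x : X.e) (y : Y.e) : (tensor X Y).e := circU x y
/-- `x ⊚ y` as an element of the square group `X ⊙ Y`. -/
def tO (x : X.e) (y : Y.e) : (tensor X Y).e := circ x y

variable {X Y}

/-- The homomorphism `(f ⊙ g)_e`. -/
def tensorMapE {X' Y' : SquareGroup.{u}} (f : X ⟶ X') (g : Y ⟶ Y') : TensorE X Y →+ TensorE X' Y' :=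
  tensorELift (fun s => match s with
    | .circU x y => circU (f.e x) (g.e y)
    | .circ x y => circ (f.e x) (g.e y)
    | .bar a b => bar (f.ee a) (g.ee b)) (by
      intro v w h
      cases h with
      | bar_central a b g' => simp [wBar, bar_comm]
      | _ => simp [wCircU, wCirc, wBar, bar_add_left, bar_add_right, circU_add, add_circ, P_circU,
          circ_P, bar_T, circU_sub_circ, f.map_P, g.map_P, map_T, map_Δ, f.map_H, g.map_H])

/-- The homomorphism `(f ⊙ g)_ee`. -/
def tensorMapEE {X' Y' : SquareGroup.{u}} (f : X ⟶ X') (g : Y ⟶ Y') :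
    X.ee ⊗[ℤ] Y.ee →+ X'.ee ⊗[ℤ] Y'.ee :=
  (TensorProduct.map f.ee.toIntLinearMap g.ee.toIntLinearMap).toAddMonoidHom

section
variable {X' Y' : SquareGroup.{u}} (f : X ⟶ X') (g : Y ⟶ Y')

@[simp] theorem tensorMapE_circU (x : X.e) (y : Y.e) :
    tensorMapE f g (circU x y) = circU (f.e x) (g.e y) := by simp [tensorMapE]
@[simp] theorem tensorMapE_circ (x : X.e) (y : Y.e) :
    tensorMapE f g (circ x y) = circ (f.e x) (g.e y) := by simp [tensorMapE]
@[simp] theorem tensorMapE_bar (a : X.ee) (b : Y.ee) :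
    tensorMapE f g (bar a b) = bar (f.ee a) (g.ee b) := by simp [tensorMapE]
@[simp] theorem tensorMapEE_tmul (a : X.ee) (b : Y.ee) :
    tensorMapEE f g (a ⊗ₜ[ℤ] b) = f.ee a ⊗ₜ[ℤ] g.ee b := rfl

theorem tensorMapE_tensorP (t : X.ee ⊗[ℤ] Y.ee) :
    tensorMapE f g (tensorP t) = tensorP (tensorMapEE f g t) := by
  induction t using TensorProduct.induction_on with
  | zero => simp
  | tmul a b => simp
  | add s t hs ht => rw [map_add, map_add, map_add, map_add, hs, ht]

/-- The homomorphism induced by `f` on the cokernels of `P`. -/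
def cokerPMap (f : X ⟶ X') : X.cokerP →+ X'.cokerP :=
  QuotientAddGroup.lift X.P.range (X'.toCokerP.comp f.e) (by
    rintro _ ⟨a, rfl⟩
    change X'.toCokerP (f.e (X.P a)) = 0
    rw [f.map_P, toCokerP_P])

@[simp] theorem cokerPMap_toCokerP (x : X.e) :
    cokerPMap f (X.toCokerP x) = X'.toCokerP (f.e x) := rfl

theorem toCokerP_surjective : Function.Surjective X.toCokerP := QuotientAddGroup.mk'_surjective _

theorem tensorProj_tensorMapE (h : TensorE X Y) :
    tensorProj (tensorMapE f g h) = TensorProduct.map (cokerPMap f).toIntLinearMap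
      (cokerPMap g).toIntLinearMap (tensorProj h) := by
  induction h using tensorE_induction with
  | h0 => simp
  | hneg h ih => simp [ih]
  | hadd h h' ih ih' => simp [ih, ih']
  | hu x y => simp
  | ho x y => simp
  | hb a b => simp

theorem tensorMapEE_tensorForm (s t : X.cokerP ⊗[ℤ] Y.cokerP) :
    tensorMapEE f g (tensorForm s t) = tensorForm
      (TensorProduct.map (cokerPMap f).toIntLinearMap (cokerPMap g).toIntLinearMap s)
      (TensorProduct.map (cokerPMap f).toIntLinearMap (cokerPMap g).toIntLinearMap t) := by
  induction s using TensorProduct.induction_on with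
  | zero => simp
  | add s s' hs hs' => simp [hs, hs']
  | tmul a b =>
    induction t using TensorProduct.induction_on with
    | zero => simp
    | add s s' hs hs' => simp [hs, hs']
    | tmul a' b' =>
      obtain ⟨a, rfl⟩ := toCokerP_surjective a
      obtain ⟨b, rfl⟩ := toCokerP_surjective b
      obtain ⟨a', rfl⟩ := toCokerP_surjective a'
      obtain ⟨b', rfl⟩ := toCokerP_surjective b'
      simp [map_cr]

theorem tensorMapEE_tensorCr (h k : TensorE X Y) :
    tensorMapEE f g (tensorCr h k) = tensorCr (tensorMapE f g h) (tensorMapE f g k) := by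
  rw [tensorCr_apply, tensorCr_apply, tensorMapEE_tensorForm, tensorProj_tensorMapE,
    tensorProj_tensorMapE]

theorem tensorH_zero : tensorH (0 : TensorE X Y) = 0 := by simp [tensorH]

theorem tensorH_neg (h : TensorE X Y) : tensorH (-h) = - tensorH h + tensorCr h h := by
  simp [tensorH, tensorHLift_fst]

theorem tensorMapEE_tensorH (h : TensorE X Y) :
    tensorMapEE f g (tensorH h) = tensorH (tensorMapE f g h) := by
  induction h using tensorE_induction with
  | h0 => simp [tensorH_zero]
  | hneg h ih => rw [tensorH_neg, map_neg, tensorH_neg, map_add, map_neg, ih, tensorMapEE_tensorCr]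
  | hadd h h' ih ih' =>
    rw [tensorH_add, map_add, map_add, map_add, tensorH_add, ih, ih', tensorMapEE_tensorCr]
  | hu x y => simp [map_cr, map_Δ, f.map_H, g.map_H]
  | ho x y => simp [map_cr, map_Δ, f.map_H, g.map_H]
  | hb a b => simp [map_T]

end

/-- The morphism `f ⊙ g`. -/
def tensorMap {X' Y' : SquareGroup.{u}} (f : X ⟶ X') (g : Y ⟶ Y') :
    tensor X Y ⟶ tensor X' Y' where
  e := tensorMapE f g
  ee := tensorMapEE f g
  map_P := tensorMapE_tensorP f g
  map_H := tensorMapEE_tensorH f g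

theorem tensor_hom_ext {Z : SquareGroup.{u}} {f g : tensor X Y ⟶ Z}
    (h₁ : ∀ x y, f.e (tU X Y x y) = g.e (tU X Y x y))
    (h₂ : ∀ a b, f.ee (a ⊗ₜ[ℤ] b : X.ee ⊗[ℤ] Y.ee) = g.ee (a ⊗ₜ[ℤ] b : X.ee ⊗[ℤ] Y.ee)) :
    f = g := by
  have hee : ∀ t : X.ee ⊗[ℤ] Y.ee, f.ee t = g.ee t := by
    intro t
    induction t using TensorProduct.induction_on with
    | zero => exact (map_zero f.ee).trans (map_zero g.ee).symm
    | tmul a b => exact h₂ a b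
    | add s t hs ht => exact (map_add f.ee s t).trans ((congrArg₂ _ hs ht).trans
        (map_add g.ee s t).symm)
  have hb : ∀ a b, f.e (bar a b : TensorE X Y) = g.e (bar a b : TensorE X Y) := fun a b =>
    (f.map_P (a ⊗ₜ[ℤ] b : X.ee ⊗[ℤ] Y.ee)).trans ((congrArg _ (hee _)).trans
      (g.map_P (a ⊗ₜ[ℤ] b : X.ee ⊗[ℤ] Y.ee)).symm)
  refine hom_ext (fun x => ?_) hee
  induction (x : TensorE X Y) using tensorE_induction with
  | h0 => exact (map_zero f.e).trans (map_zero g.e).symm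
  | hneg h ih => exact (map_neg f.e h).trans ((congrArg _ ih).trans (map_neg g.e h).symm)
  | hadd h h' ih ih' => exact (map_add f.e h h').trans ((congrArg₂ _ ih ih').trans
        (map_add g.e h h').symm)
  | hu x y => exact h₁ x y
  | ho x y =>
    rw [circ_eq]
    exact (map_add f.e _ _).trans ((congrArg₂ _ (h₁ x y) ((map_neg f.e _).trans
      ((congrArg _ (hb _ _)).trans (map_neg g.e _).symm))).trans (map_add g.e _ _).symm)
  | hb a b => exact hb a b

theorem tensorMap_id : tensorMap (𝟙 X) (𝟙 Y) = 𝟙 (tensor X Y) :=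
  tensor_hom_ext (fun x y => tensorMapE_circU (𝟙 X) (𝟙 Y) x y)
    (fun a b => tensorMapEE_tmul (𝟙 X) (𝟙 Y) a b)

theorem tensorMap_comp {X' Y' X'' Y'' : SquareGroup.{u}} (f : X ⟶ X') (f' : X' ⟶ X'')
    (g : Y ⟶ Y') (g' : Y' ⟶ Y'') :
    tensorMap (f ≫ f') (g ≫ g') = tensorMap f g ≫ tensorMap f' g' :=
  tensor_hom_ext (fun x y => by
      change tensorMapE _ _ (circU x y) = tensorMapE _ _ (tensorMapE _ _ (circU x y))
      simp)
    (fun a b => by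
      change tensorMapEE _ _ (a ⊗ₜ[ℤ] b) = tensorMapEE _ _ (tensorMapEE _ _ (a ⊗ₜ[ℤ] b))
      simp)

end tensorH

end SquareGroup

/-! ### Push-outs of square groups -/

namespace SquareGroup

section pushout

variable {Z X Y : SquareGroup.{u}} (f : Z ⟶ X) (g : Z ⟶ Y)

/-- Formal expressions in the elements of `X` and `Y`, of sort `e` (index `true`) and of sort `ee`
(index `false`). -/
inductive PushTerm (X Y : SquareGroup.{u}) : Bool → Type u
  | inl_e (x : X.e) : PushTerm X Y true
  | inr_e (y : Y.e) : PushTerm X Y true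
  | inl_ee (a : X.ee) : PushTerm X Y false
  | inr_ee (b : Y.ee) : PushTerm X Y false
  | zero (s : Bool) : PushTerm X Y s
  | neg {s : Bool} (t : PushTerm X Y s) : PushTerm X Y s
  | add {s : Bool} (t t' : PushTerm X Y s) : PushTerm X Y s
  | P (t : PushTerm X Y false) : PushTerm X Y true
  | H (t : PushTerm X Y true) : PushTerm X Y false

namespace PushTerm

/-- The formal cross effect `H(a+b) - H(b) - H(a)`. -/
def cr (a b : PushTerm X Y true) : PushTerm X Y false := (H (a.add b)).add ((H b).neg.add (H a).neg)

end PushTerm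

open PushTerm in
/-- The smallest congruence on formal expressions which turns them into a square group, which makes
the two inclusions morphisms, and which identifies the images of `Z`. -/
inductive PushRel : ∀ {s : Bool}, PushTerm X Y s → PushTerm X Y s → Prop
  | refl {s} (t : PushTerm X Y s) : PushRel t t
  | symm {s} {t t' : PushTerm X Y s} : PushRel t t' → PushRel t' t
  | trans {s} {t t' t'' : PushTerm X Y s} : PushRel t t' → PushRel t' t'' → PushRel t t''
  | neg_congr {s} {t t' : PushTerm X Y s} : PushRel t t' → PushRel t.neg t'.neg
  | add_congr {s} {t t' v v' : PushTerm X Y s} :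
      PushRel t t' → PushRel v v' → PushRel (t.add v) (t'.add v')
  | P_congr {t t' : PushTerm X Y false} : PushRel t t' → PushRel t.P t'.P
  | H_congr {t t' : PushTerm X Y true} : PushRel t t' → PushRel t.H t'.H
  | add_assoc {s} (a b c : PushTerm X Y s) : PushRel ((a.add b).add c) (a.add (b.add c))
  | zero_add {s} (a : PushTerm X Y s) : PushRel ((PushTerm.zero s).add a) a
  | neg_add {s} (a : PushTerm X Y s) : PushRel (a.neg.add a) (PushTerm.zero s)
  | add_comm (a b : PushTerm X Y false) : PushRel (a.add b) (b.add a)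
  | P_add (a b : PushTerm X Y false) : PushRel (a.add b).P (a.P.add b.P)
  | cr_add_left (a a' b : PushTerm X Y true) : PushRel ((a.add a').cr b) ((a.cr b).add (a'.cr b))
  | cr_add_right (a b b' : PushTerm X Y true) : PushRel (a.cr (b.add b')) ((a.cr b).add (a.cr b'))
  | cr_P_left (a : PushTerm X Y false) (b : PushTerm X Y true) : PushRel (a.P.cr b) (PushTerm.zero false)
  | cr_P_right (a : PushTerm X Y true) (b : PushTerm X Y false) : PushRel (a.cr b.P) (PushTerm.zero false)
  | P_cr (a b : PushTerm X Y true) : PushRel (a.cr b).P ((a.neg.add b.neg).add (a.add b))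
  | P_H_P (a : PushTerm X Y false) : PushRel a.P.H.P (a.P.add a.P)
  | inl_e_add (x x' : X.e) : PushRel (inl_e (x + x')) ((inl_e x).add (inl_e x'))
  | inr_e_add (y y' : Y.e) : PushRel (inr_e (y + y')) ((inr_e y).add (inr_e y'))
  | inl_ee_add (x x' : X.ee) : PushRel (inl_ee (x + x')) ((inl_ee x).add (inl_ee x'))
  | inr_ee_add (y y' : Y.ee) : PushRel (inr_ee (y + y')) ((inr_ee y).add (inr_ee y'))
  | inl_P (a : X.ee) : PushRel (inl_e (X.P a)) (inl_ee a).P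
  | inr_P (b : Y.ee) : PushRel (inr_e (Y.P b)) (inr_ee b).P
  | inl_H (x : X.e) : PushRel (inl_ee (X.H x)) (inl_e x).H
  | inr_H (y : Y.e) : PushRel (inr_ee (Y.H y)) (inr_e y).H
  | glue_e (z : Z.e) : PushRel (inl_e (f.e z)) (inr_e (g.e z))
  | glue_ee (z : Z.ee) : PushRel (inl_ee (f.ee z)) (inr_ee (g.ee z))

/-- The expressions of sort `s` modulo the congruence. -/
def PushCarrier (s : Bool) : Type u :=
  Quotient (⟨PushRel f g (s := s), ⟨.refl, .symm, .trans⟩⟩ : Setoid (PushTerm X Y s))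

/-- The class of an expression. -/
def pushMk {s : Bool} (t : PushTerm X Y s) : PushCarrier f g s := Quotient.mk _ t

variable {f g} in
theorem pushMk_rel {s : Bool} {t t' : PushTerm X Y s} (h : PushRel f g t t') :
    pushMk f g t = pushMk f g t' := Quotient.sound h

theorem pushMk_surjective {s : Bool} : Function.Surjective (pushMk f g (s := s)) :=
  Quotient.mk_surjective

instance (s : Bool) : Add (PushCarrier f g s) :=
  ⟨Quotient.map₂ PushTerm.add fun _ _ h _ _ h' => .add_congr h h'⟩
instance (s : Bool) : Neg (PushCarrier f g s) :=
  ⟨Quotient.map PushTerm.neg fun _ _ h => .neg_congr h⟩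
instance (s : Bool) : Zero (PushCarrier f g s) := ⟨pushMk f g (.zero s)⟩

theorem pushMk_add {s : Bool} (t t' : PushTerm X Y s) :
    pushMk f g (t.add t') = pushMk f g t + pushMk f g t' := rfl
theorem pushMk_neg {s : Bool} (t : PushTerm X Y s) : pushMk f g t.neg = - pushMk f g t := rfl
theorem pushMk_zero (s : Bool) : pushMk f g (.zero s) = 0 := rfl

instance (s : Bool) : AddGroup (PushCarrier f g s) :=
  AddGroup.ofLeftAxioms
    (fun a b c => by
      obtain ⟨a, rfl⟩ := pushMk_surjective f g a
      obtain ⟨b, rfl⟩ := pushMk_surjective f g b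
      obtain ⟨c, rfl⟩ := pushMk_surjective f g c
      exact pushMk_rel (.add_assoc a b c))
    (fun a => by
      obtain ⟨a, rfl⟩ := pushMk_surjective f g a
      exact pushMk_rel (.zero_add a))
    (fun a => by
      obtain ⟨a, rfl⟩ := pushMk_surjective f g a
      exact pushMk_rel (.neg_add a))

instance : AddCommGroup (PushCarrier f g false) :=
  { (inferInstance : AddGroup (PushCarrier f g false)) with
    add_comm := fun a b => by
      obtain ⟨a, rfl⟩ := pushMk_surjective f g a
      obtain ⟨b, rfl⟩ := pushMk_surjective f g b
      exact pushMk_rel (.add_comm a b) }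

/-- The homomorphism `P` of the push-out. -/
def pushP : PushCarrier f g false →+ PushCarrier f g true :=
  AddMonoidHom.mk' (Quotient.map PushTerm.P fun _ _ h => .P_congr h) fun a b => by
    obtain ⟨a, rfl⟩ := pushMk_surjective f g a
    obtain ⟨b, rfl⟩ := pushMk_surjective f g b
    exact pushMk_rel (.P_add a b)

/-- The quadratic map `H` of the push-out. -/
def pushH : PushCarrier f g true → PushCarrier f g false :=
  Quotient.map PushTerm.H fun _ _ h => .H_congr h

theorem pushMk_cr (a b : PushTerm X Y true) :
    pushMk f g (a.cr b) = crossEffect (pushH f g) (pushMk f g a) (pushMk f g b) := by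
  rw [crossEffect, sub_eq_add_neg, sub_eq_add_neg, add_assoc]
  rfl

/-- The push-out of two morphisms of square groups with a common source. -/
def pushout : SquareGroup.{u} where
  e := PushCarrier f g true
  ee := PushCarrier f g false
  P := pushP f g
  H := pushH f g
  isSq :=
    { cross_add_left := fun a a' b => by
        obtain ⟨a, rfl⟩ := pushMk_surjective f g a
        obtain ⟨a', rfl⟩ := pushMk_surjective f g a'
        obtain ⟨b, rfl⟩ := pushMk_surjective f g b
        rw [← pushMk_add, ← pushMk_cr, ← pushMk_cr, ← pushMk_cr]
        exact pushMk_rel (.cr_add_left a a' b)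
      cross_add_right := fun a b b' => by
        obtain ⟨a, rfl⟩ := pushMk_surjective f g a
        obtain ⟨b, rfl⟩ := pushMk_surjective f g b
        obtain ⟨b', rfl⟩ := pushMk_surjective f g b'
        rw [← pushMk_add, ← pushMk_cr, ← pushMk_cr, ← pushMk_cr]
        exact pushMk_rel (.cr_add_right a b b')
      cross_P_left := fun a b => by
        obtain ⟨a, rfl⟩ := pushMk_surjective f g a
        obtain ⟨b, rfl⟩ := pushMk_surjective f g b
        exact (pushMk_cr f g a.P b).symm.trans (pushMk_rel (.cr_P_left a b))
      cross_P_right := fun a b => by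
        obtain ⟨a, rfl⟩ := pushMk_surjective f g a
        obtain ⟨b, rfl⟩ := pushMk_surjective f g b
        exact (pushMk_cr f g a b.P).symm.trans (pushMk_rel (.cr_P_right a b))
      P_cross := fun a b => by
        obtain ⟨a, rfl⟩ := pushMk_surjective f g a
        obtain ⟨b, rfl⟩ := pushMk_surjective f g b
        rw [← pushMk_cr, sub_eq_add_neg, add_assoc _ (pushMk f g a) (pushMk f g b)]
        exact pushMk_rel (.P_cr a b)
      P_H_P := fun a => by
        obtain ⟨a, rfl⟩ := pushMk_surjective f g a
        exact pushMk_rel (.P_H_P a) }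

/-- The first inclusion into the push-out. -/
def pushInl : X ⟶ pushout f g where
  e := AddMonoidHom.mk' (fun x => pushMk f g (.inl_e x)) fun x x' => pushMk_rel (.inl_e_add x x')
  ee := AddMonoidHom.mk' (fun x => pushMk f g (.inl_ee x)) fun x x' => pushMk_rel (.inl_ee_add x x')
  map_P a := pushMk_rel (.inl_P a)
  map_H x := pushMk_rel (.inl_H x)

/-- The second inclusion into the push-out. -/
def pushInr : Y ⟶ pushout f g where
  e := AddMonoidHom.mk' (fun x => pushMk f g (.inr_e x)) fun x x' => pushMk_rel (.inr_e_add x x')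
  ee := AddMonoidHom.mk' (fun x => pushMk f g (.inr_ee x)) fun x x' => pushMk_rel (.inr_ee_add x x')
  map_P a := pushMk_rel (.inr_P a)
  map_H x := pushMk_rel (.inr_H x)

theorem push_condition : f ≫ pushInl f g = g ≫ pushInr f g :=
  hom_ext (fun z => pushMk_rel (.glue_e z)) (fun z => pushMk_rel (.glue_ee z))

variable {f g}
variable {W : SquareGroup.{u}} (h : X ⟶ W) (k : Y ⟶ W)

/-- The carriers of a square group, indexed by the sort. -/
def carrier (W : SquareGroup.{u}) : Bool → Type u
  | true => W.e
  | false => W.ee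

instance (W : SquareGroup.{u}) (s : Bool) : AddGroup (W.carrier s) :=
  match s with
  | true => W.addGroup
  | false => W.addCommGroup.toAddGroup

/-- Evaluation of formal expressions in a square group `W` under `X` and `Y`. -/
def pushEval : ∀ {s : Bool}, PushTerm X Y s → W.carrier s
  | _, .inl_e x => h.e x
  | _, .inr_e y => k.e y
  | _, .inl_ee a => h.ee a
  | _, .inr_ee b => k.ee b
  | _, .zero _ => 0
  | _, .neg t => - pushEval t
  | _, .add t t' => pushEval t + pushEval t'
  | _, .P t => W.P (pushEval t)
  | _, .H t => W.H (pushEval t)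

theorem pushEval_cr (a b : PushTerm X Y true) :
    pushEval h k (a.cr b) = W.cr (pushEval h k a) (pushEval h k b) := by
  change W.H (pushEval h k a + pushEval h k b) +
    (- W.H (pushEval h k b) + - W.H (pushEval h k a)) = _
  simp only [cr, crossEffect, sub_eq_add_neg, ← add_assoc]
  rfl

theorem pushEval_rel (w : f ≫ h = g ≫ k) {s : Bool} {t t' : PushTerm X Y s}
    (r : PushRel f g t t') : pushEval h k t = pushEval h k t' := by
  induction r with
  | refl t => rfl
  | symm _ ih => exact ih.symm
  | trans _ _ ih ih' => exact ih.trans ih'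
  | neg_congr _ ih => exact congrArg (fun z => -z) ih
  | add_congr _ _ ih ih' => exact congrArg₂ (fun z z' => z + z') ih ih'
  | P_congr _ ih => exact congrArg W.P ih
  | H_congr _ ih => exact congrArg W.H ih
  | add_assoc a b c => exact add_assoc _ _ _
  | zero_add a => exact zero_add _
  | neg_add a => exact neg_add_cancel _
  | add_comm a b => exact add_comm (G := W.ee) _ _
  | P_add a b => exact map_add W.P _ _
  | cr_add_left a a' b =>
    change pushEval h k (PushTerm.cr _ _) =
      pushEval h k (PushTerm.cr _ _) + pushEval h k (PushTerm.cr _ _)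
    rw [pushEval_cr, pushEval_cr, pushEval_cr]
    exact W.cr_add_left _ _ _
  | cr_add_right a b b' =>
    change pushEval h k (PushTerm.cr _ _) =
      pushEval h k (PushTerm.cr _ _) + pushEval h k (PushTerm.cr _ _)
    rw [pushEval_cr, pushEval_cr, pushEval_cr]
    exact W.cr_add_right _ _ _
  | cr_P_left a b => rw [pushEval_cr]; exact W.cr_P_left _ _
  | cr_P_right a b => rw [pushEval_cr]; exact W.cr_P_right _ _
  | P_cr a b =>
    change W.P (pushEval h k (PushTerm.cr _ _)) = _
    rw [pushEval_cr]
    have e : ∀ x y : W.e, -x - y + x + y = (-x + -y) + (x + y) := fun x y => by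
      rw [sub_eq_add_neg, add_assoc]
    exact (W.P_cr _ _).trans (e _ _)
  | P_H_P a => exact W.P_H_P _
  | inl_e_add x x' => exact map_add h.e _ _
  | inr_e_add x x' => exact map_add k.e _ _
  | inl_ee_add x x' => exact map_add h.ee _ _
  | inr_ee_add x x' => exact map_add k.ee _ _
  | inl_P a => exact h.map_P a
  | inr_P a => exact k.map_P a
  | inl_H a => exact h.map_H a
  | inr_H a => exact k.map_H a
  | glue_e z => exact DFunLike.congr_fun (congrArg Hom.e w) z
  | glue_ee z => exact DFunLike.congr_fun (congrArg Hom.ee w) z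

/-- The morphism out of the push-out given by a commutative square. -/
def pushDesc (w : f ≫ h = g ≫ k) : pushout f g ⟶ W where
  e := AddMonoidHom.mk' (Quotient.lift (pushEval h k (s := true)) fun _ _ => pushEval_rel h k w)
    fun a b => by
      obtain ⟨a, rfl⟩ := pushMk_surjective f g a
      obtain ⟨b, rfl⟩ := pushMk_surjective f g b
      rfl
  ee := AddMonoidHom.mk' (Quotient.lift (pushEval h k (s := false)) fun _ _ => pushEval_rel h k w)
    fun a b => by
      obtain ⟨a, rfl⟩ := pushMk_surjective f g a
      obtain ⟨b, rfl⟩ := pushMk_surjective f g b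
      rfl
  map_P a := by
    obtain ⟨a, rfl⟩ := pushMk_surjective f g a
    rfl
  map_H a := by
    obtain ⟨a, rfl⟩ := pushMk_surjective f g a
    rfl

theorem pushInl_desc (w : f ≫ h = g ≫ k) : pushInl f g ≫ pushDesc h k w = h := rfl

theorem pushInr_desc (w : f ≫ h = g ≫ k) : pushInr f g ≫ pushDesc h k w = k := rfl

theorem push_hom_ext {p q : pushout f g ⟶ W} (hl : pushInl f g ≫ p = pushInl f g ≫ q)
    (hr : pushInr f g ≫ p = pushInr f g ≫ q) : p = q := by
  have key : ∀ {s : Bool} (t : PushTerm X Y s), match s, t with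
      | true, t => p.e (pushMk f g t) = q.e (pushMk f g t)
      | false, t => p.ee (pushMk f g t) = q.ee (pushMk f g t) := by
    intro s t
    induction t with
    | inl_e x => exact DFunLike.congr_fun (congrArg Hom.e hl) x
    | inr_e x => exact DFunLike.congr_fun (congrArg Hom.e hr) x
    | inl_ee x => exact DFunLike.congr_fun (congrArg Hom.ee hl) x
    | inr_ee x => exact DFunLike.congr_fun (congrArg Hom.ee hr) x
    | zero s =>
      cases s
      exacts [(map_zero p.ee).trans (map_zero q.ee).symm, (map_zero p.e).trans (map_zero q.e).symm]
    | @neg s t ih =>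
      cases s
      exacts [(map_neg p.ee _).trans ((congrArg _ ih).trans (map_neg q.ee _).symm),
        (map_neg p.e _).trans ((congrArg _ ih).trans (map_neg q.e _).symm)]
    | @add s t t' ih ih' =>
      cases s
      exacts [(map_add p.ee _ _).trans ((congrArg₂ _ ih ih').trans (map_add q.ee _ _).symm),
        (map_add p.e _ _).trans ((congrArg₂ _ ih ih').trans (map_add q.e _ _).symm)]
    | P t ih => exact (p.map_P _).trans ((congrArg _ ih).trans (q.map_P _).symm)
    | H t ih => exact (p.map_H _).trans ((congrArg _ ih).trans (q.map_H _).symm)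
  refine hom_ext (fun x => ?_) (fun x => ?_)
  · obtain ⟨x, rfl⟩ := pushMk_surjective f g x
    exact key x
  · obtain ⟨x, rfl⟩ := pushMk_surjective f g x
    exact key x

variable (f g) in
theorem isPushout : IsPushout f g (pushInl f g) (pushInr f g) where
  w := push_condition f g
  isColimit' := ⟨PushoutCocone.IsColimit.mk _ (fun s => pushDesc s.inl s.inr s.condition)
    (fun _ => pushInl_desc _ _ _) (fun _ => pushInr_desc _ _ _)
    (fun _ _ hl hr => push_hom_ext hl hr)⟩

end pushout

end SquareGroup

/-! ### Quadratic pair modules -/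

/-- A quadratic pair module `C`, that is, a morphism `∂ : C_(1) → C_(0)` of square groups with
`C_(0) = (C_0 ⇄ C_ee)`, `C_(1) = (C_1 ⇄ C_ee)` and `∂_ee = 1`. It is given by the diagram
`P : C_ee → C_1`, `∂ : C_1 → C_0`, `H : C_0 → C_ee`; the structure maps of `C_(0)` are `∂P` and `H`,
those of `C_(1)` are `P` and `H∂`. -/
structure QPM : Type (u + 1) where
  C0 : Type u
  C1 : Type u
  Cee : Type u
  [addGroup0 : AddGroup C0]
  [addGroup1 : AddGroup C1]
  [addCommGroup : AddCommGroup Cee]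
  P : Cee →+ C1
  d : C1 →+ C0
  H : C0 → Cee
  isSq0 : IsSquareGroup (d.comp P) H
  isSq1 : IsSquareGroup P (fun x => H (d x))

namespace QPM

attribute [instance] addGroup0 addGroup1 addCommGroup

/-- A morphism of quadratic pair modules. -/
@[ext]
structure Hom (C D : QPM.{u}) : Type u where
  f0 : C.C0 →+ D.C0
  f1 : C.C1 →+ D.C1
  fee : C.Cee →+ D.Cee
  map_P : ∀ a, f1 (C.P a) = D.P (fee a)
  map_d : ∀ x, f0 (C.d x) = D.d (f1 x)
  map_H : ∀ x, fee (C.H x) = D.H (f0 x)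

instance : Category QPM.{u} where
  Hom := Hom
  id C := { f0 := AddMonoidHom.id _, f1 := AddMonoidHom.id _, fee := AddMonoidHom.id _,
            map_P := fun _ => rfl, map_d := fun _ => rfl, map_H := fun _ => rfl }
  comp f g :=
    { f0 := g.f0.comp f.f0, f1 := g.f1.comp f.f1, fee := g.fee.comp f.fee
      map_P := fun a => by simp [f.map_P, g.map_P]
      map_d := fun a => by simp [f.map_d, g.map_d]
      map_H := fun a => by simp [f.map_H, g.map_H] }

@[ext]
theorem hom_ext {C D : QPM.{u}} {f g : C ⟶ D} (h₀ : ∀ x, f.f0 x = g.f0 x)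
    (h₁ : ∀ x, f.f1 x = g.f1 x) (h₂ : ∀ a, f.fee a = g.fee a) : f = g :=
  Hom.ext (AddMonoidHom.ext h₀) (AddMonoidHom.ext h₁) (AddMonoidHom.ext h₂)

/-- The square group `C_(0)`. -/
def sq0 (C : QPM.{u}) : SquareGroup.{u} where
  e := C.C0
  ee := C.Cee
  P := C.d.comp C.P
  H := C.H
  isSq := C.isSq0

/-- The square group `C_(1)`. -/
def sq1 (C : QPM.{u}) : SquareGroup.{u} where
  e := C.C1
  ee := C.Cee
  P := C.P
  H x := C.H (C.d x)
  isSq := C.isSq1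

/-- The morphism `∂ : C_(1) → C_(0)`. -/
def sqd (C : QPM.{u}) : C.sq1 ⟶ C.sq0 where
  e := C.d
  ee := AddMonoidHom.id _
  map_P _ := rfl
  map_H _ := rfl

/-- The morphism `f_(0) : C_(0) → D_(0)`. -/
def map0 {C D : QPM.{u}} (f : C ⟶ D) : C.sq0 ⟶ D.sq0 where
  e := f.f0
  ee := f.fee
  map_P a := (f.map_d _).trans (congrArg D.d (f.map_P a))
  map_H := f.map_H

/-- The morphism `f_(1) : C_(1) → D_(1)`. -/
def map1 {C D : QPM.{u}} (f : C ⟶ D) : C.sq1 ⟶ D.sq1 where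
  e := f.f1
  ee := f.fee
  map_P := f.map_P
  map_H a := (f.map_H _).trans (congrArg D.H (f.map_d a))

theorem map_sqd {C D : QPM.{u}} (f : C ⟶ D) : map1 f ≫ D.sqd = C.sqd ≫ map0 f :=
  SquareGroup.hom_ext (fun x => (f.map_d x).symm) (fun _ => rfl)

/-- A quadratic pair module `C` is `0`-good if the square group `C_(0)` is good. -/
def isZeroGood : ObjectProperty QPM.{u} := fun C => C.sq0.IsGood

/-! #### The reflection of pairs of square groups -/

section Phi

variable {D C : SquareGroup.{u}} (f : D ⟶ C)

/-- The relations defining the group `Φ(f)_1` as a quotient of `D_e × C_ee`. -/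
inductive PhiRel : D.e × C.ee → D.e × C.ee → Prop
  | ee (a : D.ee) : PhiRel (0, f.ee a) (D.P a, 0)
  | HP (c : C.ee) : PhiRel (0, C.H (C.P c)) (0, c + c)

/-- The group `Φ(f)_1`. -/
abbrev Phi1 : Type u := (addConGen (PhiRel f)).Quotient

/-- The projection `D_e × C_ee → Φ(f)_1`. -/
def phiMk : D.e × C.ee →+ Phi1 f := (addConGen (PhiRel f)).mk'

theorem phiMk_surjective : Function.Surjective (phiMk f) := AddCon.mk'_surjective

theorem phiMk_rel {p q : D.e × C.ee} (h : PhiRel f p q) : phiMk f p = phiMk f q :=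
  Quotient.sound (s := (addConGen (PhiRel f)).toSetoid) (AddConGen.Rel.of _ _ h)

/-- The homomorphism `P : C_ee → Φ(f)_1`, `P(c) = (0, c)`. -/
def phiP : C.ee →+ Phi1 f := (phiMk f).comp (AddMonoidHom.inr D.e C.ee)

/-- The homomorphism `D_e → Φ(f)_1`, `d ↦ (d, 0)`. -/
def phiUnit : D.e →+ Phi1 f := (phiMk f).comp (AddMonoidHom.inl D.e C.ee)

theorem phiMk_eq (p : D.e × C.ee) : phiMk f p = phiUnit f p.1 + phiP f p.2 := by
  rw [phiUnit, phiP, AddMonoidHom.comp_apply, AddMonoidHom.comp_apply, ← map_add]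
  simp

/-- A homomorphism out of `Φ(f)_1`. -/
def phiLift {G : Type*} [AddGroup G] (α : D.e →+ G) (β : C.ee →+ G)
    (hc : ∀ c x, β c + α x = α x + β c) (h1 : ∀ a, β (f.ee a) = α (D.P a))
    (h2 : ∀ c, β (C.H (C.P c)) = β c + β c) : Phi1 f →+ G :=
  (addConGen (PhiRel f)).lift
    (AddMonoidHom.mk' (fun p => α p.1 + β p.2) fun p q => by
      simp only [Prod.fst_add, Prod.snd_add, map_add, add_assoc]
      rw [← add_assoc (β p.2) (α q.1), hc]
      simp only [add_assoc])
    (AddCon.addConGen_le.2 (by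
      rintro _ _ (a | c)
      · simp [AddCon.ker_rel, h1]
      · simp [AddCon.ker_rel, h2]))

theorem phiLift_mk {G : Type*} [AddGroup G] (α : D.e →+ G) (β : C.ee →+ G)
    (hc : ∀ c x, β c + α x = α x + β c) (h1 : ∀ a, β (f.ee a) = α (D.P a))
    (h2 : ∀ c, β (C.H (C.P c)) = β c + β c) (p : D.e × C.ee) :
    phiLift f α β hc h1 h2 (phiMk f p) = α p.1 + β p.2 := rfl

/-- The homomorphism `∂ : Φ(f)_1 → C_e`, `∂(d, c) = f_e(d) + P(c)`. -/
def phiD : Phi1 f →+ C.e :=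
  phiLift f f.e C.P (fun c _ => C.P_comm c _) (fun a => (f.map_P a).symm) C.P_H_P

theorem phiD_mk (p : D.e × C.ee) : phiD f (phiMk f p) = f.e p.1 + C.P p.2 := rfl

theorem phiD_phiP (c : C.ee) : phiD f (phiP f c) = C.P c :=
  (phiD_mk f (0, c)).trans (by simp)

/-- The quadratic pair module `Φ(f)` associated with a morphism of square groups. -/
def Phi : QPM.{u} where
  C0 := C.e
  C1 := Phi1 f
  Cee := C.ee
  P := phiP f
  d := phiD f
  H := C.H
  isSq0 := by
    have : (phiD f).comp (phiP f) = C.P := AddMonoidHom.ext (phiD_phiP f)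
    rw [this]
    exact C.isSq
  isSq1 := by
    have hcr : ∀ a b, crossEffect (fun x => C.H (phiD f x)) a b = C.cr (phiD f a) (phiD f b) :=
      fun a b => by simp [crossEffect, SquareGroup.cr]
    constructor
    · intro a a' b; rw [hcr, hcr, hcr, map_add, C.cr_add_left]
    · intro a b b'; rw [hcr, hcr, hcr, map_add, C.cr_add_right]
    · intro a b; rw [hcr, phiD_phiP, C.cr_P_left]
    · intro a b; rw [hcr, phiD_phiP, C.cr_P_right]
    · intro a b
      obtain ⟨⟨x, c⟩, rfl⟩ := phiMk_surjective f a
      obtain ⟨⟨y, c'⟩, rfl⟩ := phiMk_surjective f b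
      have h : C.cr (phiD f (phiMk f (x, c))) (phiD f (phiMk f (y, c'))) = f.ee (D.cr x y) := by
        rw [phiD_mk, phiD_mk, SquareGroup.map_cr]
        simp [C.cr_add_left, C.cr_add_right]
      rw [hcr, h]
      refine (phiMk_rel f (.ee (D.cr x y))).trans ?_
      rw [D.P_cr, ← map_neg, ← map_sub, ← map_add, ← map_add]
      congr 1
      ext
      · simp
      · simp only [Prod.snd_add, Prod.snd_sub, Prod.snd_neg]; abel
    · intro c
      change phiP f (C.H (phiD f (phiP f c))) = phiP f c + phiP f c
      rw [phiD_phiP, ← map_add]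
      exact phiMk_rel f (.HP c)

variable {f}
variable {D' C' : SquareGroup.{u}} {f' : D' ⟶ C'}

/-- The homomorphism `Φ(f)_1 → Φ(f')_1` induced by a morphism of pairs `(α, β)`. -/
def phiMap1 (α : D ⟶ D') (β : C ⟶ C') (w : α ≫ f' = f ≫ β) : Phi1 f →+ Phi1 f' :=
  phiLift f ((phiUnit f').comp α.e) ((phiP f').comp β.ee)
    (fun c x => by
      change phiMk f' _ + phiMk f' _ = phiMk f' _ + phiMk f' _
      rw [← map_add, ← map_add]
      simp)
    (fun a => by
      have h : β.ee (f.ee a) = f'.ee (α.ee a) :=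
        (DFunLike.congr_fun (congrArg SquareGroup.Hom.ee w) a).symm
      change phiMk f' (0, β.ee (f.ee a)) = phiMk f' (α.e (D.P a), 0)
      rw [h, α.map_P]
      exact phiMk_rel f' (.ee _))
    (fun c => by
      change phiMk f' (0, β.ee (C.H (C.P c))) = phiP f' (β.ee c) + phiP f' (β.ee c)
      rw [β.map_H, β.map_P, ← map_add]
      exact phiMk_rel f' (.HP _))

theorem phiMap1_mk (α : D ⟶ D') (β : C ⟶ C') (w : α ≫ f' = f ≫ β) (p : D.e × C.ee) :
    phiMap1 α β w (phiMk f p) = phiMk f' (α.e p.1, β.ee p.2) :=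
  (phiMk_eq f' (α.e p.1, β.ee p.2)).symm

/-- The morphism `Φ(f) → Φ(f')` induced by a morphism of pairs `(α, β)`. -/
def phiMap (α : D ⟶ D') (β : C ⟶ C') (w : α ≫ f' = f ≫ β) : Phi f ⟶ Phi f' where
  f0 := β.e
  f1 := phiMap1 α β w
  fee := β.ee
  map_P c := (phiMap1_mk α β w (0, c)).trans (congrArg (fun z => phiMk f' (z, β.ee c))
    (map_zero α.e))
  map_d x := by
    obtain ⟨⟨x, c⟩, rfl⟩ := phiMk_surjective f x
    have h : β.e (f.e x) = f'.e (α.e x) :=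
      (DFunLike.congr_fun (congrArg SquareGroup.Hom.e w) x).symm
    have h2 : β.e (phiD f (phiMk f (x, c))) = phiD f' (phiMap1 α β w (phiMk f (x, c))) := by
      rw [phiMap1_mk, phiD_mk, phiD_mk, map_add, h, β.map_P]
    exact h2
  map_H := β.map_H

theorem phi_hom_ext {E : QPM.{u}} {p q : Phi f ⟶ E}
    (h0 : ∀ x : C.e, p.f0 x = q.f0 x) (h1 : ∀ x : D.e, p.f1 (phiUnit f x) = q.f1 (phiUnit f x))
    (hee : ∀ x : C.ee, p.fee x = q.fee x) : p = q := by
  refine hom_ext h0 (fun x => ?_) hee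
  obtain ⟨x, rfl⟩ := phiMk_surjective f x
  rw [phiMk_eq]
  refine (map_add p.f1 _ _).trans ((congrArg₂ _ (h1 _) ?_).trans (map_add q.f1 _ _).symm)
  exact (p.map_P _).trans ((congrArg _ (hee _)).trans (q.map_P _).symm)

theorem phiMap_id {α : D ⟶ D} {β : C ⟶ C} (w : α ≫ f = f ≫ β) (hα : α = 𝟙 D) (hβ : β = 𝟙 C) :
    phiMap α β w = 𝟙 (Phi f) := by
  subst hα hβ
  exact phi_hom_ext (fun _ => rfl) (fun x => phiMap1_mk _ _ w (x, 0)) (fun _ => rfl)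

theorem phiMap_comp {D'' C'' : SquareGroup.{u}} {f'' : D'' ⟶ C''} {α : D ⟶ D'} {β : C ⟶ C'}
    {α' : D' ⟶ D''} {β' : C' ⟶ C''} {α'' : D ⟶ D''} {β'' : C ⟶ C''} (w : α ≫ f' = f ≫ β)
    (w' : α' ≫ f'' = f' ≫ β') (w'' : α'' ≫ f'' = f ≫ β'') (hα : α'' = α ≫ α')
    (hβ : β'' = β ≫ β') : phiMap α'' β'' w'' = phiMap α β w ≫ phiMap α' β' w' := by
  subst hα hβ
  refine hom_ext (fun _ => rfl) (fun x => ?_) (fun _ => rfl)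
  obtain ⟨x, rfl⟩ := phiMk_surjective f x
  have h : phiMap1 _ _ w'' (phiMk f x) = phiMap1 _ _ w' (phiMap1 _ _ w (phiMk f x)) := by
    rw [phiMap1_mk, phiMap1_mk, phiMap1_mk]
    rfl
  exact h

end Phi

/-! #### The tensor product of quadratic pair modules -/

section tensor

open SquareGroup

variable (C D : QPM.{u})

/-- The morphism `1 ⊙ ∂ : C_(1) ⊙ D_(1) → C_(1) ⊙ D_(0)`. -/
def legRight : C.sq1.tensor D.sq1 ⟶ C.sq1.tensor D.sq0 := tensorMap (𝟙 C.sq1) D.sqd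

/-- The morphism `∂ ⊙ 1 : C_(1) ⊙ D_(1) → C_(0) ⊙ D_(1)`. -/
def legLeft : C.sq1.tensor D.sq1 ⟶ C.sq0.tensor D.sq1 := tensorMap C.sqd (𝟙 D.sq1)

/-- The morphism from the push-out of `1 ⊙ ∂` and `∂ ⊙ 1` to `C_(0) ⊙ D_(0)`, which is induced by
`∂ ⊙ 1` and `1 ⊙ ∂`. -/
def dBar : pushout (legRight C D) (legLeft C D) ⟶ C.sq0.tensor D.sq0 :=
  pushDesc (tensorMap C.sqd (𝟙 D.sq0)) (tensorMap (𝟙 C.sq0) D.sqd) (by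
    rw [legRight, legLeft, ← tensorMap_comp, ← tensorMap_comp, Category.id_comp, Category.id_comp,
      Category.comp_id, Category.comp_id])

/-- The tensor product `C ⊙ D` of quadratic pair modules. -/
def tensor : QPM.{u} := Phi (dBar C D)

variable {C D}

/-- The morphism `f ⊙ g`. -/
def tensorMap {C' D' : QPM.{u}} (f : C ⟶ C') (g : D ⟶ D') : tensor C D ⟶ tensor C' D' :=
  phiMap
    (pushDesc
      (SquareGroup.tensorMap (map1 f) (map0 g) ≫ pushInl _ _)
      (SquareGroup.tensorMap (map0 f) (map1 g) ≫ pushInr _ _) (by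
        have h1 : legRight C D ≫ SquareGroup.tensorMap (map1 f) (map0 g) =
            SquareGroup.tensorMap (map1 f) (map1 g) ≫ legRight C' D' := by
          rw [legRight, legRight, ← tensorMap_comp, ← tensorMap_comp, map_sqd, Category.id_comp,
            Category.comp_id]
        have h2 : legLeft C D ≫ SquareGroup.tensorMap (map0 f) (map1 g) =
            SquareGroup.tensorMap (map1 f) (map1 g) ≫ legLeft C' D' := by
          rw [legLeft, legLeft, ← tensorMap_comp, ← tensorMap_comp, map_sqd, Category.id_comp,
            Category.comp_id]
        rw [← Category.assoc, h1, ← Category.assoc, h2, Category.assoc, Category.assoc,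
          push_condition]))
    (SquareGroup.tensorMap (map0 f) (map0 g))
    (by
      apply push_hom_ext
      · change SquareGroup.tensorMap _ _ ≫ SquareGroup.tensorMap _ _ =
          SquareGroup.tensorMap _ _ ≫ SquareGroup.tensorMap _ _
        rw [← tensorMap_comp, ← tensorMap_comp, map_sqd, Category.id_comp, Category.comp_id]
      · change SquareGroup.tensorMap _ _ ≫ SquareGroup.tensorMap _ _ =
          SquareGroup.tensorMap _ _ ≫ SquareGroup.tensorMap _ _
        rw [← tensorMap_comp, ← tensorMap_comp, map_sqd, Category.id_comp, Category.comp_id])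

theorem tensorMap_id : tensorMap (𝟙 C) (𝟙 D) = 𝟙 (tensor C D) := by
  have h0 : map0 (𝟙 C) = 𝟙 _ := rfl
  have h0' : map0 (𝟙 D) = 𝟙 _ := rfl
  have h1 : map1 (𝟙 C) = 𝟙 _ := rfl
  have h1' : map1 (𝟙 D) = 𝟙 _ := rfl
  refine phiMap_id _ (push_hom_ext ?_ ?_) ?_
  · rw [pushInl_desc, h1, h0', SquareGroup.tensorMap_id, Category.id_comp, Category.comp_id]
  · rw [pushInr_desc, h0, h1', SquareGroup.tensorMap_id, Category.id_comp, Category.comp_id]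
  · rw [h0, h0', SquareGroup.tensorMap_id]

theorem tensorMap_comp {C' D' C'' D'' : QPM.{u}} (f : C ⟶ C') (f' : C' ⟶ C'')
    (g : D ⟶ D') (g' : D' ⟶ D'') :
    tensorMap (f ≫ f') (g ≫ g') = tensorMap f g ≫ tensorMap f' g' := by
  have h0 : map0 (f ≫ f') = map0 f ≫ map0 f' := rfl
  have h0' : map0 (g ≫ g') = map0 g ≫ map0 g' := rfl
  have h1 : map1 (f ≫ f') = map1 f ≫ map1 f' := rfl
  have h1' : map1 (g ≫ g') = map1 g ≫ map1 g' := rfl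
  refine phiMap_comp _ _ _ (push_hom_ext ?_ ?_) ?_
  · rw [pushInl_desc, ← Category.assoc (pushInl _ _), pushInl_desc, Category.assoc (_ : _ ⟶ _),
      pushInl_desc, h1, h0', SquareGroup.tensorMap_comp, Category.assoc]
  · rw [pushInr_desc, ← Category.assoc (pushInr _ _), pushInr_desc, Category.assoc (_ : _ ⟶ _),
      pushInr_desc, h0, h1', SquareGroup.tensorMap_comp, Category.assoc]
  · rw [h0, h0', SquareGroup.tensorMap_comp]

variable (C) in
/-- The functor `C ⊙ -`. -/
def tensorLeft : QPM.{u} ⥤ QPM.{u} where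
  obj D := tensor C D
  map g := tensorMap (𝟙 C) g
  map_id _ := tensorMap_id
  map_comp g g' := by rw [← tensorMap_comp, Category.id_comp]

end tensor

end QPM

/-! ### Structure isomorphisms of the tensor product of quadratic pair modules -/

namespace QPM

open SquareGroup

section structureMaps

variable (C D E : QPM.{u})

/-- The homomorphism `υ_e ζ_e : (C_(1) ⊙ D_(0))_e → (C ⊙ D)_1`. -/
def zeta : (C.sq1.tensor D.sq0).e →+ (C.tensor D).C1 :=
  (phiUnit (dBar C D)).comp (pushInl (legRight C D) (legLeft C D)).e

/-- The homomorphism `υ_e ξ_e : (C_(0) ⊙ D_(1))_e → (C ⊙ D)_1`. -/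
def xi : (C.sq0.tensor D.sq1).e →+ (C.tensor D).C1 :=
  (phiUnit (dBar C D)).comp (pushInr (legRight C D) (legLeft C D)).e

/-- The element `x ⊚̲ y` of `(C ⊙ D)_0 = (C_(0) ⊙ D_(0))_e`, for `x` in `C_0` and `y` in `D_0`. -/
def u00 (x : C.C0) (y : D.C0) : (C.tensor D).C0 := tU C.sq0 D.sq0 x y
/-- The element `x ⊚ y` of `(C ⊙ D)_0 = (C_(0) ⊙ D_(0))_e`, for `x` in `C_0` and `y` in `D_0`. -/
def o00 (x : C.C0) (y : D.C0) : (C.tensor D).C0 := tO C.sq0 D.sq0 x y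
/-- The element `x ⊚̲ y` of `(C ⊙ D)_1`, for `x` in `C_1` and `y` in `D_0`. -/
def u10 (x : C.C1) (y : D.C0) : (C.tensor D).C1 := zeta C D (tU C.sq1 D.sq0 x y)
/-- The element `x ⊚̲ y` of `(C ⊙ D)_1`, for `x` in `C_0` and `y` in `D_1`. -/
def u01 (x : C.C0) (y : D.C1) : (C.tensor D).C1 := xi C D (tU C.sq0 D.sq1 x y)
/-- The element `x ⊚ y` of `(C ⊙ D)_1`, for `x` in `C_0` and `y` in `D_1`. -/
def o01 (x : C.C0) (y : D.C1) : (C.tensor D).C1 := xi C D (tO C.sq0 D.sq1 x y)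
/-- The element `a ⊗ b` of `(C ⊙ D)_ee`. -/
def tee (a : C.Cee) (b : D.Cee) : (C.tensor D).Cee := (a ⊗ₜ[ℤ] b : C.Cee ⊗[ℤ] D.Cee)

/-- The associativity morphism `(C ⊙ D) ⊙ E → C ⊙ (D ⊙ E)`, which is
`(x ⊚̲ y) ⊚̲ z ↦ x ⊚̲ (y ⊚̲ z)` in degrees `0` and `1`, and the associativity of the tensor product of
abelian groups in degree `ee`. These values determine the morphism. -/
structure IsAssociator (α : (C.tensor D).tensor E ⟶ C.tensor (D.tensor E)) : Prop where
  map_000 : ∀ x y z, α.f0 (u00 (C.tensor D) E (u00 C D x y) z) = u00 C (D.tensor E) x (u00 D E y z)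
  map_100 : ∀ x y z, α.f1 (u10 (C.tensor D) E (u10 C D x y) z) = u10 C (D.tensor E) x (u00 D E y z)
  map_010 : ∀ x y z, α.f1 (u10 (C.tensor D) E (u01 C D x y) z) = u01 C (D.tensor E) x (u10 D E y z)
  map_001 : ∀ x y z, α.f1 (u01 (C.tensor D) E (u00 C D x y) z) = u01 C (D.tensor E) x (u01 D E y z)
  map_ee : ∀ a b c, α.fee (tee (C.tensor D) E (tee C D a b) c) = tee C (D.tensor E) a (tee D E b c)

/-- The unit quadratic pair module `Φ(0 → ℤ_nil)`. -/
def Zbar : QPM.{u} := Phi (fromZero Znil)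

/-- An integer as an element of degree `0` of the unit. -/
def Zbar.int0 (n : ℤ) : Zbar.{u}.C0 := (ULift.up n : ULift.{u} ℤ)
/-- An integer as an element of degree `ee` of the unit. -/
def Zbar.intee (n : ℤ) : Zbar.{u}.Cee := (ULift.up n : ULift.{u} ℤ)

/-- The left unit morphism `n ⊚ x ↦ n x`, `n ⊗ a ↦ n a`. -/
structure IsLeftUnitor (l : Zbar.tensor C ⟶ C) : Prop where
  map_0 : ∀ (n : ℤ) (x : C.C0), l.f0 (o00 Zbar C (Zbar.int0 n) x) = n • x
  map_1 : ∀ (n : ℤ) (x : C.C1), l.f1 (o01 Zbar C (Zbar.int0 n) x) = n • x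
  map_ee : ∀ (n : ℤ) (a : C.Cee), l.fee (tee Zbar C (Zbar.intee n) a) = n • a

/-- The right unit morphism `x ⊚̲ n ↦ n x`, `a ⊗ n ↦ n a`. -/
structure IsRightUnitor (r : C.tensor Zbar ⟶ C) : Prop where
  map_0 : ∀ (x : C.C0) (n : ℤ), r.f0 (u00 C Zbar x (Zbar.int0 n)) = n • x
  map_1 : ∀ (x : C.C1) (n : ℤ), r.f1 (u10 C Zbar x (Zbar.int0 n)) = n • x
  map_ee : ∀ (a : C.Cee) (n : ℤ), r.fee (tee C Zbar a (Zbar.intee n)) = n • a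

end structureMaps

end QPM

/-- The full subcategory of `0`-good quadratic pair modules. -/
abbrev QPM0 : Type (u + 1) := QPM.isZeroGood.{u}.FullSubcategory

/-- The category of `M`-graded `0`-good quadratic pair modules. -/
abbrev GradedQPM0 (M : Type u) : Type (u + 1) := GradedObject M QPM0.{u}

end

open scoped MonoidalCategory

section

open scoped TensorProduct

/-! ### Homomorphisms out of the tensor product of square groups -/

theorem add_central_add {A G : Type*} [AddCommGroup A] [AddGroup G] {P : A →+ G}
    (hP : ∀ a g, P a + g = g + P a) (x y : G) (a b : A) :
    x + P a + (y + P b) = x + y + P (a + b) := by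
  rw [map_add, add_assoc, ← add_assoc (P a), hP a y]
  simp only [add_assoc]

theorem neg_add_central {A G : Type*} [AddCommGroup A] [AddGroup G] {P : A →+ G}
    (hP : ∀ a g, P a + g = g + P a) (x : G) (a : A) : -(x + P a) = -x + P (-a) := by
  rw [neg_add_rev, ← map_neg, hP]

namespace SquareGroup

variable {X Y Z : SquareGroup.{u}}

theorem T_cr (x y : X.e) : X.T (X.cr x y) = -X.cr y x := X.cr_self_swap x y

theorem circU_P (x : X.e) (b : Y.ee) : circU x (Y.P b) = bar (X.cr x x) b := by
  have h : bar (X.H x) (Y.T b) = -bar (X.T (X.H x)) b := by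
    rw [← bar_T, T_T]
  rw [circU_eq, circ_P, H_P, map_add, T_T, bar_add_right, h, Δ_apply, bar_add_left, sub_eq_add_neg,
    bar_add_left, neg_bar, add_assoc, add_assoc, bar_comm (X.T _), add_assoc (-bar _ _),
    bar_comm (X.H x) b, neg_add_cancel_left, neg_add_cancel, add_zero]

theorem tensor_T (a : X.ee) (b : Y.ee) :
    (X.tensor Y).T (a ⊗ₜ[ℤ] b) = -(X.T a ⊗ₜ[ℤ] Y.T b) := by
  have h : (X.tensor Y).T (a ⊗ₜ[ℤ] b) = tensorH (bar a b) - a ⊗ₜ[ℤ] b := rfl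
  rw [h, tensorH_bar]
  abel

theorem tensor_cr_circU (x x' : X.e) (y y' : Y.e) :
    (X.tensor Y).cr (circU x y) (circU x' y') = X.cr x x' ⊗ₜ[ℤ] Y.cr y y' := by
  refine (crossEffect_tensorH _ _).trans ?_
  rw [tensorCr_apply, tensorProj_circU, tensorProj_circU, tensorForm_tmul]

/-- A homomorphism out of `(X ⊙ Y)_e`, given by its values on the elements `x ⊚̲ y` and `a ⊗̄ b`. -/
def tensorEDesc {A G : Type*} [AddCommGroup A] [AddGroup G] (P : A →+ G)
    (hP : ∀ a g, P a + g = g + P a) (v : X.e → Y.e → G) (p : X.ee →+ Y.ee →+ A)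
    (add_right : ∀ x y y', v x (y + y') = v x y + v x y')
    (add_left : ∀ x x' y, v (x + x') y = v x y + v x' y + P (p (X.cr x' x) (Y.H y)))
    (P_left : ∀ a y, v (X.P a) y = P (p a (Y.Δ y)))
    (P_right : ∀ x b, v x (Y.P b) = P (p (X.cr x x) b))
    (T_T : ∀ a b, P (p (X.T a) (Y.T b)) = -P (p a b)) : TensorE X Y →+ G :=
  tensorELift (fun s => match s with
    | .circU x y => v x y
    | .circ x y => v x y + P (-p (X.H x) (Y.T (Y.H y)))
    | .bar a b => P (p a b)) (by
      intro r w h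
      cases h with
      | bar_add_left a a' b => simp [wBar]
      | bar_add_right a b b' => simp [wBar]
      | bar_central a b g => simp [wBar, hP]
      | circU_add x y y' => simp [wCircU, add_right]
      | add_circ x x' y =>
        simp only [wCirc, map_add, FreeAddGroup.lift_apply_of, add_left, H_add]
        rw [add_central_add hP, add_assoc (v x y + v x' y), ← map_add]
        have h : P (p (X.cr x x') (Y.T (Y.H y))) = P (p (X.cr x' x) (Y.H y)) := by
          have h1 : X.cr x x' = -X.T (X.cr x' x) := by rw [T_cr, neg_neg]
          rw [h1, map_neg, AddMonoidHom.neg_apply, map_neg, T_T, neg_neg]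
        congr 1
        simp only [map_add, AddMonoidHom.add_apply]
        generalize p (X.cr x x') (Y.T (Y.H y)) = c at h ⊢
        simp only [← map_add]
        rw [← sub_eq_zero, ← map_sub]
        have h' : P (p (X.cr x' x) (Y.H y) - c) = 0 := by rw [map_sub, h, sub_self]
        rw [← h']
        congr 1
        abel
      | P_circU a y => simp [wCircU, wBar, P_left]
      | circ_P x b =>
        simp only [wCirc, wBar, FreeAddGroup.lift_apply_of, P_right, H_P, ← map_add]
        have h : P (p (X.H x) (Y.T b)) = -P (p (X.T (X.H x)) b) := by
          have := T_T (X.T (X.H x)) b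
          rwa [SquareGroup.T_T] at this
        simp only [Δ_apply, map_add, map_sub, map_neg, AddMonoidHom.add_apply,
          AddMonoidHom.sub_apply, SquareGroup.T_T, neg_add_rev, h, neg_neg]
        rw [sub_eq_add_neg, add_assoc]
      | bar_T a b => simp [wBar, T_T]
      | circU_sub_circ x y =>
        simp only [wCircU, wCirc, wBar, map_sub, FreeAddGroup.lift_apply_of]
        rw [sub_eq_add_neg, neg_add_central hP, neg_neg, ← add_assoc, add_neg_cancel, zero_add])

section tensorEDesc

variable {A G : Type*} [AddCommGroup A] [AddGroup G] {P : A →+ G}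
    {hP : ∀ a g, P a + g = g + P a} {v : X.e → Y.e → G} {p : X.ee →+ Y.ee →+ A}
    {add_right : ∀ x y y', v x (y + y') = v x y + v x y'}
    {add_left : ∀ x x' y, v (x + x') y = v x y + v x' y + P (p (X.cr x' x) (Y.H y))}
    {P_left : ∀ a y, v (X.P a) y = P (p a (Y.Δ y))}
    {P_right : ∀ x b, v x (Y.P b) = P (p (X.cr x x) b)}
    {T_T : ∀ a b, P (p (X.T a) (Y.T b)) = -P (p a b)}

@[simp] theorem tensorEDesc_circU (x : X.e) (y : Y.e) :
    tensorEDesc P hP v p add_right add_left P_left P_right T_T (circU x y) = v x y :=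
  tensorELift_circU ..

@[simp] theorem tensorEDesc_bar (a : X.ee) (b : Y.ee) :
    tensorEDesc P hP v p add_right add_left P_left P_right T_T (bar a b) = P (p a b) :=
  tensorELift_bar ..

end tensorEDesc

@[elab_as_elim]
theorem tensorE_induction_circU {p : TensorE X Y → Prop} (h0 : p 0) (hneg : ∀ g, p g → p (-g))
    (hadd : ∀ g h, p g → p h → p (g + h)) (hu : ∀ x y, p (circU x y)) (hb : ∀ a b, p (bar a b))
    (g : TensorE X Y) : p g :=
  tensorE_induction h0 hneg hadd hu
    (fun x y => by rw [circ_eq]; exact hadd _ _ (hu _ _) (hneg _ (hb _ _))) hb g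

/-- The homomorphism out of `X_ee ⊗ Y_ee` given by a biadditive map. -/
def liftEE {A : Type*} [AddCommGroup A] (p : X.ee →+ Y.ee →+ A) : X.ee ⊗[ℤ] Y.ee →+ A :=
  TensorProduct.liftAddHom p (by simp)

@[simp] theorem liftEE_tmul {A : Type*} [AddCommGroup A] (p : X.ee →+ Y.ee →+ A) (a : X.ee)
    (b : Y.ee) : liftEE p (a ⊗ₜ[ℤ] b) = p a b := rfl

/-- The data defining a morphism out of `X ⊙ Y`. -/
structure Bilin (X Y Z : SquareGroup.{u}) where
  v : X.e → Y.e → Z.e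
  p : X.ee →+ Y.ee →+ Z.ee
  add_right : ∀ x y y', v x (y + y') = v x y + v x y'
  add_left : ∀ x x' y, v (x + x') y = v x y + v x' y + Z.P (p (X.cr x' x) (Y.H y))
  P_left : ∀ a y, v (X.P a) y = Z.P (p a (Y.Δ y))
  P_right : ∀ x b, v x (Y.P b) = Z.P (p (X.cr x x) b)
  map_T : ∀ a b, Z.T (p a b) = -p (X.T a) (Y.T b)
  map_cr : ∀ x x' y y', Z.cr (v x y) (v x' y') = p (X.cr x x') (Y.cr y y')
  map_H : ∀ x y, Z.H (v x y) = p (X.cr x x) (Y.H y) + p (X.H x) (Y.Δ y)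

namespace Bilin

variable (B : Bilin X Y Z)

/-- The homomorphism `(X ⊙ Y)_e → Z_e`. -/
def descE : TensorE X Y →+ Z.e :=
  tensorEDesc Z.P Z.P_comm B.v B.p B.add_right B.add_left B.P_left B.P_right (fun a b => by
    rw [← Z.P_T (B.p a b), B.map_T, map_neg, neg_neg])

@[simp] theorem descE_circU (x : X.e) (y : Y.e) : B.descE (circU x y) = B.v x y :=
  tensorEDesc_circU ..
@[simp] theorem descE_bar (a : X.ee) (b : Y.ee) : B.descE (bar a b) = Z.P (B.p a b) :=
  tensorEDesc_bar ..

theorem descE_tensorP (t : X.ee ⊗[ℤ] Y.ee) : B.descE (tensorP t) = Z.P (liftEE B.p t) := by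
  induction t using TensorProduct.induction_on with
  | zero => simp
  | tmul a b => simp
  | add s t hs ht => simp [hs, ht]

theorem liftEE_tensorCr (g h : TensorE X Y) :
    liftEE B.p (tensorCr g h) = Z.cr (B.descE g) (B.descE h) := by
  rw [← crHom_apply]
  induction g using tensorE_induction_circU with
  | h0 => simp
  | hneg g ih => simp only [map_neg, AddMonoidHom.neg_apply, ih]
  | hadd g g' ih ih' => simp only [map_add, AddMonoidHom.add_apply, ih, ih']
  | hu x y =>
    induction h using tensorE_induction_circU with
    | h0 => simp only [map_zero]
    | hneg g ih => simp only [map_neg, ih]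
    | hadd g g' ih ih' => simp only [map_add, ih, ih']
    | hu x' y' => simp [tensorCr_apply, B.map_cr]
    | hb a b => simp [tensorCr_apply]
  | hb a b => simp [tensorCr_apply]

theorem H_neg (X : SquareGroup.{u}) (x : X.e) : X.H (-x) = -X.H x + X.cr x x := by
  have h := X.H_add x (-x)
  have h2 : X.cr x (-x) = -X.cr x x := map_neg (X.crHom x) x
  rw [add_neg_cancel, H_zero, h2] at h
  rw [eq_comm, ← sub_eq_zero]
  rw [eq_comm, ← neg_eq_zero] at h
  rw [← h]; abel

theorem liftEE_tensorH (g : TensorE X Y) : liftEE B.p (tensorH g) = Z.H (B.descE g) := by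
  induction g using tensorE_induction_circU with
  | h0 => simp [tensorH_zero]
  | hneg g ih => rw [tensorH_neg, map_add, map_neg, ih, liftEE_tensorCr, map_neg, H_neg]
  | hadd g g' ih ih' => rw [tensorH_add, map_add, map_add, ih, ih', liftEE_tensorCr, map_add, H_add]
  | hu x y => simp [B.map_H]
  | hb a b => simp [H_P, B.map_T, sub_eq_add_neg]

/-- The morphism `X ⊙ Y → Z`. -/
def desc : X.tensor Y ⟶ Z where
  e := B.descE
  ee := liftEE B.p
  map_P := B.descE_tensorP
  map_H := B.liftEE_tensorH

end Bilin

end SquareGroup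

end

section

open scoped TensorProduct

/-! ### Calculus in quadratic pair modules -/

namespace QPM

section calculus

variable (C : QPM.{u})

/-- The cross effect of `H`. -/
def cr : C.C0 →+ C.C0 →+ C.Cee := C.sq0.crHom

/-- The involution `T = HP - 1`. -/
def T : C.Cee →+ C.Cee := C.sq0.T

/-- The homomorphism `Δ(x) = (x|x)_H - H(x) + TH(x)`. -/
def Δ : C.C0 →+ C.Cee := C.sq0.Δ

theorem H_add (x y : C.C0) : C.H (x + y) = C.H x + C.H y + C.cr x y := C.sq0.H_add x y
theorem H_neg (x : C.C0) : C.H (-x) = -C.H x + C.cr x x := SquareGroup.Bilin.H_neg C.sq0 x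
@[simp] theorem H_zero : C.H 0 = 0 := C.sq0.H_zero
@[simp] theorem cr_dP_left (a : C.Cee) (y : C.C0) : C.cr (C.d (C.P a)) y = 0 := C.sq0.cr_P_left a y
@[simp] theorem cr_dP_right (x : C.C0) (a : C.Cee) : C.cr x (C.d (C.P a)) = 0 :=
  C.sq0.cr_P_right x a
theorem P_comm (a : C.Cee) (x : C.C1) : C.P a + x = x + C.P a := C.sq1.P_comm a x
theorem dP_comm (a : C.Cee) (x : C.C0) : C.d (C.P a) + x = x + C.d (C.P a) := C.sq0.P_comm a x
theorem H_dP (a : C.Cee) : C.H (C.d (C.P a)) = a + C.T a := C.sq0.H_P a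
@[simp] theorem P_T (a : C.Cee) : C.P (C.T a) = C.P a := C.sq1.P_T a
@[simp] theorem T_T (a : C.Cee) : C.T (C.T a) = a := C.sq0.T_T a
@[simp] theorem T_cr (x y : C.C0) : C.T (C.cr x y) = -C.cr y x := C.sq0.T_cr x y
theorem Δ_apply (x : C.C0) : C.Δ x = C.cr x x - C.H x + C.T (C.H x) := rfl

@[simp] theorem Δ_dP (a : C.Cee) : C.Δ (C.d (C.P a)) = 0 := by
  rw [Δ_apply, cr_dP_left, H_dP, map_add, T_T]; abel

theorem add_comm1 (x y : C.C1) : x + y = y + x + C.P (C.cr (C.d x) (C.d y)) := by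
  have h : C.P (C.cr (C.d x) (C.d y)) = -x - y + x + y := by
    refine Eq.trans (congrArg C.P ?_) (C.sq1.P_cr x y)
    change C.H (C.d x + C.d y) - _ - _ = C.H (C.d (x + y)) - _ - _
    rw [map_add]
    rfl
  rw [h]; simp [sub_eq_add_neg, add_assoc]

theorem add_comm0 (x y : C.C0) : x + y = y + x + C.d (C.P (C.cr x y)) := by
  have h : C.d (C.P (C.cr x y)) = -x - y + x + y := C.sq0.P_cr x y
  rw [h]; simp [sub_eq_add_neg, add_assoc]

end calculus

/-- A quadratic pair module given by a biadditive cross effect. -/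
def ofCr {G₀ G₁ A : Type u} [AddGroup G₀] [AddGroup G₁] [AddCommGroup A] (P : A →+ G₁)
    (d : G₁ →+ G₀) (H : G₀ → A) (cr : G₀ →+ G₀ →+ A)
    (H_add : ∀ x y, H (x + y) = H x + H y + cr x y)
    (cr_dP_left : ∀ a y, cr (d (P a)) y = 0) (cr_dP_right : ∀ x a, cr x (d (P a)) = 0)
    (add_comm0 : ∀ x y, x + y = y + x + d (P (cr x y)))
    (add_comm1 : ∀ x y, x + y = y + x + P (cr (d x) (d y)))
    (P_H_P : ∀ a, P (H (d (P a))) = P a + P a) : QPM.{u} where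
  C0 := G₀
  C1 := G₁
  Cee := A
  P := P
  d := d
  H := H
  isSq0 := by
    have h : ∀ x y, crossEffect H x y = cr x y := fun x y => by rw [crossEffect, H_add]; abel
    constructor
    · intro a a' b; simp [h]
    · intro a a' b; simp [h]
    · intro a b; rw [h]; exact cr_dP_left a b
    · intro a b; rw [h]; exact cr_dP_right a b
    · intro a b
      rw [h, add_assoc _ a b, add_comm0 a b]
      simp [sub_eq_add_neg, add_assoc]
    · intro a; simp [P_H_P]
  isSq1 := by
    have h : ∀ x y, crossEffect (fun x => H (d x)) x y = cr (d x) (d y) := fun x y => by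
      rw [crossEffect, map_add, H_add]; abel
    constructor
    · intro a a' b; simp [h]
    · intro a a' b; simp [h]
    · intro a b; rw [h]; exact cr_dP_left a (d b)
    · intro a b; rw [h]; exact cr_dP_right (d a) b
    · intro a b
      rw [h, add_assoc _ a b, add_comm1 a b]
      simp [sub_eq_add_neg, add_assoc]
    · intro a; exact P_H_P a

theorem ofCr_cr {G₀ G₁ A : Type u} [AddGroup G₀] [AddGroup G₁] [AddCommGroup A] (P : A →+ G₁)
    (d : G₁ →+ G₀) (H : G₀ → A) (cr : G₀ →+ G₀ →+ A) (h₁ h₂ h₃ h₄ h₅ h₆) (x y : G₀) :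
    (ofCr P d H cr h₁ h₂ h₃ h₄ h₅ h₆).cr x y = cr x y := by
  change H (x + y) - H y - H x = cr x y
  rw [h₁]; abel

section hom

variable {C D : QPM.{u}} (f : C ⟶ D)

theorem map_cr (x y : C.C0) : f.fee (C.cr x y) = D.cr (f.f0 x) (f.f0 y) :=
  SquareGroup.map_cr (map0 f) x y
theorem map_T (a : C.Cee) : f.fee (C.T a) = D.T (f.fee a) := SquareGroup.map_T (map0 f) a
theorem map_Δ (x : C.C0) : f.fee (C.Δ x) = D.Δ (f.f0 x) := SquareGroup.map_Δ (map0 f) x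

@[simp] theorem id_f0 (x : C.C0) : (𝟙 C : C ⟶ C).f0 x = x := rfl
@[simp] theorem id_f1 (x : C.C1) : (𝟙 C : C ⟶ C).f1 x = x := rfl
@[simp] theorem id_fee (x : C.Cee) : (𝟙 C : C ⟶ C).fee x = x := rfl
@[simp] theorem comp_f0 {E : QPM.{u}} (f : C ⟶ D) (g : D ⟶ E) (x : C.C0) :
    (f ≫ g).f0 x = g.f0 (f.f0 x) := rfl
@[simp] theorem comp_f1 {E : QPM.{u}} (f : C ⟶ D) (g : D ⟶ E) (x : C.C1) :
    (f ≫ g).f1 x = g.f1 (f.f1 x) := rfl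
@[simp] theorem comp_fee {E : QPM.{u}} (f : C ⟶ D) (g : D ⟶ E) (x : C.Cee) :
    (f ≫ g).fee x = g.fee (f.fee x) := rfl

end hom

/-! ### Bilinear maps of quadratic pair modules -/

/-- The data defining a morphism `C ⊙ D → E`. -/
structure Bilin (C D E : QPM.{u}) where
  v00 : C.C0 → D.C0 → E.C0
  v10 : C.C1 → D.C0 → E.C1
  v01 : C.C0 → D.C1 → E.C1
  p : C.Cee →+ D.Cee →+ E.Cee
  v00_add : ∀ x y y', v00 x (y + y') = v00 x y + v00 x y'
  v10_add : ∀ x y y', v10 x (y + y') = v10 x y + v10 x y'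
  v01_add : ∀ x y y', v01 x (y + y') = v01 x y + v01 x y'
  add_v00 : ∀ x x' y, v00 (x + x') y = v00 x y + v00 x' y + E.d (E.P (p (C.cr x' x) (D.H y)))
  add_v10 : ∀ x x' y, v10 (x + x') y = v10 x y + v10 x' y + E.P (p (C.cr (C.d x') (C.d x)) (D.H y))
  add_v01 : ∀ x x' y, v01 (x + x') y = v01 x y + v01 x' y + E.P (p (C.cr x' x) (D.H (D.d y)))
  d_v10 : ∀ x y, E.d (v10 x y) = v00 (C.d x) y
  d_v01 : ∀ x y, E.d (v01 x y) = v00 x (D.d y)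
  v10_d : ∀ x y, v10 x (D.d y) = v01 (C.d x) y
  P_v10 : ∀ a y, v10 (C.P a) y = E.P (p a (D.Δ y))
  v01_P : ∀ x b, v01 x (D.P b) = E.P (p (C.cr x x) b)
  T_p : ∀ a b, E.T (p a b) = -p (C.T a) (D.T b)
  cr_v00 : ∀ x x' y y', E.cr (v00 x y) (v00 x' y') = p (C.cr x x') (D.cr y y')
  H_v00 : ∀ x y, E.H (v00 x y) = p (C.cr x x) (D.H y) + p (C.H x) (D.Δ y)

namespace Bilin

variable {C D E : QPM.{u}} (B : Bilin C D E)

theorem v00_dP (x : C.C0) (b : D.Cee) :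
    B.v00 x (D.d (D.P b)) = E.d (E.P (B.p (C.cr x x) b)) := by
  rw [← d_v01, v01_P]
theorem dP_v00 (a : C.Cee) (y : D.C0) : B.v00 (C.d (C.P a)) y = E.d (E.P (B.p a (D.Δ y))) := by
  rw [← d_v10, P_v10]
theorem v10_dP (x : C.C1) (b : D.Cee) :
    B.v10 x (D.d (D.P b)) = E.P (B.p (C.cr (C.d x) (C.d x)) b) := by
  rw [v10_d, v01_P]
theorem dP_v01 (a : C.Cee) (y : D.C1) :
    B.v01 (C.d (C.P a)) y = E.P (B.p a (D.Δ (D.d y))) := by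
  rw [← v10_d, P_v10]

theorem P_p_T_T (a : C.Cee) (b : D.Cee) : E.P (B.p (C.T a) (D.T b)) = -E.P (B.p a b) := by
  rw [← E.P_T (B.p a b), T_p, map_neg, neg_neg]

theorem P_p_T (a : C.Cee) (b : D.Cee) : E.P (B.p a (D.T b)) = -E.P (B.p (C.T a) b) := by
  rw [← P_p_T_T, T_T]

/-- The homomorphism `x ⊚̲ -` on `D_0`. -/
def v00Hom (x : C.C0) : D.C0 →+ E.C0 := AddMonoidHom.mk' (B.v00 x) (B.v00_add x)
/-- The homomorphism `x ⊚̲ -` on `D_0`. -/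
def v10Hom (x : C.C1) : D.C0 →+ E.C1 := AddMonoidHom.mk' (B.v10 x) (B.v10_add x)
/-- The homomorphism `x ⊚̲ -` on `D_1`. -/
def v01Hom (x : C.C0) : D.C1 →+ E.C1 := AddMonoidHom.mk' (B.v01 x) (B.v01_add x)

@[simp] theorem v00Hom_apply (x : C.C0) (y : D.C0) : B.v00Hom x y = B.v00 x y := rfl
@[simp] theorem v10Hom_apply (x : C.C1) (y : D.C0) : B.v10Hom x y = B.v10 x y := rfl
@[simp] theorem v01Hom_apply (x : C.C0) (y : D.C1) : B.v01Hom x y = B.v01 x y := rfl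

/-- The composition of a bilinear map and a morphism. -/
def comp {F : QPM.{u}} (f : E ⟶ F) : Bilin C D F where
  v00 x y := f.f0 (B.v00 x y)
  v10 x y := f.f1 (B.v10 x y)
  v01 x y := f.f1 (B.v01 x y)
  p := (AddMonoidHom.compHom f.fee).comp B.p
  v00_add x y y' := by rw [v00_add, map_add]
  v10_add x y y' := by rw [v10_add, map_add]
  v01_add x y y' := by rw [v01_add, map_add]
  add_v00 x x' y := by rw [add_v00, map_add, map_add, f.map_d, f.map_P]; rfl
  add_v10 x x' y := by rw [add_v10, map_add, map_add, f.map_P]; rfl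
  add_v01 x x' y := by rw [add_v01, map_add, map_add, f.map_P]; rfl
  d_v10 x y := by rw [← f.map_d, d_v10]
  d_v01 x y := by rw [← f.map_d, d_v01]
  v10_d x y := by rw [v10_d]
  P_v10 a y := by rw [P_v10, f.map_P]; rfl
  v01_P a y := by rw [v01_P, f.map_P]; rfl
  T_p a b := by
    change F.T (f.fee _) = - f.fee _
    rw [← map_T, T_p, map_neg]
  cr_v00 x x' y y' := by rw [← map_cr, cr_v00]; rfl
  H_v00 x y := by rw [← f.map_H, H_v00, map_add]; rfl

/-- The bilinear map of square groups in degree `(0, 0)`. -/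
def sq00 : SquareGroup.Bilin C.sq0 D.sq0 E.sq0 where
  v := B.v00
  p := B.p
  add_right := B.v00_add
  add_left := B.add_v00
  P_left := B.dP_v00
  P_right := B.v00_dP
  map_T := B.T_p
  map_cr := B.cr_v00
  map_H := B.H_v00

theorem sq1_cr (C : QPM.{u}) (x y : C.C1) : C.sq1.cr x y = C.cr (C.d x) (C.d y) := by
  change C.H (C.d (x + y)) - _ - _ = C.H (C.d x + C.d y) - _ - _
  rw [map_add]
  rfl

theorem sq1_Δ (C : QPM.{u}) (x : C.C1) : C.sq1.Δ x = C.Δ (C.d x) := by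
  change C.sq1.cr x x - _ + _ = _
  rw [sq1_cr]
  rfl

/-- The bilinear map of square groups in degree `(1, 0)`. -/
def sq10 : SquareGroup.Bilin C.sq1 D.sq0 E.sq1 where
  v := B.v10
  p := B.p
  add_right := B.v10_add
  add_left x x' y := (B.add_v10 x x' y).trans
    (congrArg (fun t => B.v10 x y + B.v10 x' y + E.P (B.p t (D.H y))) (sq1_cr C x' x).symm)
  P_left := B.P_v10
  P_right x b := (B.v10_dP x b).trans (congrArg (fun t => E.P (B.p t b)) (sq1_cr C x x).symm)
  map_T := B.T_p
  map_cr x x' y y' := (sq1_cr E _ _).trans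
    (((congrArg₂ (fun a b => E.cr a b) (B.d_v10 x y) (B.d_v10 x' y')).trans
      (B.cr_v00 _ _ _ _)).trans (congrArg (fun t => B.p t (D.cr y y')) (sq1_cr C x x').symm))
  map_H x y := ((congrArg E.H (B.d_v10 x y)).trans (B.H_v00 _ _)).trans
    (congrArg (fun t => B.p t (D.H y) + B.p (C.H (C.d x)) (D.Δ y)) (sq1_cr C x x).symm)

/-- The bilinear map of square groups in degree `(0, 1)`. -/
def sq01 : SquareGroup.Bilin C.sq0 D.sq1 E.sq1 where
  v := B.v01
  p := B.p
  add_right := B.v01_add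
  add_left := B.add_v01
  P_left a y := (B.dP_v01 a y).trans (congrArg (fun t => E.P (B.p a t)) (sq1_Δ D y).symm)
  P_right := B.v01_P
  map_T := B.T_p
  map_cr x x' y y' := (sq1_cr E _ _).trans
    (((congrArg₂ (fun a b => E.cr a b) (B.d_v01 x y) (B.d_v01 x' y')).trans
      (B.cr_v00 _ _ _ _)).trans (congrArg (fun t => B.p (C.cr x x') t) (sq1_cr D y y').symm))
  map_H x y := ((congrArg E.H (B.d_v01 x y)).trans (B.H_v00 _ _)).trans
    (congrArg (fun t => B.p (C.cr x x) (D.H (D.d y)) + B.p (C.H x) t) (sq1_Δ D y).symm)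

end Bilin

section desc

open SquareGroup

variable {C D E : QPM.{u}} (B : Bilin C D E)

theorem Bilin.desc_glue : legRight C D ≫ B.sq10.desc = legLeft C D ≫ B.sq01.desc :=
  SquareGroup.tensor_hom_ext
    (fun x y => (B.sq10.descE_circU x (D.d y)).trans
      ((B.v10_d x y).trans (B.sq01.descE_circU (C.d x) y).symm))
    (fun _ _ => rfl)

theorem Bilin.desc_dBar :
    pushDesc B.sq10.desc B.sq01.desc B.desc_glue ≫ E.sqd = dBar C D ≫ B.sq00.desc := by
  apply push_hom_ext
  · refine SquareGroup.tensor_hom_ext (fun x y => ?_) (fun a b => rfl)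
    exact (congrArg E.d (B.sq10.descE_circU x y)).trans
      ((B.d_v10 x y).trans (B.sq00.descE_circU (C.d x) y).symm)
  · refine SquareGroup.tensor_hom_ext (fun x y => ?_) (fun a b => rfl)
    exact (congrArg E.d (B.sq01.descE_circU x y)).trans
      ((B.d_v01 x y).trans (B.sq00.descE_circU x (D.d y)).symm)

/-- The homomorphism `Φ(f)_1 → E_1` given by a morphism of pairs. -/
def phiDesc1 {X Y : SquareGroup.{u}} {f : X ⟶ Y} (α : X ⟶ E.sq1) (β : Y ⟶ E.sq0)
    (w : α ≫ E.sqd = f ≫ β) : Phi1 f →+ E.sq1.e :=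
  phiLift f α.e (E.sq1.P.comp β.ee) (fun c x => E.P_comm _ _)
    (fun a => (congrArg E.sq1.P (DFunLike.congr_fun (congrArg SquareGroup.Hom.ee w) a).symm).trans
      (α.map_P a).symm)
    (fun c => by
      have h : β.ee (Y.H (Y.P c)) = β.ee c + E.sq0.T (β.ee c) := by
        rw [β.map_H, β.map_P]; exact E.H_dP _
      exact (congrArg E.sq1.P h).trans ((map_add E.sq1.P _ _).trans
        (congrArg (E.sq1.P (β.ee c) + ·) (E.P_T _))))

theorem phiDesc1_mk {X Y : SquareGroup.{u}} {f : X ⟶ Y} (α : X ⟶ E.sq1) (β : Y ⟶ E.sq0)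
    (w : α ≫ E.sqd = f ≫ β) (p : X.e × Y.ee) :
    phiDesc1 α β w (phiMk f p) = α.e p.1 + E.sq1.P (β.ee p.2) := rfl

/-- A morphism `Φ(f) → E` given by a morphism of pairs. -/
def phiDesc {X Y : SquareGroup.{u}} {f : X ⟶ Y} (α : X ⟶ E.sq1) (β : Y ⟶ E.sq0)
    (w : α ≫ E.sqd = f ≫ β) : Phi f ⟶ E where
  f0 := β.e
  f1 := phiDesc1 α β w
  fee := β.ee
  map_P c := (phiDesc1_mk α β w (0, c)).trans (by rw [map_zero, zero_add]; rfl)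
  map_d x := by
    obtain ⟨⟨x, c⟩, rfl⟩ := phiMk_surjective f x
    have h : β.e (f.e x) = E.sqd.e (α.e x) :=
      (DFunLike.congr_fun (congrArg SquareGroup.Hom.e w) x).symm
    have h1 : β.e (phiD f (phiMk f (x, c))) = E.sqd.e (phiDesc1 α β w (phiMk f (x, c))) := by
      rw [phiD_mk, phiDesc1_mk, map_add, h, β.map_P, map_add]
      rfl
    exact h1
  map_H := β.map_H

/-- The morphism `C ⊙ D → E` given by a bilinear map. -/
def Bilin.desc : C.tensor D ⟶ E :=
  phiDesc (pushDesc B.sq10.desc B.sq01.desc B.desc_glue) B.sq00.desc B.desc_dBar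

theorem phiDesc_unit {X Y : SquareGroup.{u}} {f : X ⟶ Y} (α : X ⟶ E.sq1) (β : Y ⟶ E.sq0)
    (w : α ≫ E.sqd = f ≫ β) (x : X.e) : (phiDesc α β w).f1 (phiUnit f x) = α.e x :=
  (phiDesc1_mk α β w (x, 0)).trans ((congrArg (fun t => α.e x + E.sq1.P t) (map_zero β.ee)).trans
    ((congrArg (α.e x + ·) (map_zero E.sq1.P)).trans (add_zero _)))

@[simp] theorem Bilin.desc_u00 (x : C.C0) (y : D.C0) : B.desc.f0 (u00 C D x y) = B.v00 x y :=
  B.sq00.descE_circU x y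

@[simp] theorem Bilin.desc_u10 (x : C.C1) (y : D.C0) : B.desc.f1 (u10 C D x y) = B.v10 x y :=
  (phiDesc_unit _ _ _ _).trans (B.sq10.descE_circU x y)

@[simp] theorem Bilin.desc_u01 (x : C.C0) (y : D.C1) : B.desc.f1 (u01 C D x y) = B.v01 x y :=
  (phiDesc_unit _ _ _ _).trans (B.sq01.descE_circU x y)

@[simp] theorem Bilin.desc_tee (a : C.Cee) (b : D.Cee) : B.desc.fee (tee C D a b) = B.p a b := rfl

/-- The unit of the reflection `Φ`. -/
def phiUnitHom {X Y : SquareGroup.{u}} (f : X ⟶ Y) : X ⟶ (Phi f).sq1 where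
  e := phiUnit f
  ee := f.ee
  map_P a := (phiMk_rel f (.ee a)).symm
  map_H x := (f.map_H x).trans (congrArg Y.H
    ((phiD_mk f (x, 0)).trans (by rw [map_zero, add_zero])).symm)

/-- The identification of `Φ(f)_(0)` with the target of `f`. -/
def phiBaseHom {X Y : SquareGroup.{u}} (f : X ⟶ Y) : Y ⟶ (Phi f).sq0 where
  e := AddMonoidHom.id _
  ee := AddMonoidHom.id _
  map_P a := (phiD_phiP f a).symm
  map_H _ := rfl

variable (C D) in
/-- The biadditive map `a ⊗ b` with values in `(C ⊙ D)_ee`. -/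
def teeHom : C.Cee →+ D.Cee →+ (C.tensor D).Cee :=
  AddMonoidHom.mk' (fun a => AddMonoidHom.mk' (tee C D a) fun b b' => TensorProduct.tmul_add a b b')
    fun a a' => AddMonoidHom.ext fun b => TensorProduct.add_tmul a a' b

@[simp] theorem teeHom_apply (a : C.Cee) (b : D.Cee) : teeHom C D a b = tee C D a b := rfl

theorem zeta_tensorP (t : C.Cee ⊗[ℤ] D.Cee) :
    zeta C D (tensorP (X := C.sq1) (Y := D.sq0) t) = (C.tensor D).P t := by
  have h : (dBar C D).ee ((pushInl (legRight C D) (legLeft C D)).ee t) = t := by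
    change tensorMapEE (sqd C) (𝟙 D.sq0) t = t
    induction t using TensorProduct.induction_on with
    | zero => exact map_zero _
    | tmul a b => rfl
    | add s t hs ht => exact (map_add _ s t).trans (congrArg₂ _ hs ht)
  have h2 : zeta C D (tensorP (X := C.sq1) (Y := D.sq0) t) =
      phiUnit (dBar C D) ((pushout (legRight C D) (legLeft C D)).P
        ((pushInl (legRight C D) (legLeft C D)).ee t)) :=
    congrArg (phiUnit (dBar C D)) ((pushInl (legRight C D) (legLeft C D)).map_P t)
  rw [h2]
  refine (phiMk_rel (dBar C D) (.ee _)).symm.trans ?_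
  rw [h]
  rfl

theorem xi_tensorP (t : C.Cee ⊗[ℤ] D.Cee) :
    xi C D (tensorP (X := C.sq0) (Y := D.sq1) t) = (C.tensor D).P t := by
  have h : (dBar C D).ee ((pushInr (legRight C D) (legLeft C D)).ee t) = t := by
    change tensorMapEE (𝟙 C.sq0) (sqd D) t = t
    induction t using TensorProduct.induction_on with
    | zero => exact map_zero _
    | tmul a b => rfl
    | add s t hs ht => exact (map_add _ s t).trans (congrArg₂ _ hs ht)
  have h2 : xi C D (tensorP (X := C.sq0) (Y := D.sq1) t) =
      phiUnit (dBar C D) ((pushout (legRight C D) (legLeft C D)).P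
        ((pushInr (legRight C D) (legLeft C D)).ee t)) :=
    congrArg (phiUnit (dBar C D)) ((pushInr (legRight C D) (legLeft C D)).map_P t)
  rw [h2]
  refine (phiMk_rel (dBar C D) (.ee _)).symm.trans ?_
  rw [h]
  rfl

theorem zeta_bar (a : C.Cee) (b : D.Cee) :
    zeta C D (bar (X := C.sq1) (Y := D.sq0) a b) = (C.tensor D).P (tee C D a b) :=
  zeta_tensorP (a ⊗ₜ b)
theorem xi_bar (a : C.Cee) (b : D.Cee) :
    xi C D (bar (X := C.sq0) (Y := D.sq1) a b) = (C.tensor D).P (tee C D a b) :=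
  xi_tensorP (a ⊗ₜ b)

theorem d_zeta (t : TensorE C.sq1 D.sq0) :
    (C.tensor D).d (zeta C D t) = tensorMapE C.sqd (𝟙 D.sq0) t := by
  refine (phiD_mk (dBar C D) (_, 0)).trans ?_
  rw [map_zero, add_zero]
  rfl

theorem d_xi (t : TensorE C.sq0 D.sq1) :
    (C.tensor D).d (xi C D t) = tensorMapE (𝟙 C.sq0) D.sqd t := by
  refine (phiD_mk (dBar C D) (_, 0)).trans ?_
  rw [map_zero, add_zero]
  rfl

theorem dP_tee (a : C.Cee) (b : D.Cee) :
    (C.tensor D).d ((C.tensor D).P (tee C D a b)) = bar (X := C.sq0) (Y := D.sq0) a b :=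
  (phiD_mk (dBar C D) (0, _)).trans (by rw [map_zero, zero_add]; rfl)

variable (C D) in
/-- The universal bilinear map, with values in `C ⊙ D`. -/
def Bilin.univ : Bilin C D (C.tensor D) where
  v00 := u00 C D
  v10 := u10 C D
  v01 := u01 C D
  p := teeHom C D
  v00_add x y y' := circU_add (X := C.sq0) (Y := D.sq0) x y y'
  v10_add x y y' := (congrArg (zeta C D) (circU_add (X := C.sq1) (Y := D.sq0) x y y')).trans
    (map_add _ _ _)
  v01_add x y y' := (congrArg (xi C D) (circU_add (X := C.sq0) (Y := D.sq1) x y y')).trans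
    (map_add _ _ _)
  add_v00 x x' y := by
    rw [teeHom_apply, dP_tee]
    exact add_circU (X := C.sq0) (Y := D.sq0) x x' y
  add_v10 x x' y := by
    rw [teeHom_apply, ← zeta_bar, ← sq1_cr]
    exact (congrArg (zeta C D) (add_circU (X := C.sq1) (Y := D.sq0) x x' y)).trans
      ((map_add _ _ _).trans (congrArg (· + _) (map_add _ _ _)))
  add_v01 x x' y := by
    rw [teeHom_apply, ← xi_bar]
    exact (congrArg (xi C D) (add_circU (X := C.sq0) (Y := D.sq1) x x' y)).trans
      ((map_add _ _ _).trans (congrArg (· + _) (map_add _ _ _)))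
  d_v10 x y := (d_zeta _).trans (tensorMapE_circU C.sqd (𝟙 D.sq0) x y)
  d_v01 x y := (d_xi _).trans (tensorMapE_circU (𝟙 C.sq0) D.sqd x y)
  v10_d x y := by
    have h := DFunLike.congr_fun (congrArg SquareGroup.Hom.e
      (push_condition (legRight C D) (legLeft C D))) (circU (X := C.sq1) (Y := D.sq1) x y)
    exact congrArg (phiUnit (dBar C D)) h
  P_v10 a y := (congrArg (zeta C D) (P_circU (X := C.sq1) (Y := D.sq0) a y)).trans (zeta_bar _ _)
  v01_P x b := (congrArg (xi C D) (circU_P (X := C.sq0) (Y := D.sq1) x b)).trans (xi_bar _ _)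
  T_p a b := tensor_T (X := C.sq0) (Y := D.sq0) a b
  cr_v00 x x' y y' := tensor_cr_circU (X := C.sq0) (Y := D.sq0) x x' y y'
  H_v00 x y := tensorH_circU (X := C.sq0) (Y := D.sq0) x y

theorem tensor_hom_ext {f g : C.tensor D ⟶ E}
    (h₀₀ : ∀ x y, f.f0 (u00 C D x y) = g.f0 (u00 C D x y))
    (h₁₀ : ∀ x y, f.f1 (u10 C D x y) = g.f1 (u10 C D x y))
    (h₀₁ : ∀ x y, f.f1 (u01 C D x y) = g.f1 (u01 C D x y))
    (hee : ∀ a b, f.fee (tee C D a b) = g.fee (tee C D a b)) : f = g := by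
  have h0 : phiBaseHom (dBar C D) ≫ map0 f = phiBaseHom (dBar C D) ≫ map0 g :=
    SquareGroup.tensor_hom_ext (X := C.sq0) (Y := D.sq0) (Z := E.sq0) h₀₀ hee
  have h1 : (phiUnitHom (dBar C D) ≫ map1 f) = (phiUnitHom (dBar C D) ≫ map1 g) :=
    push_hom_ext
      (SquareGroup.tensor_hom_ext (f := pushInl _ _ ≫ phiUnitHom (dBar C D) ≫ map1 f)
        (g := pushInl _ _ ≫ phiUnitHom (dBar C D) ≫ map1 g) h₁₀
        (fun a b => hee a b))
      (SquareGroup.tensor_hom_ext (f := pushInr _ _ ≫ phiUnitHom (dBar C D) ≫ map1 f)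
        (g := pushInr _ _ ≫ phiUnitHom (dBar C D) ≫ map1 g) h₀₁
        (fun a b => hee a b))
  exact phi_hom_ext (DFunLike.congr_fun (congrArg SquareGroup.Hom.e h0))
    (DFunLike.congr_fun (congrArg SquareGroup.Hom.e h1))
    (DFunLike.congr_fun (congrArg SquareGroup.Hom.ee h0))

end desc

end QPM

end

section

open scoped TensorProduct

namespace QPM

open SquareGroup

section generation

variable {C D : QPM.{u}}

theorem tensoree_hom_ext {A : Type*} [AddGroup A] {f g : (C.tensor D).Cee →+ A}
    (h : ∀ a b, f (tee C D a b) = g (tee C D a b)) : f = g := by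
  refine AddMonoidHom.ext fun t => ?_
  induction (t : C.Cee ⊗[ℤ] D.Cee) using TensorProduct.induction_on with
  | zero => exact (map_zero f).trans (map_zero g).symm
  | tmul a b => exact h a b
  | add s t hs ht => exact (map_add f s t).trans ((congrArg₂ _ hs ht).trans (map_add g s t).symm)

@[elab_as_elim]
theorem tensor0_induction {p : (C.tensor D).C0 → Prop} (h0 : p 0) (hneg : ∀ g, p g → p (-g))
    (hadd : ∀ g h, p g → p h → p (g + h)) (hu : ∀ x y, p (u00 C D x y))
    (hb : ∀ a b, p ((C.tensor D).d ((C.tensor D).P (tee C D a b)))) (g : (C.tensor D).C0) : p g :=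
  tensorE_induction_circU (X := C.sq0) (Y := D.sq0) h0 hneg hadd hu
    (fun a b => (congrArg p (dP_tee a b)).mp (hb a b)) g

theorem tensor0_hom_ext {G : Type*} [AddGroup G] {f g : (C.tensor D).C0 →+ G}
    (hu : ∀ x y, f (u00 C D x y) = g (u00 C D x y))
    (hb : ∀ a b, f ((C.tensor D).d ((C.tensor D).P (tee C D a b))) =
      g ((C.tensor D).d ((C.tensor D).P (tee C D a b)))) : f = g := by
  refine AddMonoidHom.ext fun t => ?_
  induction t using tensor0_induction with
  | h0 => simp
  | hneg g ih => simp [ih]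
  | hadd g h ih ih' => simp [ih, ih']
  | hu x y => exact hu x y
  | hb a b => exact hb a b

/-- The sub-object of a quadratic pair module `C` which is all of `C` in the degrees `0` and `ee`,
and a subgroup of `C_1` in degree `1`. -/
def restrict (C : QPM.{u}) (S : AddSubgroup C.C1) (hS : ∀ a, C.P a ∈ S) : QPM.{u} :=
  ofCr (C.P.codRestrict S hS) (C.d.comp S.subtype) C.H C.cr C.H_add C.cr_dP_left C.cr_dP_right
    C.add_comm0 (fun x y => Subtype.ext (C.add_comm1 x y))
    (fun a => Subtype.ext (by
      change C.P (C.H (C.d (C.P a))) = C.P a + C.P a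
      rw [H_dP, map_add, P_T]))

/-- The inclusion of the sub-object of the previous definition. -/
def restrictι (C : QPM.{u}) (S : AddSubgroup C.C1) (hS : ∀ a, C.P a ∈ S) : C.restrict S hS ⟶ C where
  f0 := AddMonoidHom.id _
  f1 := S.subtype
  fee := AddMonoidHom.id _
  map_P _ := rfl
  map_d _ := rfl
  map_H _ := rfl

/-- A bilinear map with values in a sub-object. -/
def Bilin.restrict {E : QPM.{u}} (B : Bilin C D E) (S : AddSubgroup E.C1) (hS : ∀ a, E.P a ∈ S)
    (h10 : ∀ x y, B.v10 x y ∈ S) (h01 : ∀ x y, B.v01 x y ∈ S) : Bilin C D (E.restrict S hS) where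
  v00 := B.v00
  v10 x y := ⟨B.v10 x y, h10 x y⟩
  v01 x y := ⟨B.v01 x y, h01 x y⟩
  p := B.p
  v00_add := B.v00_add
  v10_add x y y' := Subtype.ext (B.v10_add x y y')
  v01_add x y y' := Subtype.ext (B.v01_add x y y')
  add_v00 := B.add_v00
  add_v10 x x' y := Subtype.ext (B.add_v10 x x' y)
  add_v01 x x' y := Subtype.ext (B.add_v01 x x' y)
  d_v10 := B.d_v10
  d_v01 := B.d_v01
  v10_d x y := Subtype.ext (B.v10_d x y)
  P_v10 a y := Subtype.ext (B.P_v10 a y)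
  v01_P x b := Subtype.ext (B.v01_P x b)
  T_p := B.T_p
  cr_v00 := B.cr_v00
  H_v00 := B.H_v00

theorem tensor1_hom_ext {G : Type*} [AddGroup G] {f g : (C.tensor D).C1 →+ G}
    (h10 : ∀ x y, f (u10 C D x y) = g (u10 C D x y))
    (h01 : ∀ x y, f (u01 C D x y) = g (u01 C D x y))
    (hb : ∀ a b, f ((C.tensor D).P (tee C D a b)) = g ((C.tensor D).P (tee C D a b))) : f = g := by
  have hP : f.comp (C.tensor D).P = g.comp (C.tensor D).P := tensoree_hom_ext hb
  let B := (Bilin.univ C D).restrict (f.eqLocus g) (DFunLike.congr_fun hP) h10 h01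
  have h : B.desc ≫ restrictι _ _ _ = 𝟙 (C.tensor D) :=
    tensor_hom_ext B.desc_u00 (fun x y => congrArg Subtype.val (B.desc_u10 x y))
      (fun x y => congrArg Subtype.val (B.desc_u01 x y)) B.desc_tee
  refine AddMonoidHom.ext fun x => ?_
  have hx := (B.desc.f1 x).2
  have hx' : (B.desc.f1 x).1 = x := DFunLike.congr_fun (congrArg QPM.Hom.f1 h) x
  rw [hx'] at hx
  exact hx

end generation

/-! ### Homomorphisms out of the degree `1` part of a tensor product -/

section pullback

/-- The base change of the degree `1` part of `T` along a homomorphism `Q_0 → T_0`. -/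
def pullback {Q T : QPM.{u}} (φ : Q.C0 →+ T.C0) (χ : Q.Cee →+ T.Cee)
    (hP : ∀ t, φ (Q.d (Q.P t)) = T.d (T.P (χ t)))
    (hcr : ∀ q q', T.P (χ (Q.cr q q')) = T.P (T.cr (φ q) (φ q')))
    (hT : ∀ t, T.P (χ (Q.T t)) = T.P (χ t)) : QPM.{u} :=
  ofCr (G₁ := (φ.comp (AddMonoidHom.fst Q.C0 T.C1)).eqLocus (T.d.comp (AddMonoidHom.snd Q.C0 T.C1)))
    (((Q.d.comp Q.P).prod (T.P.comp χ)).codRestrict _ hP)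
    ((AddMonoidHom.fst Q.C0 T.C1).comp (AddSubgroup.subtype _)) Q.H Q.cr Q.H_add Q.cr_dP_left
    Q.cr_dP_right Q.add_comm0 (by
      rintro ⟨⟨x, x'⟩, hx⟩ ⟨⟨y, y'⟩, hy⟩
      refine Subtype.ext (Prod.ext (Q.add_comm0 x y) ?_)
      change x' + y' = y' + x' + T.P (χ (Q.cr x y))
      rw [hcr]
      change φ x = T.d x' at hx
      change φ y = T.d y' at hy
      rw [hx, hy]
      exact T.add_comm1 x' y') (by
      intro a
      refine Subtype.ext (Prod.ext ?_ ?_)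
      · change Q.d (Q.P (Q.H (Q.d (Q.P a)))) = Q.d (Q.P a) + Q.d (Q.P a)
        rw [H_dP, map_add, P_T, map_add]
      · change T.P (χ (Q.H (Q.d (Q.P a)))) = T.P (χ a) + T.P (χ a)
        rw [H_dP, map_add, map_add, hT])

/-- Data defining a homomorphism `(C ⊙ D)_1 → T_1` over a homomorphism `φ : (C ⊙ D)_0 → T_0`. -/
structure Ext (C D T : QPM.{u}) where
  φ : (C.tensor D).C0 →+ T.C0
  χ : (C.tensor D).Cee →+ T.Cee
  v10 : C.C1 → D.C0 → T.C1
  v01 : C.C0 → D.C1 → T.C1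
  hP : ∀ t, φ ((C.tensor D).d ((C.tensor D).P t)) = T.d (T.P (χ t))
  hcr : ∀ q q', T.P (χ ((C.tensor D).cr q q')) = T.P (T.cr (φ q) (φ q'))
  hT : ∀ t, T.P (χ ((C.tensor D).T t)) = T.P (χ t)
  v10_add : ∀ x y y', v10 x (y + y') = v10 x y + v10 x y'
  v01_add : ∀ x y y', v01 x (y + y') = v01 x y + v01 x y'
  add_v10 : ∀ x x' y, v10 (x + x') y =
    v10 x y + v10 x' y + T.P (χ (tee C D (C.cr (C.d x') (C.d x)) (D.H y)))
  add_v01 : ∀ x x' y, v01 (x + x') y =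
    v01 x y + v01 x' y + T.P (χ (tee C D (C.cr x' x) (D.H (D.d y))))
  d_v10 : ∀ x y, T.d (v10 x y) = φ (u00 C D (C.d x) y)
  d_v01 : ∀ x y, T.d (v01 x y) = φ (u00 C D x (D.d y))
  v10_d : ∀ x y, v10 x (D.d y) = v01 (C.d x) y
  P_v10 : ∀ a y, v10 (C.P a) y = T.P (χ (tee C D a (D.Δ y)))
  v01_P : ∀ x b, v01 x (D.P b) = T.P (χ (tee C D (C.cr x x) b))

namespace Ext

variable {C D T : QPM.{u}} (F : Ext C D T)

/-- The bilinear map with values in the base change. -/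
def bilin : Bilin C D (pullback F.φ F.χ F.hP F.hcr F.hT) where
  v00 := u00 C D
  v10 x y := ⟨(u00 C D (C.d x) y, F.v10 x y), (F.d_v10 x y).symm⟩
  v01 x y := ⟨(u00 C D x (D.d y), F.v01 x y), (F.d_v01 x y).symm⟩
  p := teeHom C D
  v00_add := (Bilin.univ C D).v00_add
  v10_add x y y' := Subtype.ext (Prod.ext ((Bilin.univ C D).v00_add _ _ _) (F.v10_add x y y'))
  v01_add x y y' := Subtype.ext (Prod.ext
    ((congrArg (u00 C D x) (map_add D.d y y')).trans ((Bilin.univ C D).v00_add _ _ _))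
    (F.v01_add x y y'))
  add_v00 := (Bilin.univ C D).add_v00
  add_v10 x x' y := Subtype.ext (Prod.ext
    ((congrArg (u00 C D · y) (map_add C.d x x')).trans ((Bilin.univ C D).add_v00 _ _ _))
    (F.add_v10 x x' y))
  add_v01 x x' y := Subtype.ext (Prod.ext ((Bilin.univ C D).add_v00 _ _ _) (F.add_v01 x x' y))
  d_v10 _ _ := rfl
  d_v01 _ _ := rfl
  v10_d x y := Subtype.ext (Prod.ext rfl (F.v10_d x y))
  P_v10 a y := Subtype.ext (Prod.ext ((Bilin.univ C D).dP_v00 a y) (F.P_v10 a y))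
  v01_P x b := Subtype.ext (Prod.ext ((Bilin.univ C D).v00_dP x b) (F.v01_P x b))
  T_p := (Bilin.univ C D).T_p
  cr_v00 := (Bilin.univ C D).cr_v00
  H_v00 := (Bilin.univ C D).H_v00

/-- The homomorphism `(C ⊙ D)_1 → T_1`. -/
def hom : (C.tensor D).C1 →+ T.C1 :=
  ((AddMonoidHom.snd (C.tensor D).C0 T.C1).comp (AddSubgroup.subtype _)).comp F.bilin.desc.f1

@[simp] theorem hom_u10 (x : C.C1) (y : D.C0) : F.hom (u10 C D x y) = F.v10 x y :=
  congrArg (fun t => t.1.2) (F.bilin.desc_u10 x y)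

@[simp] theorem hom_u01 (x : C.C0) (y : D.C1) : F.hom (u01 C D x y) = F.v01 x y :=
  congrArg (fun t => t.1.2) (F.bilin.desc_u01 x y)

theorem desc_fee (t : (C.tensor D).Cee) : F.bilin.desc.fee t = t :=
  DFunLike.congr_fun (tensoree_hom_ext (f := F.bilin.desc.fee) (g := AddMonoidHom.id _)
    fun _ _ => rfl) t

@[simp] theorem hom_P (t : (C.tensor D).Cee) : F.hom ((C.tensor D).P t) = T.P (F.χ t) := by
  refine (congrArg (fun t => t.1.2) (F.bilin.desc.map_P t)).trans ?_
  exact congrArg (fun t => T.P (F.χ t)) (F.desc_fee t)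

theorem desc_f0 (t : (C.tensor D).C0) : F.bilin.desc.f0 t = t :=
  DFunLike.congr_fun (tensor0_hom_ext (f := F.bilin.desc.f0) (g := AddMonoidHom.id _)
    F.bilin.desc_u00 (fun a b => (F.bilin.desc.map_d _).trans
      ((congrArg _ (F.bilin.desc.map_P _)).trans (congrArg (fun t => (C.tensor D).d ((C.tensor D).P t)) (F.desc_fee (tee C D a b)))))) t

theorem d_hom (q : (C.tensor D).C1) : T.d (F.hom q) = F.φ ((C.tensor D).d q) := by
  refine (F.bilin.desc.f1 q).2.symm.trans (congrArg F.φ ?_)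
  exact (F.bilin.desc.map_d q).symm.trans (F.desc_f0 _)

end Ext

end pullback

end QPM

end

section

open scoped TensorProduct

namespace QPM

open SquareGroup

/-! ### The symmetry -/

/-- The projection of `C_ee` onto the image of `P`, as a commutative group. -/
def toImP (C : QPM.{u}) : C.Cee →+ C.Cee ⧸ C.P.ker := QuotientAddGroup.mk' C.P.ker

theorem P_eq_P {C : QPM.{u}} {a b : C.Cee} : C.P a = C.P b ↔ C.toImP a = C.toImP b := by
  rw [← sub_eq_zero, ← map_sub, ← sub_eq_zero (a := C.toImP a), ← map_sub]
  exact (QuotientAddGroup.eq_zero_iff (N := C.P.ker) (a - b)).symm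

@[simp] theorem toImP_T (C : QPM.{u}) (a : C.Cee) : C.toImP (C.T a) = C.toImP a :=
  P_eq_P.1 (C.P_T a)

namespace Bilin

variable {C D E : QPM.{u}} (B : Bilin C D E)

theorem toImP_p_T (a : C.Cee) (b : D.Cee) :
    E.toImP (B.p a (D.T b)) = -E.toImP (B.p (C.T a) b) := by
  rw [← map_neg, ← P_eq_P, P_p_T, map_neg]

/-- The element `x ⊚ y` in degree `(0, 0)`. -/
def o00 (x : C.C0) (y : D.C0) : E.C0 := B.v00 x y + E.d (E.P (-B.p (C.H x) (D.T (D.H y))))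
/-- The element `x ⊚ y` in degree `(1, 0)`. -/
def o10 (x : C.C1) (y : D.C0) : E.C1 := B.v10 x y + E.P (-B.p (C.H (C.d x)) (D.T (D.H y)))
/-- The element `x ⊚ y` in degree `(0, 1)`. -/
def o01 (x : C.C0) (y : D.C1) : E.C1 := B.v01 x y + E.P (-B.p (C.H x) (D.T (D.H (D.d y))))

theorem o00_eq (x : C.C0) (y : D.C0) :
    B.o00 x y = B.v00 x y + E.d (E.P (-B.p (C.H x) (D.T (D.H y)))) := rfl
theorem o10_eq (x : C.C1) (y : D.C0) :
    B.o10 x y = B.v10 x y + E.P (-B.p (C.H (C.d x)) (D.T (D.H y))) := rfl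
theorem o01_eq (x : C.C0) (y : D.C1) :
    B.o01 x y = B.v01 x y + E.P (-B.p (C.H x) (D.T (D.H (D.d y)))) := rfl

theorem dP_central (E : QPM.{u}) (a : E.Cee) (g : E.C0) :
    (E.d.comp E.P) a + g = g + (E.d.comp E.P) a := E.dP_comm a g

theorem o_add_left_aux (x x' : C.C0) (y : D.C0) :
    E.P (B.p (C.cr x' x) (D.H y) + -B.p (C.H (x + x')) (D.T (D.H y))) =
      E.P (-B.p (C.H x) (D.T (D.H y)) + -B.p (C.H x') (D.T (D.H y))) := by
  rw [P_eq_P]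
  simp only [H_add, map_add, map_neg, AddMonoidHom.add_apply, AddMonoidHom.neg_apply, toImP_p_T,
    T_cr]
  abel

theorem o_add_right_aux (x : C.C0) (y y' : D.C0) :
    E.P (-B.p (C.H x) (D.T (D.H (y + y')))) =
      E.P (-B.p (C.H x) (D.T (D.H y)) + -B.p (C.H x) (D.T (D.H y')) +
        B.p (C.H x) (D.cr y' y)) := by
  rw [P_eq_P]
  simp only [H_add, map_add, map_neg, T_cr]
  abel

theorem add_o00 (x x' : C.C0) (y : D.C0) : B.o00 (x + x') y = B.o00 x y + B.o00 x' y := by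
  have h := add_central_add (dP_central E)
  simp only [AddMonoidHom.comp_apply] at h
  rw [o00, o00, o00, h, add_v00, add_assoc, ← map_add, ← map_add, o_add_left_aux]

theorem add_o10 (x x' : C.C1) (y : D.C0) : B.o10 (x + x') y = B.o10 x y + B.o10 x' y := by
  rw [o10, o10, o10, add_central_add E.P_comm, add_v10, add_assoc, ← map_add, map_add C.d,
    o_add_left_aux]

theorem add_o01 (x x' : C.C0) (y : D.C1) : B.o01 (x + x') y = B.o01 x y + B.o01 x' y := by
  rw [o01, o01, o01, add_central_add E.P_comm, add_v01, add_assoc, ← map_add, o_add_left_aux]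

theorem o00_add (x : C.C0) (y y' : D.C0) : B.o00 x (y + y') =
    B.o00 x y + B.o00 x y' + E.d (E.P (B.p (C.H x) (D.cr y' y))) := by
  have h := add_central_add (dP_central E)
  simp only [AddMonoidHom.comp_apply] at h
  rw [o00, o00, o00, h, v00_add, o_add_right_aux, add_assoc (B.v00 x y + _), ← map_add, ← map_add]

theorem o10_add (x : C.C1) (y y' : D.C0) : B.o10 x (y + y') =
    B.o10 x y + B.o10 x y' + E.P (B.p (C.H (C.d x)) (D.cr y' y)) := by
  rw [o10, o10, o10, add_central_add E.P_comm, v10_add, o_add_right_aux,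
    add_assoc (B.v10 x y + _), ← map_add]

theorem o01_add (x : C.C0) (y y' : D.C1) : B.o01 x (y + y') =
    B.o01 x y + B.o01 x y' + E.P (B.p (C.H x) (D.cr (D.d y') (D.d y))) := by
  rw [o01, o01, o01, add_central_add E.P_comm, v01_add, map_add D.d, o_add_right_aux,
    add_assoc (B.v01 x y + _), ← map_add]

theorem d_o10 (x : C.C1) (y : D.C0) : E.d (B.o10 x y) = B.o00 (C.d x) y := by
  rw [o10, map_add, d_v10, o00]

theorem d_o01 (x : C.C0) (y : D.C1) : E.d (B.o01 x y) = B.o00 x (D.d y) := by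
  rw [o01, map_add, d_v01, o00]

theorem o10_d (x : C.C1) (y : D.C1) : B.o10 x (D.d y) = B.o01 (C.d x) y := by
  rw [o10, v10_d, o01]

theorem o01_P (x : C.C0) (b : D.Cee) : B.o01 x (D.P b) = E.P (B.p (C.Δ x) b) := by
  rw [o01, v01_P, ← map_add, P_eq_P]
  simp only [H_dP, Δ_apply, map_add, map_sub, map_neg, AddMonoidHom.add_apply,
    AddMonoidHom.sub_apply, toImP_p_T, T_T]
  abel

theorem P_o10 (a : C.Cee) (y : D.C0) : B.o10 (C.P a) y = E.P (B.p a (D.cr y y)) := by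
  rw [o10, P_v10, ← map_add, P_eq_P]
  simp only [H_dP, Δ_apply, map_add, map_sub, map_neg, AddMonoidHom.add_apply,
    toImP_p_T, T_T]
  abel

theorem cr_o00 (x x' : C.C0) (y y' : D.C0) :
    E.cr (B.o00 x y) (B.o00 x' y') = B.p (C.cr x x') (D.cr y y') := by
  simp [o00, cr_v00]

theorem H_o00 (x : C.C0) (y : D.C0) :
    E.H (B.o00 x y) = B.p (C.Δ x) (D.H y) + B.p (C.H x) (D.cr y y) := by
  rw [o00, H_add, H_v00, cr_dP_right, H_dP]
  simp only [Δ_apply, map_add, map_sub, map_neg, AddMonoidHom.add_apply,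
    AddMonoidHom.sub_apply, T_p, T_T]
  abel

/-- The bilinear map obtained by exchanging the two arguments. -/
def swap : Bilin D C E where
  v00 y x := B.o00 x y
  v10 y x := B.o01 x y
  v01 y x := B.o10 x y
  p := B.p.flip
  v00_add y x x' := B.add_o00 x x' y
  v10_add y x x' := B.add_o01 x x' y
  v01_add y x x' := B.add_o10 x x' y
  add_v00 y y' x := B.o00_add x y y'
  add_v10 y y' x := B.o01_add x y y'
  add_v01 y y' x := B.o10_add x y y'
  d_v10 y x := B.d_o01 x y
  d_v01 y x := B.d_o10 x y
  v10_d y x := (B.o10_d x y).symm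
  P_v10 b x := B.o01_P x b
  v01_P y a := B.P_o10 a y
  T_p b a := B.T_p a b
  cr_v00 y y' x x' := B.cr_o00 x x' y y'
  H_v00 y x := (B.H_o00 x y).trans (add_comm _ _)

theorem o_swap_aux (x : C.C0) (y : D.C0) :
    E.P (-B.p (C.H x) (D.T (D.H y)) + -B.p (C.T (C.H x)) (D.H y)) = 0 := by
  rw [← map_zero E.P, P_eq_P]
  simp only [map_add, map_neg, toImP_p_T]
  simp

theorem swap_o00 (y : D.C0) (x : C.C0) : B.swap.o00 y x = B.v00 x y := by
  change B.v00 x y + E.d (E.P _) + E.d (E.P (-B.p _ _)) = _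
  rw [add_assoc, ← map_add, ← map_add, o_swap_aux, map_zero, add_zero]

theorem swap_o10 (y : D.C1) (x : C.C0) : B.swap.o10 y x = B.v01 x y := by
  change B.v01 x y + E.P _ + E.P (-B.p _ _) = _
  rw [add_assoc, ← map_add, o_swap_aux, add_zero]

theorem swap_o01 (y : D.C0) (x : C.C1) : B.swap.o01 y x = B.v10 x y := by
  change B.v10 x y + E.P _ + E.P (-B.p _ _) = _
  rw [add_assoc, ← map_add, o_swap_aux, add_zero]

theorem desc_o00 (x : C.C0) (y : D.C0) : B.desc.f0 ((univ C D).o00 x y) = B.o00 x y := by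
  rw [o00, o00, map_add, B.desc.map_d, B.desc.map_P, map_neg B.desc.fee]
  exact congrArg (· + _) (B.desc_u00 x y)

theorem desc_o10 (x : C.C1) (y : D.C0) : B.desc.f1 ((univ C D).o10 x y) = B.o10 x y := by
  rw [o10, o10, map_add, B.desc.map_P, map_neg B.desc.fee]
  exact congrArg (· + _) (B.desc_u10 x y)

theorem desc_o01 (x : C.C0) (y : D.C1) : B.desc.f1 ((univ C D).o01 x y) = B.o01 x y := by
  rw [o01, o01, map_add, B.desc.map_P, map_neg B.desc.fee]
  exact congrArg (· + _) (B.desc_u01 x y)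

end Bilin

theorem univ_o00 (C D : QPM.{u}) (x : C.C0) (y : D.C0) :
    (Bilin.univ C D).o00 x y = o00 C D x y := by
  refine Eq.trans ?_ (circ_eq (X := C.sq0) (Y := D.sq0) x y).symm
  refine congrArg (u00 C D x y + ·) ?_
  rw [map_neg, map_neg]
  exact congrArg (- ·) (dP_tee _ _)

theorem univ_o01 (C D : QPM.{u}) (x : C.C0) (y : D.C1) :
    (Bilin.univ C D).o01 x y = o01 C D x y := by
  refine Eq.trans ?_ (congrArg (xi C D) (circ_eq (X := C.sq0) (Y := D.sq1) x y)).symm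
  refine Eq.trans ?_ (map_add _ _ _).symm
  refine congrArg (u01 C D x y + ·) ?_
  rw [map_neg]
  exact (congrArg (- ·) (xi_bar _ _).symm).trans (map_neg (xi C D) _).symm

/-- The symmetry `C ⊙ D → D ⊙ C`, `x ⊚̲ y ↦ y ⊚ x`. -/
def braid (C D : QPM.{u}) : C.tensor D ⟶ D.tensor C := (Bilin.univ D C).swap.desc

section braid

variable {C D : QPM.{u}}

@[simp] theorem braid_u00 (x : C.C0) (y : D.C0) :
    (braid C D).f0 (u00 C D x y) = (Bilin.univ D C).o00 y x := Bilin.desc_u00 _ x y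
@[simp] theorem braid_u10 (x : C.C1) (y : D.C0) :
    (braid C D).f1 (u10 C D x y) = (Bilin.univ D C).o01 y x := Bilin.desc_u10 _ x y
@[simp] theorem braid_u01 (x : C.C0) (y : D.C1) :
    (braid C D).f1 (u01 C D x y) = (Bilin.univ D C).o10 y x := Bilin.desc_u01 _ x y
@[simp] theorem braid_tee (a : C.Cee) (b : D.Cee) :
    (braid C D).fee (tee C D a b) = tee D C b a := rfl
@[simp] theorem braid_o00 (x : C.C0) (y : D.C0) :
    (braid C D).f0 ((Bilin.univ C D).o00 x y) = u00 D C y x :=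
  (Bilin.desc_o00 _ x y).trans (Bilin.swap_o00 _ x y)
@[simp] theorem braid_o10 (x : C.C1) (y : D.C0) :
    (braid C D).f1 ((Bilin.univ C D).o10 x y) = u01 D C y x :=
  (Bilin.desc_o10 _ x y).trans (Bilin.swap_o10 _ x y)
@[simp] theorem braid_o01 (x : C.C0) (y : D.C1) :
    (braid C D).f1 ((Bilin.univ C D).o01 x y) = u10 D C y x :=
  (Bilin.desc_o01 _ x y).trans (Bilin.swap_o01 _ x y)

theorem braid_braid (C D : QPM.{u}) : braid C D ≫ braid D C = 𝟙 (C.tensor D) :=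
  tensor_hom_ext (by simp) (by simp) (by simp) (by simp)

/-- The symmetry as an isomorphism. -/
def braidIso (C D : QPM.{u}) : C.tensor D ≅ D.tensor C :=
  ⟨braid C D, braid D C, braid_braid C D, braid_braid D C⟩

end braid

section tensorMap

variable {C D C' D' : QPM.{u}} (f : C ⟶ C') (g : D ⟶ D')

@[simp] theorem tensorMap_u00 (x : C.C0) (y : D.C0) :
    (tensorMap f g).f0 (u00 C D x y) = u00 C' D' (f.f0 x) (g.f0 y) :=
  tensorMapE_circU (map0 f) (map0 g) x y

@[simp] theorem tensorMap_tee (a : C.Cee) (b : D.Cee) :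
    (tensorMap f g).fee (tee C D a b) = tee C' D' (f.fee a) (g.fee b) := rfl

theorem phiMap_phiUnit {X Y X' Y' : SquareGroup.{u}} {h : X ⟶ Y} {h' : X' ⟶ Y'} (α : X ⟶ X')
    (β : Y ⟶ Y') (w : α ≫ h' = h ≫ β) (x : X.e) :
    (phiMap α β w).f1 (phiUnit h x) = phiUnit h' (α.e x) := by
  refine (phiMap1_mk α β w (x, 0)).trans ?_
  rw [map_zero]
  rfl

@[simp] theorem tensorMap_u10 (x : C.C1) (y : D.C0) :
    (tensorMap f g).f1 (u10 C D x y) = u10 C' D' (f.f1 x) (g.f0 y) :=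
  (phiMap_phiUnit _ _ _ _).trans (congrArg (zeta C' D') (tensorMapE_circU (map1 f) (map0 g) x y))

@[simp] theorem tensorMap_u01 (x : C.C0) (y : D.C1) :
    (tensorMap f g).f1 (u01 C D x y) = u01 C' D' (f.f0 x) (g.f1 y) :=
  (phiMap_phiUnit _ _ _ _).trans (congrArg (xi C' D') (tensorMapE_circU (map0 f) (map1 g) x y))

@[simp] theorem tensorMap_o00 (x : C.C0) (y : D.C0) :
    (tensorMap f g).f0 ((Bilin.univ C D).o00 x y) = (Bilin.univ C' D').o00 (f.f0 x) (g.f0 y) := by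
  rw [Bilin.o00, Bilin.o00, map_add, (tensorMap f g).map_d, (tensorMap f g).map_P, map_neg,
    ← f.map_H, ← g.map_H, ← map_T]
  exact congrArg (· + _) (tensorMap_u00 f g x y)

@[simp] theorem tensorMap_o10 (x : C.C1) (y : D.C0) :
    (tensorMap f g).f1 ((Bilin.univ C D).o10 x y) = (Bilin.univ C' D').o10 (f.f1 x) (g.f0 y) := by
  rw [Bilin.o10, Bilin.o10, map_add, (tensorMap f g).map_P, map_neg, ← f.map_d,
    ← f.map_H, ← g.map_H, ← map_T]
  exact congrArg (· + _) (tensorMap_u10 f g x y)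

@[simp] theorem tensorMap_o01 (x : C.C0) (y : D.C1) :
    (tensorMap f g).f1 ((Bilin.univ C D).o01 x y) = (Bilin.univ C' D').o01 (f.f0 x) (g.f1 y) := by
  rw [Bilin.o01, Bilin.o01, map_add, (tensorMap f g).map_P, map_neg, ← g.map_d,
    ← f.map_H, ← g.map_H, ← map_T]
  exact congrArg (· + _) (tensorMap_u01 f g x y)

end tensorMap

end QPM

end

section

open scoped TensorProduct

namespace QPM

open SquareGroup

/-! ### Associativity -/

section desc

variable {C D : QPM.{u}}

/-- A homomorphism out of `(C ⊙ D)_ee`. -/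
def teeDesc {A : Type*} [AddCommGroup A] (p : C.Cee →+ D.Cee →+ A) : (C.tensor D).Cee →+ A :=
  liftEE (X := C.sq0) (Y := D.sq0) p

@[simp] theorem teeDesc_tee {A : Type*} [AddCommGroup A] (p : C.Cee →+ D.Cee →+ A) (a : C.Cee)
    (b : D.Cee) : teeDesc p (tee C D a b) = p a b := rfl

section
variable {A G : Type*} [AddCommGroup A] [AddGroup G] (P : A →+ G)
    (hP : ∀ a g, P a + g = g + P a) (v : C.C0 → D.C0 → G) (p : C.Cee →+ D.Cee →+ A)
    (add_right : ∀ x y y', v x (y + y') = v x y + v x y')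
    (add_left : ∀ x x' y, v (x + x') y = v x y + v x' y + P (p (C.cr x' x) (D.H y)))
    (P_left : ∀ a y, v (C.d (C.P a)) y = P (p a (D.Δ y)))
    (P_right : ∀ x b, v x (D.d (D.P b)) = P (p (C.cr x x) b))
    (T_T : ∀ a b, P (p (C.T a) (D.T b)) = -P (p a b))

/-- A homomorphism out of `(C ⊙ D)_0`. -/
def desc0 : (C.tensor D).C0 →+ G :=
  tensorEDesc (X := C.sq0) (Y := D.sq0) P hP v p add_right add_left P_left P_right T_T

@[simp] theorem desc0_u00 (x : C.C0) (y : D.C0) :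
    desc0 P hP v p add_right add_left P_left P_right T_T (u00 C D x y) = v x y :=
  tensorEDesc_circU (X := C.sq0) (Y := D.sq0) x y

@[simp] theorem desc0_dP (t : (C.tensor D).Cee) :
    desc0 P hP v p add_right add_left P_left P_right T_T ((C.tensor D).d ((C.tensor D).P t)) =
      P (teeDesc p t) := by
  refine DFunLike.congr_fun (tensoree_hom_ext (f := (desc0 P hP v p add_right add_left P_left
    P_right T_T).comp ((C.tensor D).d.comp (C.tensor D).P)) (g := P.comp (teeDesc p))
    fun a b => ?_) t
  exact (congrArg (desc0 P hP v p add_right add_left P_left P_right T_T) (dP_tee a b)).trans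
    (tensorEDesc_bar (X := C.sq0) (Y := D.sq0) a b)
end

theorem T_tee (a : C.Cee) (b : D.Cee) : (C.tensor D).T (tee C D a b) = -tee C D (C.T a) (D.T b) :=
  (Bilin.univ C D).T_p a b

theorem H_u00 (x : C.C0) (y : D.C0) : (C.tensor D).H (u00 C D x y) =
    tee C D (C.cr x x) (D.H y) + tee C D (C.H x) (D.Δ y) :=
  (Bilin.univ C D).H_v00 x y

theorem cr_u00 (x x' : C.C0) (y y' : D.C0) :
    (C.tensor D).cr (u00 C D x y) (u00 C D x' y') = tee C D (C.cr x x') (D.cr y y') :=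
  (Bilin.univ C D).cr_v00 x x' y y'

theorem Bilin.Δ_v00 {E : QPM.{u}} (B : Bilin C D E) (x : C.C0) (y : D.C0) :
    E.Δ (B.v00 x y) = B.p (C.Δ x) (D.Δ y) := by
  rw [QPM.Δ_apply, B.H_v00, B.cr_v00]
  simp only [map_add, map_sub, B.T_p, QPM.T_cr, QPM.Δ_apply, map_neg, T_T,
    AddMonoidHom.add_apply, AddMonoidHom.sub_apply, AddMonoidHom.neg_apply]
  abel

theorem Δ_u00 (x : C.C0) (y : D.C0) :
    (C.tensor D).Δ (u00 C D x y) = tee C D (C.Δ x) (D.Δ y) := (Bilin.univ C D).Δ_v00 x y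

end desc

/-- The sum of two homomorphisms and a central function, as a homomorphism. -/
def addHom {Q A G : Type*} [AddGroup Q] [AddCommGroup A] [AddGroup G] (P : A →+ G)
    (hP : ∀ a g, P a + g = g + P a) (f g : Q →+ G) (h : Q → A) (k : Q → Q → A)
    (hh : ∀ q q', h (q + q') = h q + h q' + k q q')
    (hc : ∀ q q', g q + f q' = f q' + g q + P (k q q')) : Q →+ G :=
  AddMonoidHom.mk' (fun q => f q + g q + P (h q)) fun q q' => by
    rw [add_central_add hP, hh, map_add f, map_add g, map_add P (h q + h q')]
    have h1 : f q + g q + (f q' + g q') = f q + f q' + (g q + g q') + P (k q q') := by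
      rw [add_assoc, ← add_assoc (g q), hc, add_assoc (f q' + g q), hP]
      simp only [add_assoc]
    rw [h1, add_assoc _ (P (k q q')), hP, ← add_assoc]

@[simp] theorem addHom_apply {Q A G : Type*} [AddGroup Q] [AddCommGroup A] [AddGroup G] (P : A →+ G)
    (hP : ∀ a g, P a + g = g + P a) (f g : Q →+ G) (h : Q → A) (k : Q → Q → A)
    (hh : ∀ q q', h (q + q') = h q + h q' + k q q')
    (hc : ∀ q q', g q + f q' = f q' + g q + P (k q q')) (q : Q) :
    addHom P hP f g h k hh hc q = f q + g q + P (h q) := rfl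

namespace Bilin

variable {C D E X T : QPM.{u}} (V : Bilin C D X) (U : Bilin X E T)

/-- The composition of the biadditive maps in degree `ee`. -/
def assocP : C.Cee →+ (D.tensor E).Cee →+ T.Cee :=
  AddMonoidHom.mk' (fun a => teeDesc (U.p.comp (V.p a)))
    fun a a' => tensoree_hom_ext fun b c => by simp

@[simp] theorem assocP_tee (a : C.Cee) (b : D.Cee) (c : E.Cee) :
    assocP V U a (tee D E b c) = U.p (V.p a b) c := rfl

theorem T_assocP (a : C.Cee) (t : (D.tensor E).Cee) :
    T.T (assocP V U a t) = -assocP V U (C.T a) ((D.tensor E).T t) := by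
  refine DFunLike.congr_fun (tensoree_hom_ext (f := T.T.comp (assocP V U a))
    (g := -(assocP V U (C.T a)).comp (D.tensor E).T) fun b c => ?_) t
  simp [T_tee, U.T_p, V.T_p]

theorem V_p_cr_T (x : C.C0) (b : D.Cee) : V.p (C.cr x x) (D.T b) = X.T (V.p (C.cr x x) b) := by
  rw [T_p, T_cr]; simp

theorem P_p_cr_T_T (x : C.C0) (b : D.Cee) (c : E.Cee) :
    T.P (U.p (V.p (C.cr x x) (D.T b)) (E.T c)) = -T.P (U.p (V.p (C.cr x x) b) c) := by
  rw [V_p_cr_T, U.P_p_T_T]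

/-- The map `x ⊚̲ (y ⊚̲ z) ↦ (x ⊚̲ y) ⊚̲ z` in degree `(0, 0, 0)`. -/
def assoc00 (x : C.C0) : (D.tensor E).C0 →+ T.C0 :=
  desc0 (T.d.comp T.P) (dP_central T) (fun y z => U.v00 (V.v00 x y) z) (U.p.comp (V.p (C.cr x x)))
    (fun y z z' => U.v00_add _ z z')
    (fun y y' z => by rw [V.v00_add, U.add_v00, V.cr_v00]; rfl)
    (fun b z => by rw [V.v00_dP, U.dP_v00]; rfl)
    (fun y c => by rw [U.v00_dP, V.cr_v00]; rfl)
    (fun b c => by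
      refine (congrArg T.d (V.P_p_cr_T_T U x b c)).trans ?_
      rw [map_neg]; rfl)

@[simp] theorem assoc00_u00 (x : C.C0) (y : D.C0) (z : E.C0) :
    assoc00 V U x (u00 D E y z) = U.v00 (V.v00 x y) z := desc0_u00 ..

@[simp] theorem assoc00_dP (x : C.C0) (t : (D.tensor E).Cee) :
    assoc00 V U x ((D.tensor E).d ((D.tensor E).P t)) = T.d (T.P (assocP V U (C.cr x x) t)) :=
  desc0_dP ..

/-- The map `x ⊚̲ (y ⊚̲ z) ↦ (x ⊚̲ y) ⊚̲ z` in degree `(1, 0, 0)`. -/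
def assoc10 (x : C.C1) : (D.tensor E).C0 →+ T.C1 :=
  desc0 T.P T.P_comm (fun y z => U.v10 (V.v10 x y) z) (U.p.comp (V.p (C.cr (C.d x) (C.d x))))
    (fun y z z' => U.v10_add _ z z')
    (fun y y' z => by rw [V.v10_add, U.add_v10, V.d_v10, V.d_v10, V.cr_v00]; rfl)
    (fun b z => by rw [V.v10_dP, U.P_v10]; rfl)
    (fun y c => by rw [U.v10_dP, V.d_v10, V.cr_v00]; rfl)
    (fun b c => V.P_p_cr_T_T U (C.d x) b c)

@[simp] theorem assoc10_u00 (x : C.C1) (y : D.C0) (z : E.C0) :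
    assoc10 V U x (u00 D E y z) = U.v10 (V.v10 x y) z := desc0_u00 ..

@[simp] theorem assoc10_dP (x : C.C1) (t : (D.tensor E).Cee) :
    assoc10 V U x ((D.tensor E).d ((D.tensor E).P t)) =
      T.P (assocP V U (C.cr (C.d x) (C.d x)) t) :=
  desc0_dP ..

theorem cr_assoc00 (x x' : C.C0) (q q' : (D.tensor E).C0) :
    T.cr (assoc00 V U x q) (assoc00 V U x' q') =
      assocP V U (C.cr x x') ((D.tensor E).cr q q') := by
  have h : ∀ y z, (T.cr (U.v00 (V.v00 x y) z)).comp (assoc00 V U x') =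
      (assocP V U (C.cr x x')).comp ((D.tensor E).cr (u00 D E y z)) := fun y z =>
    tensor0_hom_ext (fun y' z' => by simp [cr_u00, U.cr_v00, V.cr_v00]) (fun b c => by simp)
  refine DFunLike.congr_fun (tensor0_hom_ext (f := (T.cr.flip (assoc00 V U x' q')).comp
    (assoc00 V U x)) (g := (assocP V U (C.cr x x')).comp ((D.tensor E).cr.flip q'))
    (fun y z => ?_) (fun b c => ?_)) q
  · simpa using DFunLike.congr_fun (h y z) q'
  · simp

theorem P_assocP_T (x x' : C.C0) (t : (D.tensor E).Cee) :
    T.P (assocP V U (C.cr x x') ((D.tensor E).T t)) = T.P (assocP V U (C.cr x' x) t) := by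
  have h := T_assocP V U (C.cr x' x) t
  rw [T_cr, map_neg, AddMonoidHom.neg_apply, neg_neg] at h
  rw [← h, P_T]

/-- The data of the map `x ⊚̲ (y ⊚̲ z) ↦ (x ⊚̲ y) ⊚̲ z` in the degrees `(0, 1, 0)` and `(0, 0, 1)`. -/
def assocExt (x : C.C0) : Ext D E T where
  φ := assoc00 V U x
  χ := assocP V U (C.cr x x)
  v10 y z := U.v10 (V.v01 x y) z
  v01 y z := U.v01 (V.v00 x y) z
  hP := assoc00_dP V U x
  hcr q q' := by rw [cr_assoc00]
  hT := P_assocP_T V U x x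
  v10_add y z z' := U.v10_add _ z z'
  v01_add y z z' := U.v01_add _ z z'
  add_v10 y y' z := by rw [V.v01_add, U.add_v10, V.d_v01, V.d_v01, V.cr_v00]; rfl
  add_v01 y y' z := by rw [V.v00_add, U.add_v01, V.cr_v00]; rfl
  d_v10 y z := by rw [U.d_v10, V.d_v01, assoc00_u00]
  d_v01 y z := by rw [U.d_v01, assoc00_u00]
  v10_d y z := by rw [U.v10_d, V.d_v01]
  P_v10 b z := by rw [V.v01_P, U.P_v10]; rfl
  v01_P y c := by rw [U.v01_P, V.cr_v00]; rfl

/-- The map `x ⊚̲ (y ⊚̲ z) ↦ (x ⊚̲ y) ⊚̲ z` in the degrees `(0, 1, 0)` and `(0, 0, 1)`. -/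
def assoc01 (x : C.C0) : (D.tensor E).C1 →+ T.C1 := (assocExt V U x).hom

@[simp] theorem assoc01_u10 (x : C.C0) (y : D.C1) (z : E.C0) :
    assoc01 V U x (u10 D E y z) = U.v10 (V.v01 x y) z := Ext.hom_u10 ..
@[simp] theorem assoc01_u01 (x : C.C0) (y : D.C0) (z : E.C1) :
    assoc01 V U x (u01 D E y z) = U.v01 (V.v00 x y) z := Ext.hom_u01 ..
@[simp] theorem assoc01_P (x : C.C0) (t : (D.tensor E).Cee) :
    assoc01 V U x ((D.tensor E).P t) = T.P (assocP V U (C.cr x x) t) := Ext.hom_P ..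
theorem d_assoc01 (x : C.C0) (q : (D.tensor E).C1) :
    T.d (assoc01 V U x q) = assoc00 V U x ((D.tensor E).d q) := Ext.d_hom ..

theorem d_assoc10 (x : C.C1) (q : (D.tensor E).C0) :
    T.d (assoc10 V U x q) = assoc00 V U (C.d x) q :=
  DFunLike.congr_fun (tensor0_hom_ext (f := T.d.comp (assoc10 V U x)) (g := assoc00 V U (C.d x))
    (fun y z => by simp [U.d_v10, V.d_v10]) (fun b c => by simp)) q

theorem P_assocP_add (x x' : C.C0) (t : (D.tensor E).Cee) :
    T.P (assocP V U (C.cr (x + x') (x + x')) t) = T.P (assocP V U (C.cr x x) t) +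
      T.P (assocP V U (C.cr x' x') t) +
        T.P (assocP V U (C.cr x' x) ((D.tensor E).H ((D.tensor E).d ((D.tensor E).P t)))) := by
  rw [H_dP, map_add (assocP V U _), map_add T.P, P_assocP_T, ← map_add, ← map_add, ← map_add]
  congr 1
  simp only [map_add, AddMonoidHom.add_apply]
  abel

theorem p_H_u00 (a : C.Cee) (y : D.C0) (z : E.C0) :
    assocP V U a ((D.tensor E).H (u00 D E y z)) =
      U.p (V.p a (D.cr y y)) (E.H z) + U.p (V.p a (D.H y)) (E.Δ z) := by
  rw [H_u00]; simp

theorem add_assoc10 (x x' : C.C1) (q : (D.tensor E).C0) :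
    assoc10 V U (x + x') q = assoc10 V U x q + assoc10 V U x' q +
      T.P (assocP V U (C.cr (C.d x') (C.d x)) ((D.tensor E).H q)) := by
  refine DFunLike.congr_fun (tensor0_hom_ext (f := assoc10 V U (x + x'))
    (g := addHom T.P T.P_comm (assoc10 V U x) (assoc10 V U x')
      (fun q => assocP V U (C.cr (C.d x') (C.d x)) ((D.tensor E).H q))
      (fun q q' => assocP V U (C.cr (C.d x') (C.d x)) ((D.tensor E).cr q q'))
      (fun q q' => by simp [H_add]) (fun q q' => by
        rw [T.add_comm1, d_assoc10, d_assoc10, cr_assoc00])) (fun y z => ?_) (fun b c => ?_)) q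
  · rw [addHom_apply, assoc10_u00, assoc10_u00, assoc10_u00, V.add_v10, U.add_v10, U.add_v10,
      map_add X.d, U.P_v10, p_H_u00, V.d_v10, V.d_v10, V.cr_v00]
    simp only [cr_dP_left, map_zero, AddMonoidHom.zero_apply, add_zero]
    rw [add_assoc _ (T.P _), ← map_add]
  · rw [addHom_apply, assoc10_dP, assoc10_dP, assoc10_dP, map_add C.d, P_assocP_add]

theorem add_assoc01 (x x' : C.C0) (q : (D.tensor E).C1) :
    assoc01 V U (x + x') q = assoc01 V U x q + assoc01 V U x' q +
      T.P (assocP V U (C.cr x' x) ((D.tensor E).H ((D.tensor E).d q))) := by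
  refine DFunLike.congr_fun (tensor1_hom_ext (f := assoc01 V U (x + x'))
    (g := addHom T.P T.P_comm (assoc01 V U x) (assoc01 V U x')
      (fun q => assocP V U (C.cr x' x) ((D.tensor E).H ((D.tensor E).d q)))
      (fun q q' => assocP V U (C.cr x' x) ((D.tensor E).cr ((D.tensor E).d q) ((D.tensor E).d q')))
      (fun q q' => by simp [H_add]) (fun q q' => by
        rw [T.add_comm1, d_assoc01, d_assoc01, cr_assoc00]))
      (fun y z => ?_) (fun y z => ?_) (fun b c => ?_)) q
  · have h : (D.tensor E).d (u10 D E y z) = u00 D E (D.d y) z := (univ D E).d_v10 y z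
    rw [addHom_apply, assoc01_u10, assoc01_u10, assoc01_u10, V.add_v01, U.add_v10, U.add_v10,
      map_add X.d, U.P_v10, h, p_H_u00, V.d_v01, V.d_v01, V.cr_v00]
    simp only [cr_dP_left, map_zero, AddMonoidHom.zero_apply, add_zero]
    rw [add_assoc _ (T.P _), ← map_add]
  · have h : (D.tensor E).d (u01 D E y z) = u00 D E y (E.d z) := (univ D E).d_v01 y z
    rw [addHom_apply, assoc01_u01, assoc01_u01, assoc01_u01, V.add_v00, U.add_v01, U.add_v01,
      U.dP_v01, h, p_H_u00, V.cr_v00]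
    simp only [cr_dP_left, map_zero, AddMonoidHom.zero_apply, add_zero]
    rw [add_assoc _ (T.P _), ← map_add]
  · rw [addHom_apply, assoc01_P, assoc01_P, assoc01_P, P_assocP_add]

theorem add_assoc00 (x x' : C.C0) (q : (D.tensor E).C0) :
    assoc00 V U (x + x') q = assoc00 V U x q + assoc00 V U x' q +
      T.d (T.P (assocP V U (C.cr x' x) ((D.tensor E).H q))) := by
  refine DFunLike.congr_fun (tensor0_hom_ext (f := assoc00 V U (x + x'))
    (g := addHom (T.d.comp T.P) (dP_central T) (assoc00 V U x) (assoc00 V U x')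
      (fun q => assocP V U (C.cr x' x) ((D.tensor E).H q))
      (fun q q' => assocP V U (C.cr x' x) ((D.tensor E).cr q q'))
      (fun q q' => by simp [H_add]) (fun q q' => by
        rw [T.add_comm0, cr_assoc00]; rfl)) (fun y z => ?_) (fun b c => ?_)) q
  · rw [addHom_apply, assoc00_u00, assoc00_u00, assoc00_u00, V.add_v00, U.add_v00, U.add_v00,
      U.dP_v00, p_H_u00, V.cr_v00]
    simp only [cr_dP_left, map_zero, AddMonoidHom.zero_apply, add_zero, AddMonoidHom.comp_apply]
    rw [add_assoc _ (T.d (T.P _)), ← map_add, ← map_add]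
  · rw [addHom_apply, assoc00_dP, assoc00_dP, assoc00_dP, P_assocP_add, map_add, map_add]
    rfl

theorem assoc10_d (x : C.C1) (q : (D.tensor E).C1) :
    assoc10 V U x ((D.tensor E).d q) = assoc01 V U (C.d x) q := by
  refine DFunLike.congr_fun (tensor1_hom_ext (f := (assoc10 V U x).comp (D.tensor E).d)
    (g := assoc01 V U (C.d x)) (fun y z => ?_) (fun y z => ?_) (fun b c => ?_)) q
  · have h : (D.tensor E).d (u10 D E y z) = u00 D E (D.d y) z := (univ D E).d_v10 y z
    simp [h, V.v10_d]
  · have h : (D.tensor E).d (u01 D E y z) = u00 D E y (E.d z) := (univ D E).d_v01 y z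
    simp [h, U.v10_d, V.d_v10]
  · simp

theorem P_assoc10 (a : C.Cee) (q : (D.tensor E).C0) :
    assoc10 V U (C.P a) q = T.P (assocP V U a ((D.tensor E).Δ q)) :=
  DFunLike.congr_fun (tensor0_hom_ext (f := assoc10 V U (C.P a))
    (g := (T.P.comp (assocP V U a)).comp (D.tensor E).Δ)
    (fun y z => by simp [Δ_u00, V.P_v10, U.P_v10]) (fun b c => by simp)) q

theorem H_assoc00 (x : C.C0) (q : (D.tensor E).C0) : T.H (assoc00 V U x q) =
    assocP V U (C.cr x x) ((D.tensor E).H q) + assocP V U (C.H x) ((D.tensor E).Δ q) := by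
  induction q using tensor0_induction with
  | h0 => simp
  | hneg q ih =>
    rw [map_neg, QPM.H_neg, QPM.H_neg, ih, cr_assoc00]
    simp only [map_add, map_neg]
    abel
  | hadd q q' ih ih' =>
    rw [map_add, QPM.H_add, QPM.H_add, ih, ih', cr_assoc00]
    simp only [map_add]
    abel
  | hu y z =>
    rw [assoc00_u00, U.H_v00, V.H_v00, V.cr_v00, p_H_u00, Δ_u00]
    simp only [map_add, AddMonoidHom.add_apply, assocP_tee]
    abel
  | hb b c =>
    rw [assoc00_dP, H_dP, H_dP, Δ_dP, T_assocP, T_cr]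
    simp

/-- The bilinear map `(x, y ⊚̲ z) ↦ (x ⊚̲ y) ⊚̲ z` associated with two bilinear maps. -/
def assoc : Bilin C (D.tensor E) T where
  v00 x := assoc00 V U x
  v10 x := assoc10 V U x
  v01 x := assoc01 V U x
  p := assocP V U
  v00_add _ := map_add _
  v10_add _ := map_add _
  v01_add _ := map_add _
  add_v00 := add_assoc00 V U
  add_v10 := add_assoc10 V U
  add_v01 := add_assoc01 V U
  d_v10 := d_assoc10 V U
  d_v01 := d_assoc01 V U
  v10_d := assoc10_d V U
  P_v10 := P_assoc10 V U
  v01_P := assoc01_P V U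
  T_p := T_assocP V U
  cr_v00 := cr_assoc00 V U
  H_v00 := H_assoc00 V U

end Bilin

end QPM

end

section

open scoped TensorProduct

namespace QPM

open SquareGroup

namespace Bilin

variable {C D E X T : QPM.{u}} (V : Bilin C D X) (U : Bilin X E T)

theorem o_assoc_aux (x : C.C0) (y : D.C0) (z : E.C0) :
    T.P (assocP V U (C.cr x x) (-tee D E (D.H y) (E.T (E.H z))) +
        -assocP V U (C.H x) ((D.tensor E).T ((D.tensor E).H ((univ D E).o00 y z)))) =
      T.P (U.p (-V.p (C.H x) (D.T (D.H y))) (E.Δ z) +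
        -U.p (X.H (V.o00 x y)) (E.T (E.H z))) := by
  have h : T.toImP (U.p (V.p (C.H x) (D.T (D.H y))) (E.H z)) =
      T.toImP (U.p (V.p (C.T (C.H x)) (D.H y)) (E.T (E.H z))) := by
    rw [toImP_p_T, V.T_p, T_T, map_neg, AddMonoidHom.neg_apply, map_neg, neg_neg]
  rw [P_eq_P, H_o00, H_o00]
  simp only [univ, teeHom_apply, map_add, map_neg, T_tee, T_cr, assocP_tee,
    AddMonoidHom.add_apply, AddMonoidHom.neg_apply, Δ_apply, map_sub, AddMonoidHom.sub_apply, h,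
    T_T]
  abel

theorem assoc_o00 (x : C.C0) (y : D.C0) (z : E.C0) :
    (V.assoc U).o00 x ((univ D E).o00 y z) = U.o00 (V.o00 x y) z := by
  have h := V.o_assoc_aux U x y z
  rw [map_add, map_add] at h
  have h1 : (V.assoc U).v00 x ((univ D E).o00 y z) = U.v00 (V.v00 x y) z +
      T.d (T.P (assocP V U (C.cr x x) (-tee D E (D.H y) (E.T (E.H z))))) := by
    rw [o00, v00_add, v00_dP]
    exact congrArg (· + _) (assoc00_u00 V U x y z)
  have h2 : U.v00 (V.o00 x y) z =
      U.v00 (V.v00 x y) z + T.d (T.P (U.p (-V.p (C.H x) (D.T (D.H y))) (E.Δ z))) := by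
    rw [o00, U.add_v00, U.dP_v00, cr_dP_left]; simp
  rw [(V.assoc U).o00_eq, h1, U.o00_eq, h2, add_assoc, add_assoc, ← map_add T.d, ← map_add T.P,
    ← map_add T.d]
  rw [← map_add T.P] at h
  exact congrArg (fun t => U.v00 (V.v00 x y) z + T.d t) h

theorem assoc_o100 (x : C.C1) (y : D.C0) (z : E.C0) :
    (V.assoc U).o10 x ((univ D E).o00 y z) = U.o10 (V.o10 x y) z := by
  have h := V.o_assoc_aux U (C.d x) y z
  rw [map_add, map_add] at h
  have h1 : (V.assoc U).v10 x ((univ D E).o00 y z) = U.v10 (V.v10 x y) z +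
      T.P (assocP V U (C.cr (C.d x) (C.d x)) (-tee D E (D.H y) (E.T (E.H z)))) := by
    rw [o00, v10_add, v10_dP]
    exact congrArg (· + _) (assoc10_u00 V U x y z)
  have h2 : U.v10 (V.o10 x y) z =
      U.v10 (V.v10 x y) z + T.P (U.p (-V.p (C.H (C.d x)) (D.T (D.H y))) (E.Δ z)) := by
    rw [o10, U.add_v10, U.P_v10, cr_dP_left]; simp
  rw [(V.assoc U).o10_eq, h1, U.o10_eq, h2, add_assoc, add_assoc, d_o10]
  exact congrArg (fun t => U.v10 (V.v10 x y) z + t) h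

theorem assoc_o010 (x : C.C0) (y : D.C1) (z : E.C0) :
    (V.assoc U).o01 x ((univ D E).o10 y z) = U.o10 (V.o01 x y) z := by
  have h := V.o_assoc_aux U x (D.d y) z
  rw [map_add, map_add] at h
  have h1 : (V.assoc U).v01 x ((univ D E).o10 y z) = U.v10 (V.v01 x y) z +
      T.P (assocP V U (C.cr x x) (-tee D E (D.H (D.d y)) (E.T (E.H z)))) := by
    rw [o10, v01_add, v01_P]
    exact congrArg (· + _) (assoc01_u10 V U x y z)
  have h2 : U.v10 (V.o01 x y) z =
      U.v10 (V.v01 x y) z + T.P (U.p (-V.p (C.H x) (D.T (D.H (D.d y)))) (E.Δ z)) := by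
    rw [o01, U.add_v10, U.P_v10, cr_dP_left]; simp
  rw [(V.assoc U).o01_eq, h1, U.o10_eq, h2, add_assoc, add_assoc, d_o10, d_o01]
  exact congrArg (fun t => U.v10 (V.v01 x y) z + t) h

theorem assoc_o001 (x : C.C0) (y : D.C0) (z : E.C1) :
    (V.assoc U).o01 x ((univ D E).o01 y z) = U.o01 (V.o00 x y) z := by
  have h := V.o_assoc_aux U x y (E.d z)
  rw [map_add, map_add] at h
  have h1 : (V.assoc U).v01 x ((univ D E).o01 y z) = U.v01 (V.v00 x y) z +
      T.P (assocP V U (C.cr x x) (-tee D E (D.H y) (E.T (E.H (E.d z))))) := by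
    rw [o01, v01_add, v01_P]
    exact congrArg (· + _) (assoc01_u01 V U x y z)
  have h2 : U.v01 (V.o00 x y) z =
      U.v01 (V.v00 x y) z + T.P (U.p (-V.p (C.H x) (D.T (D.H y))) (E.Δ (E.d z))) := by
    rw [o00, U.add_v01, U.dP_v01, cr_dP_left]; simp
  rw [(V.assoc U).o01_eq, h1, U.o01_eq, h2, add_assoc, add_assoc, d_o01]
  exact congrArg (fun t => U.v01 (V.v00 x y) z + t) h

end Bilin

section associator

variable {C D E : QPM.{u}}

variable (C D E) in
/-- The morphism `x ⊚̲ (y ⊚̲ z) ↦ (x ⊚̲ y) ⊚̲ z`. -/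
def assocInv : C.tensor (D.tensor E) ⟶ (C.tensor D).tensor E :=
  ((Bilin.univ C D).assoc (Bilin.univ (C.tensor D) E)).desc

@[simp] theorem assocInv_u000 (x : C.C0) (y : D.C0) (z : E.C0) :
    (assocInv C D E).f0 (u00 C _ x (u00 D E y z)) = u00 _ E (u00 C D x y) z :=
  (Bilin.desc_u00 _ _ _).trans (Bilin.assoc00_u00 _ _ x y z)
@[simp] theorem assocInv_u100 (x : C.C1) (y : D.C0) (z : E.C0) :
    (assocInv C D E).f1 (u10 C _ x (u00 D E y z)) = u10 _ E (u10 C D x y) z :=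
  (Bilin.desc_u10 _ _ _).trans (Bilin.assoc10_u00 _ _ x y z)
@[simp] theorem assocInv_u010 (x : C.C0) (y : D.C1) (z : E.C0) :
    (assocInv C D E).f1 (u01 C _ x (u10 D E y z)) = u10 _ E (u01 C D x y) z :=
  (Bilin.desc_u01 _ _ _).trans (Bilin.assoc01_u10 _ _ x y z)
@[simp] theorem assocInv_u001 (x : C.C0) (y : D.C0) (z : E.C1) :
    (assocInv C D E).f1 (u01 C _ x (u01 D E y z)) = u01 _ E (u00 C D x y) z :=
  (Bilin.desc_u01 _ _ _).trans (Bilin.assoc01_u01 _ _ x y z)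
@[simp] theorem assocInv_tee (a : C.Cee) (b : D.Cee) (c : E.Cee) :
    (assocInv C D E).fee (tee C _ a (tee D E b c)) = tee _ E (tee C D a b) c := rfl

@[simp] theorem assocInv_o000 (x : C.C0) (y : D.C0) (z : E.C0) :
    (assocInv C D E).f0 ((Bilin.univ C _).o00 x ((Bilin.univ D E).o00 y z)) =
      (Bilin.univ _ E).o00 ((Bilin.univ C D).o00 x y) z :=
  (Bilin.desc_o00 _ _ _).trans (Bilin.assoc_o00 _ _ x y z)
@[simp] theorem assocInv_o100 (x : C.C1) (y : D.C0) (z : E.C0) :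
    (assocInv C D E).f1 ((Bilin.univ C _).o10 x ((Bilin.univ D E).o00 y z)) =
      (Bilin.univ _ E).o10 ((Bilin.univ C D).o10 x y) z :=
  (Bilin.desc_o10 _ _ _).trans (Bilin.assoc_o100 _ _ x y z)
@[simp] theorem assocInv_o010 (x : C.C0) (y : D.C1) (z : E.C0) :
    (assocInv C D E).f1 ((Bilin.univ C _).o01 x ((Bilin.univ D E).o10 y z)) =
      (Bilin.univ _ E).o10 ((Bilin.univ C D).o01 x y) z :=
  (Bilin.desc_o01 _ _ _).trans (Bilin.assoc_o010 _ _ x y z)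
@[simp] theorem assocInv_o001 (x : C.C0) (y : D.C0) (z : E.C1) :
    (assocInv C D E).f1 ((Bilin.univ C _).o01 x ((Bilin.univ D E).o01 y z)) =
      (Bilin.univ _ E).o01 ((Bilin.univ C D).o00 x y) z :=
  (Bilin.desc_o01 _ _ _).trans (Bilin.assoc_o001 _ _ x y z)

/-- Morphisms out of `C ⊙ (D ⊙ E)` are determined by their values on the elements
`x ⊚̲ (y ⊚̲ z)` and `a ⊗ (b ⊗ c)`. -/
theorem tensor₃_hom_ext {F : QPM.{u}} {f g : C.tensor (D.tensor E) ⟶ F}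
    (h000 : ∀ x y z, f.f0 (u00 C _ x (u00 D E y z)) = g.f0 (u00 C _ x (u00 D E y z)))
    (h100 : ∀ x y z, f.f1 (u10 C _ x (u00 D E y z)) = g.f1 (u10 C _ x (u00 D E y z)))
    (h010 : ∀ x y z, f.f1 (u01 C _ x (u10 D E y z)) = g.f1 (u01 C _ x (u10 D E y z)))
    (h001 : ∀ x y z, f.f1 (u01 C _ x (u01 D E y z)) = g.f1 (u01 C _ x (u01 D E y z)))
    (hee : ∀ a b c, f.fee (tee C _ a (tee D E b c)) = g.fee (tee C _ a (tee D E b c))) :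
    f = g := by
  have he : ∀ a t, f.fee (tee C _ a t) = g.fee (tee C _ a t) := fun a t =>
    DFunLike.congr_fun (tensoree_hom_ext (f := f.fee.comp (teeHom C _ a))
      (g := g.fee.comp (teeHom C _ a)) (hee a)) t
  refine tensor_hom_ext (fun x q => ?_) (fun x q => ?_) (fun x q => ?_) he
  · refine DFunLike.congr_fun (tensor0_hom_ext (f := f.f0.comp ((Bilin.univ C _).v00Hom x))
      (g := g.f0.comp ((Bilin.univ C _).v00Hom x)) (h000 x) fun b c => ?_) q
    simp only [AddMonoidHom.comp_apply, Bilin.v00Hom_apply, Bilin.v00_dP]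
    rw [f.map_d, g.map_d, f.map_P, g.map_P]
    exact congrArg (fun t => F.d (F.P t)) (he _ _)
  · refine DFunLike.congr_fun (tensor0_hom_ext (f := f.f1.comp ((Bilin.univ C _).v10Hom x))
      (g := g.f1.comp ((Bilin.univ C _).v10Hom x)) (h100 x) fun b c => ?_) q
    simp only [AddMonoidHom.comp_apply, Bilin.v10Hom_apply, Bilin.v10_dP]
    rw [f.map_P, g.map_P]
    exact congrArg F.P (he _ _)
  · refine DFunLike.congr_fun (tensor1_hom_ext (f := f.f1.comp ((Bilin.univ C _).v01Hom x))
      (g := g.f1.comp ((Bilin.univ C _).v01Hom x)) (h010 x) (h001 x) fun b c => ?_) q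
    simp only [AddMonoidHom.comp_apply, Bilin.v01Hom_apply, Bilin.v01_P]
    rw [f.map_P, g.map_P]
    exact congrArg F.P (he _ _)

variable (C D E) in
/-- The isomorphism `(C ⊙ D) ⊙ E → E ⊙ (D ⊙ C)` which reverses the order of the factors. -/
def reverse : (C.tensor D).tensor E ≅ E.tensor (D.tensor C) where
  hom := braid _ _ ≫ tensorMap (𝟙 E) (braid C D)
  inv := tensorMap (𝟙 E) (braid D C) ≫ braid _ _
  hom_inv_id := by
    rw [Category.assoc, ← Category.assoc (tensorMap _ _), ← tensorMap_comp, braid_braid,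
      Category.comp_id, tensorMap_id, Category.id_comp, braid_braid]
  inv_hom_id := by
    rw [Category.assoc, ← Category.assoc (braid _ _), braid_braid, Category.id_comp,
      ← tensorMap_comp, braid_braid, Category.comp_id, tensorMap_id]

theorem assocInv_comp (C D E : QPM.{u}) :
    assocInv C D E ≫ (reverse C D E).hom ≫ assocInv E D C ≫ (reverse E D C).hom =
      𝟙 (C.tensor (D.tensor E)) := by
  apply tensor₃_hom_ext <;> intros <;> simp [reverse]

instance (C D E : QPM.{u}) : IsIso (assocInv C D E) := by
  have : IsSplitMono (assocInv C D E) := ⟨⟨_, assocInv_comp C D E⟩⟩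
  have : IsSplitEpi (assocInv C D E) := ⟨⟨(reverse C D E).hom ≫ assocInv E D C ≫
    (reverse E D C).hom, by
      rw [← cancel_mono (reverse C D E).hom, Category.assoc, Category.assoc, Category.assoc,
        assocInv_comp E D C, Category.comp_id, Category.id_comp]⟩⟩
  exact isIso_of_mono_of_isSplitEpi _

variable (C D E) in
/-- The associativity isomorphism. -/
noncomputable def assocIso : (C.tensor D).tensor E ≅ C.tensor (D.tensor E) :=
  (asIso (assocInv C D E)).symm

theorem assocIso_inv : (assocIso C D E).inv = assocInv C D E := rfl

theorem isAssociator_assocIso : IsAssociator C D E (assocIso C D E).hom where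
  map_000 x y z := by
    rw [← assocInv_u000, ← assocIso_inv, ← comp_f0, Iso.inv_hom_id, id_f0]
  map_100 x y z := by
    rw [← assocInv_u100, ← assocIso_inv, ← comp_f1, Iso.inv_hom_id, id_f1]
  map_010 x y z := by
    rw [← assocInv_u010, ← assocIso_inv, ← comp_f1, Iso.inv_hom_id, id_f1]
  map_001 x y z := by
    rw [← assocInv_u001, ← assocIso_inv, ← comp_f1, Iso.inv_hom_id, id_f1]
  map_ee a b c := by
    rw [← assocInv_tee, ← assocIso_inv, ← comp_fee, Iso.inv_hom_id, id_fee]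

end associator

end QPM

end

section

open scoped TensorProduct

namespace QPM

open SquareGroup

/-! ### The unit -/

namespace Zbar

/-- The elements of degree `0` of the unit as integers. -/
def toInt0 : Zbar.{u}.C0 →+ ℤ := (AddEquiv.ulift : ULift.{u} ℤ ≃+ ℤ).toAddMonoidHom
/-- The elements of degree `ee` of the unit as integers. -/
def toIntee : Zbar.{u}.Cee →+ ℤ := (AddEquiv.ulift : ULift.{u} ℤ ≃+ ℤ).toAddMonoidHom

theorem H_int0 (n : Zbar.{u}.C0) : toIntee.{u} (Zbar.H n) = toInt0 n * (toInt0 n - 1) / 2 := rfl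

theorem dP (a : Zbar.{u}.Cee) : Zbar.{u}.d (Zbar.P a) = 0 :=
  (phiD_phiP (fromZero Znil.{u}) a).trans rfl

theorem exists_P (w : Zbar.{u}.C1) : ∃ a, w = Zbar.P a := by
  obtain ⟨⟨x, a⟩, rfl⟩ := phiMk_surjective (fromZero Znil.{u}) w
  exact ⟨a, rfl⟩

theorem T_eq (a : Zbar.{u}.Cee) : Zbar.{u}.T a = -a := by
  have h := Zbar.{u}.H_dP a
  rw [dP, H_zero] at h
  exact (neg_eq_of_add_eq_zero_right h.symm).symm

theorem choose_add (m n : ℤ) :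
    (m + n) * (m + n - 1) / 2 = m * (m - 1) / 2 + n * (n - 1) / 2 + m * n := by
  have h : (m + n) * (m + n - 1) = m * (m - 1) + n * (n - 1) + 2 * (m * n) := by ring
  obtain ⟨k, hk⟩ := Int.even_mul_pred_self m
  obtain ⟨l, hl⟩ := Int.even_mul_pred_self n
  rw [h, hk, hl]
  omega

theorem toIntee_cr (m n : Zbar.{u}.C0) : toIntee.{u} (Zbar.cr m n) = toInt0 m * toInt0 n := by
  have h := congrArg toIntee.{u} (Zbar.H_add m n)
  rw [map_add, map_add, H_int0, H_int0, H_int0, map_add, choose_add] at h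
  linarith

theorem toIntee_Δ (n : Zbar.{u}.C0) : toIntee.{u} (Zbar.Δ n) = toInt0 n := by
  rw [Δ_apply, T_eq, map_add, map_sub, map_neg, toIntee_cr, H_int0]
  obtain ⟨k, hk⟩ := Int.even_mul_pred_self (toInt0 n)
  rw [hk, ← two_mul, Int.mul_ediv_cancel_left _ two_ne_zero]
  linarith

end Zbar

section

variable (C : QPM.{u})

theorem P_cr_d (x : C.C1) : C.P (C.cr (C.d x) (C.d x)) = 0 := by
  have h := C.add_comm1 x x
  rwa [left_eq_add] at h

theorem dP_cr (x : C.C0) : C.d (C.P (C.cr x x)) = 0 := by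
  have h := C.add_comm0 x x
  rwa [left_eq_add] at h

theorem P_cr_add_P_cr (x y : C.C0) : C.P (C.cr x y) + C.P (C.cr y x) = 0 := by
  rw [← C.P_T (C.cr x y), T_cr, map_neg, neg_add_cancel]

theorem cr_zsmul_left (n : ℤ) (x y : C.C0) : C.cr (n • x) y = n • C.cr x y :=
  map_zsmul (C.cr.flip y) n x

theorem H_zsmul (n : ℤ) (x : C.C0) : C.H (n • x) = (n * (n - 1) / 2) • C.cr x x + n • C.H x := by
  have h (n : ℤ) : (n + 1) * (n + 1 - 1) / 2 = n * (n - 1) / 2 + n := by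
    rw [Zbar.choose_add]; simp
  have step (n : ℤ) : C.H ((n + 1) • x) - (((n + 1) * (n + 1 - 1) / 2) • C.cr x x + (n + 1) • C.H x)
      = C.H (n • x) - ((n * (n - 1) / 2) • C.cr x x + n • C.H x) := by
    rw [h, add_zsmul, one_zsmul, H_add, cr_zsmul_left,
      add_zsmul, add_zsmul, one_zsmul]
    abel
  rw [← sub_eq_zero]
  induction n using Int.induction_on with
  | zero => simp
  | succ n ih => rw [step, ih]
  | pred n ih =>
    rw [← step]
    simpa using ih

theorem zsmul_add1 (n : ℤ) (x y : C.C1) : n • (x + y) =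
    n • x + n • y + C.P ((n * (n - 1) / 2) • C.cr (C.d y) (C.d x)) :=
  DFunLike.congr_fun (AddMonoidHom.ext_int (f := zmultiplesHom C.C1 (x + y))
    (g := addHom C.P C.P_comm (zmultiplesHom C.C1 x) (zmultiplesHom C.C1 y)
      (fun n => (n * (n - 1) / 2) • C.cr (C.d y) (C.d x))
      (fun m n => (m * n) • C.cr (C.d y) (C.d x))
      (fun m n => by rw [Zbar.choose_add, add_zsmul, add_zsmul])
      (fun m n => by
        rw [add_comm1]
        simp [mul_zsmul])) (by simp)) n

theorem zsmul_add0 (n : ℤ) (x y : C.C0) : n • (x + y) =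
    n • x + n • y + C.d (C.P ((n * (n - 1) / 2) • C.cr y x)) :=
  DFunLike.congr_fun (AddMonoidHom.ext_int (f := zmultiplesHom C.C0 (x + y))
    (g := addHom (C.d.comp C.P) (Bilin.dP_central C) (zmultiplesHom C.C0 x) (zmultiplesHom C.C0 y)
      (fun n => (n * (n - 1) / 2) • C.cr y x)
      (fun m n => (m * n) • C.cr y x)
      (fun m n => by rw [Zbar.choose_add, add_zsmul, add_zsmul])
      (fun m n => by
        rw [add_comm0]
        simp [mul_zsmul])) (by simp)) n

/-- The biadditive map `a ⊗ n ↦ n a`. -/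
def unitP : C.Cee →+ Zbar.{u}.Cee →+ C.Cee :=
  AddMonoidHom.mk' (fun a => (zmultiplesHom C.Cee a).comp Zbar.toIntee)
    fun a a' => AddMonoidHom.ext fun n => by simp

@[simp] theorem unitP_apply (a : C.Cee) (n : Zbar.{u}.Cee) :
    C.unitP a n = Zbar.toIntee n • a := rfl

/-- The homomorphism from the degree `1` part of the unit to `C_1` given by `P(n) ↦ P(n(x|x))`. -/
def unit01 (x : C.C0) : Zbar.{u}.C1 →+ C.C1 :=
  phiLift (fromZero Znil) 0 (C.P.comp (C.unitP (C.cr x x))) (fun c y => C.P_comm _ _)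
    (fun _ => map_zero _) (fun c => by
      have h : C.P (C.cr x x) + C.P (C.cr x x) = 0 := C.P_cr_add_P_cr x x
      have h2 : ∀ k : Zbar.{u}.Cee, C.P (C.unitP (C.cr x x) k) =
        Zbar.toIntee k • C.P (C.cr x x) := fun k => map_zsmul _ _ _
      refine (map_zero (C.P.comp (C.unitP (C.cr x x)))).trans ?_
      change 0 = C.P (C.unitP (C.cr x x) c) + C.P (C.unitP (C.cr x x) c)
      refine Eq.trans ?_ (congrArg₂ (· + ·) (h2 c) (h2 c)).symm
      have h3 := AddCommute.refl (C.P (C.cr x x))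
      change 0 = Zbar.toIntee c • C.P (C.cr x x) + Zbar.toIntee c • C.P (C.cr x x)
      rw [← h3.zsmul_add, h, zsmul_zero])

@[simp] theorem unit01_P (x : C.C0) (a : Zbar.{u}.Cee) :
    C.unit01 x (Zbar.P a) = C.P (Zbar.toIntee a • C.cr x x) :=
  (phiLift_mk (fromZero Znil) _ _ _ _ _ (0, a)).trans (zero_add _)

/-- The bilinear map `(x, n) ↦ n x`. -/
def unitBilin : Bilin C Zbar.{u} C where
  v00 x n := Zbar.toInt0 n • x
  v10 x n := Zbar.toInt0 n • x
  v01 x := C.unit01 x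
  p := C.unitP
  v00_add x n n' := by rw [map_add, add_zsmul]
  v10_add x n n' := by rw [map_add, add_zsmul]
  v01_add x := map_add _
  add_v00 x x' n := by rw [zsmul_add0, unitP_apply, Zbar.H_int0]
  add_v10 x x' n := by rw [zsmul_add1, unitP_apply, Zbar.H_int0]
  add_v01 x x' w := by
    obtain ⟨k, rfl⟩ := Zbar.exists_P w
    rw [unit01_P, unit01_P, unit01_P, Zbar.dP, H_zero, map_zero, map_zero, add_zero, ← map_add,
      P_eq_P]
    have h := P_cr_add_P_cr C x x'
    rw [← map_add, ← map_zero C.P, P_eq_P, map_add, map_zero] at h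
    simp only [map_add, AddMonoidHom.add_apply, map_zsmul, smul_add]
    have h' := congrArg (Zbar.toIntee k • ·) h
    simp only [smul_add, smul_zero] at h'
    rw [← sub_eq_zero, ← h']
    abel
  d_v10 x n := map_zsmul _ _ _
  d_v01 x w := by
    obtain ⟨k, rfl⟩ := Zbar.exists_P w
    rw [unit01_P, Zbar.dP, map_zsmul, map_zsmul, dP_cr, smul_zero, map_zero, zero_zsmul]
  v10_d x w := by
    obtain ⟨k, rfl⟩ := Zbar.exists_P w
    rw [unit01_P, Zbar.dP, map_zsmul, P_cr_d, smul_zero, map_zero, zero_zsmul]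
  P_v10 a n := by rw [unitP_apply, Zbar.toIntee_Δ, map_zsmul]
  v01_P x a := C.unit01_P x a
  T_p a n := by rw [unitP_apply, unitP_apply, Zbar.T_eq, map_neg, neg_zsmul, neg_neg, map_zsmul]
  cr_v00 x x' n n' := by
    rw [unitP_apply, Zbar.toIntee_cr, cr_zsmul_left, map_zsmul, ← mul_zsmul]
  H_v00 x n := by rw [H_zsmul, unitP_apply, unitP_apply, Zbar.H_int0, Zbar.toIntee_Δ]

/-- The inverse of the right unit isomorphism. -/
def rightUnitInv : C ⟶ C.tensor Zbar.{u} where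
  f0 := AddMonoidHom.mk' (fun x => u00 C Zbar x (Zbar.int0 1)) fun x x' => by
    refine ((Bilin.univ C Zbar).add_v00 x x' _).trans ?_
    have h : Zbar.{u}.H (Zbar.int0 1) = 0 := rfl
    rw [h, map_zero, map_zero, map_zero, add_zero]
    rfl
  f1 := AddMonoidHom.mk' (fun x => u10 C Zbar x (Zbar.int0 1)) fun x x' => by
    refine ((Bilin.univ C Zbar).add_v10 x x' _).trans ?_
    have h : Zbar.{u}.H (Zbar.int0 1) = 0 := rfl
    rw [h, map_zero, map_zero, add_zero]
    rfl
  fee := (teeHom C Zbar).flip (Zbar.intee 1)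
  map_P a := (Bilin.univ C Zbar).P_v10 a _
  map_d x := ((Bilin.univ C Zbar).d_v10 x _).symm
  map_H x := by
    have h : Zbar.{u}.H (Zbar.int0 1) = 0 := rfl
    refine Eq.trans ?_ ((Bilin.univ C Zbar).H_v00 x (Zbar.int0 1)).symm
    rw [h, map_zero, zero_add]
    rfl

@[simp] theorem rightUnitInv_f0 (x : C.C0) :
    C.rightUnitInv.f0 x = u00 C Zbar x (Zbar.int0 1) := rfl
@[simp] theorem rightUnitInv_f1 (x : C.C1) :
    C.rightUnitInv.f1 x = u10 C Zbar x (Zbar.int0 1) := rfl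
@[simp] theorem rightUnitInv_fee (a : C.Cee) :
    C.rightUnitInv.fee a = tee C Zbar a (Zbar.intee 1) := rfl

/-- The right unit isomorphism. -/
def rightUnit : C.tensor Zbar.{u} ≅ C where
  hom := C.unitBilin.desc
  inv := C.rightUnitInv
  hom_inv_id := by
    have h0 (n : Zbar.{u}.C0) : n = Zbar.toInt0 n • Zbar.int0 1 :=
      ULift.ext _ _ (mul_one (Zbar.toInt0 n)).symm
    have hee (n : Zbar.{u}.Cee) : n = Zbar.toIntee n • Zbar.intee 1 :=
      ULift.ext _ _ (mul_one (Zbar.toIntee n)).symm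
    have he (a : C.Cee) (n : Zbar.{u}.Cee) :
        C.rightUnitInv.fee (C.unitP a n) = teeHom C Zbar a n := by
      rw [unitP_apply, map_zsmul]
      conv_rhs => rw [hee n, map_zsmul]
      rfl
    refine tensor_hom_ext (fun x n => ?_) (fun x n => ?_) (fun x w => ?_) (fun a n => ?_)
    · rw [comp_f0, Bilin.desc_u00, id_f0]
      refine (map_zsmul C.rightUnitInv.f0 _ _).trans ?_
      refine (map_zsmul ((Bilin.univ C Zbar).v00Hom x) (Zbar.toInt0 n) (Zbar.int0 1)).symm.trans ?_
      rw [← h0]; rfl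
    · rw [comp_f1, Bilin.desc_u10, id_f1]
      refine (map_zsmul C.rightUnitInv.f1 _ _).trans ?_
      refine (map_zsmul ((Bilin.univ C Zbar).v10Hom x) (Zbar.toInt0 n) (Zbar.int0 1)).symm.trans ?_
      rw [← h0]; rfl
    · obtain ⟨k, rfl⟩ := Zbar.exists_P w
      rw [comp_f1, Bilin.desc_u01, id_f1]
      refine Eq.trans ?_ ((Bilin.univ C Zbar).v01_P x k).symm
      refine (congrArg C.rightUnitInv.f1 (C.unit01_P x k)).trans ?_
      rw [C.rightUnitInv.map_P]
      exact congrArg _ (he _ _)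
    · exact he a n
  inv_hom_id := by
    refine hom_ext (fun x => ?_) (fun x => ?_) (fun a => ?_)
    · exact (C.unitBilin.desc_u00 x (Zbar.int0 1)).trans (one_zsmul x)
    · exact (C.unitBilin.desc_u10 x (Zbar.int0 1)).trans (one_zsmul x)
    · exact (C.unitBilin.desc_tee a (Zbar.intee 1)).trans (one_zsmul a)

theorem isRightUnitor_rightUnit : IsRightUnitor C C.rightUnit.hom where
  map_0 x n := C.unitBilin.desc_u00 x (Zbar.int0 n)
  map_1 x n := C.unitBilin.desc_u10 x (Zbar.int0 n)
  map_ee a n := C.unitBilin.desc_tee a (Zbar.intee n)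

/-- The left unit isomorphism. -/
def leftUnit : Zbar.{u}.tensor C ≅ C := braidIso Zbar C ≪≫ C.rightUnit

theorem isLeftUnitor_leftUnit : IsLeftUnitor C C.leftUnit.hom where
  map_0 n x := by
    rw [← univ_o00]
    exact (congrArg C.rightUnit.hom.f0 (braid_o00 (Zbar.int0 n) x)).trans
      (C.isRightUnitor_rightUnit.map_0 x n)
  map_1 n x := by
    rw [← univ_o01]
    exact (congrArg C.rightUnit.hom.f1 (braid_o01 (Zbar.int0 n) x)).trans
      (C.isRightUnitor_rightUnit.map_1 x n)
  map_ee n a := C.isRightUnitor_rightUnit.map_ee a n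

@[simp] theorem leftUnit_inv_f0 (x : C.C0) :
    C.leftUnit.inv.f0 x = u00 Zbar C (Zbar.int0 1) x := by
  have h : Zbar.{u}.H (Zbar.int0 1) = 0 := rfl
  refine (braid_u00 x (Zbar.int0 1)).trans ?_
  rw [Bilin.o00_eq, h]
  simp; rfl

@[simp] theorem leftUnit_inv_f1 (x : C.C1) :
    C.leftUnit.inv.f1 x = u01 Zbar C (Zbar.int0 1) x := by
  have h : Zbar.{u}.H (Zbar.int0 1) = 0 := rfl
  refine (braid_u10 x (Zbar.int0 1)).trans ?_
  rw [Bilin.o01_eq, h]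
  simp; rfl

@[simp] theorem leftUnit_inv_fee (a : C.Cee) :
    C.leftUnit.inv.fee a = tee Zbar C (Zbar.intee 1) a := rfl

end

/-! ### The monoidal category of quadratic pair modules -/

section monoidal

theorem tensor₄_hom_ext {B C D E F : QPM.{u}} {f g : B.tensor (C.tensor (D.tensor E)) ⟶ F}
    (h0000 : ∀ w x y z, f.f0 (u00 B _ w (u00 C _ x (u00 D E y z))) =
      g.f0 (u00 B _ w (u00 C _ x (u00 D E y z))))
    (h1000 : ∀ w x y z, f.f1 (u10 B _ w (u00 C _ x (u00 D E y z))) =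
      g.f1 (u10 B _ w (u00 C _ x (u00 D E y z))))
    (h0100 : ∀ w x y z, f.f1 (u01 B _ w (u10 C _ x (u00 D E y z))) =
      g.f1 (u01 B _ w (u10 C _ x (u00 D E y z))))
    (h0010 : ∀ w x y z, f.f1 (u01 B _ w (u01 C _ x (u10 D E y z))) =
      g.f1 (u01 B _ w (u01 C _ x (u10 D E y z))))
    (h0001 : ∀ w x y z, f.f1 (u01 B _ w (u01 C _ x (u01 D E y z))) =
      g.f1 (u01 B _ w (u01 C _ x (u01 D E y z))))
    (hee : ∀ a b c d, f.fee (tee B _ a (tee C _ b (tee D E c d))) =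
      g.fee (tee B _ a (tee C _ b (tee D E c d)))) : f = g := by
  have he : ∀ a b t, f.fee (tee B _ a (tee C _ b t)) = g.fee (tee B _ a (tee C _ b t)) :=
    fun a b t => DFunLike.congr_fun (tensoree_hom_ext
      (f := f.fee.comp ((teeHom B _ a).comp (teeHom C _ b)))
      (g := g.fee.comp ((teeHom B _ a).comp (teeHom C _ b))) (hee a b)) t
  refine tensor₃_hom_ext (fun w x q => ?_) (fun w x q => ?_) (fun w x q => ?_) (fun w x q => ?_) he
  · refine DFunLike.congr_fun (tensor0_hom_ext
      (f := f.f0.comp (((Bilin.univ B _).v00Hom w).comp ((Bilin.univ C _).v00Hom x)))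
      (g := g.f0.comp (((Bilin.univ B _).v00Hom w).comp ((Bilin.univ C _).v00Hom x)))
      (h0000 w x) fun b c => ?_) q
    simp only [AddMonoidHom.comp_apply, Bilin.v00Hom_apply, Bilin.v00_dP]
    rw [f.map_d, g.map_d, f.map_P, g.map_P]
    exact congrArg (fun t => F.d (F.P t)) (he _ _ _)
  · refine DFunLike.congr_fun (tensor0_hom_ext
      (f := f.f1.comp (((Bilin.univ B _).v10Hom w).comp ((Bilin.univ C _).v00Hom x)))
      (g := g.f1.comp (((Bilin.univ B _).v10Hom w).comp ((Bilin.univ C _).v00Hom x)))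
      (h1000 w x) fun b c => ?_) q
    simp only [AddMonoidHom.comp_apply, Bilin.v10Hom_apply, Bilin.v00Hom_apply, Bilin.v00_dP,
      Bilin.v10_dP]
    rw [f.map_P, g.map_P]
    exact congrArg F.P (he _ _ _)
  · refine DFunLike.congr_fun (tensor0_hom_ext
      (f := f.f1.comp (((Bilin.univ B _).v01Hom w).comp ((Bilin.univ C _).v10Hom x)))
      (g := g.f1.comp (((Bilin.univ B _).v01Hom w).comp ((Bilin.univ C _).v10Hom x)))
      (h0100 w x) fun b c => ?_) q
    simp only [AddMonoidHom.comp_apply, Bilin.v10Hom_apply, Bilin.v01Hom_apply, Bilin.v01_P,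
      Bilin.v10_dP]
    rw [f.map_P, g.map_P]
    exact congrArg F.P (he _ _ _)
  · refine DFunLike.congr_fun (tensor1_hom_ext
      (f := f.f1.comp (((Bilin.univ B _).v01Hom w).comp ((Bilin.univ C _).v01Hom x)))
      (g := g.f1.comp (((Bilin.univ B _).v01Hom w).comp ((Bilin.univ C _).v01Hom x)))
      (h0010 w x) (h0001 w x) fun b c => ?_) q
    simp only [AddMonoidHom.comp_apply, Bilin.v01Hom_apply, Bilin.v01_P]
    rw [f.map_P, g.map_P]
    exact congrArg F.P (he _ _ _)

theorem assocInv_naturality {C D E C' D' E' : QPM.{u}} (f : C ⟶ C') (g : D ⟶ D') (h : E ⟶ E') :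
    tensorMap f (tensorMap g h) ≫ assocInv C' D' E' =
      assocInv C D E ≫ tensorMap (tensorMap f g) h := by
  apply tensor₃_hom_ext <;> intros <;> simp

theorem assocInv_pentagon (B C D E : QPM.{u}) :
    tensorMap (𝟙 B) (assocInv C D E) ≫ assocInv B (C.tensor D) E ≫
        tensorMap (assocInv B C D) (𝟙 E) =
      assocInv B C (D.tensor E) ≫ assocInv (B.tensor C) D E := by
  apply tensor₄_hom_ext <;> intros <;> simp

theorem assocInv_triangle (C D : QPM.{u}) :
    tensorMap (𝟙 C) D.leftUnit.inv ≫ assocInv C Zbar D = tensorMap C.rightUnit.inv (𝟙 D) := by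
  apply tensor_hom_ext <;> intros <;> simp [rightUnit]

theorem braid_naturality {C D C' D' : QPM.{u}} (f : C ⟶ C') (g : D ⟶ D') :
    tensorMap f g ≫ braid C' D' = braid C D ≫ tensorMap g f := by
  apply tensor_hom_ext <;> intros <;> simp

theorem rightUnitInv_naturality {C D : QPM.{u}} (f : C ⟶ D) :
    f ≫ D.rightUnit.inv = C.rightUnit.inv ≫ tensorMap f (𝟙 Zbar) := by
  apply hom_ext <;> intros <;> simp [rightUnit]

theorem leftUnitInv_naturality {C D : QPM.{u}} (f : C ⟶ D) :
    f ≫ D.leftUnit.inv = C.leftUnit.inv ≫ tensorMap (𝟙 Zbar) f := by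
  apply hom_ext <;> intros <;> simp

/-- The isomorphism `f ⊙ g` for isomorphisms `f` and `g`. -/
def tensorIso {C D C' D' : QPM.{u}} (f : C ≅ C') (g : D ≅ D') :
    C.tensor D ≅ C'.tensor D' where
  hom := tensorMap f.hom g.hom
  inv := tensorMap f.inv g.inv
  hom_inv_id := by rw [← tensorMap_comp, f.hom_inv_id, g.hom_inv_id, tensorMap_id]
  inv_hom_id := by rw [← tensorMap_comp, f.inv_hom_id, g.inv_hom_id, tensorMap_id]

noncomputable instance : MonoidalCategory QPM.{u} where
  tensorObj C D := C.tensor D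
  tensorHom f g := tensorMap f g
  whiskerLeft C _ _ g := tensorMap (𝟙 C) g
  whiskerRight f D := tensorMap f (𝟙 D)
  tensorUnit := Zbar
  associator C D E := assocIso C D E
  leftUnitor C := C.leftUnit
  rightUnitor C := C.rightUnit
  tensorHom_def f g := by rw [← tensorMap_comp, Category.comp_id, Category.id_comp]
  id_tensorHom_id _ _ := tensorMap_id
  tensorHom_comp_tensorHom _ _ _ _ := (tensorMap_comp _ _ _ _).symm
  whiskerLeft_id _ _ := tensorMap_id
  id_whiskerRight _ _ := tensorMap_id
  associator_naturality f g h := by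
    rw [← cancel_epi (assocIso _ _ _).inv, ← cancel_mono (assocIso _ _ _).inv]
    simp only [Category.assoc, Iso.hom_inv_id, Category.comp_id, Iso.inv_hom_id_assoc]
    exact (assocInv_naturality f g h).symm
  leftUnitor_naturality f := by
    rw [← cancel_epi (leftUnit _).inv, ← cancel_mono (leftUnit _).inv]
    simp [leftUnitInv_naturality]
  rightUnitor_naturality f := by
    rw [← cancel_epi (rightUnit _).inv, ← cancel_mono (rightUnit _).inv]
    simp [rightUnitInv_naturality]
  pentagon B C D E := congrArg Iso.hom (Iso.ext_inv (α :=
      tensorIso (assocIso B C D) (Iso.refl E) ≪≫ assocIso B (C.tensor D) E ≪≫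
        tensorIso (Iso.refl B) (assocIso C D E))
      (β := assocIso (B.tensor C) D E ≪≫ assocIso B C (D.tensor E))
      (by
        simp only [Iso.trans_inv, Category.assoc]
        exact assocInv_pentagon B C D E))
  triangle C D := congrArg Iso.hom (Iso.ext_inv
      (α := assocIso C Zbar D ≪≫ tensorIso (Iso.refl C) D.leftUnit)
      (β := tensorIso C.rightUnit (Iso.refl D)) (assocInv_triangle C D))

end monoidal

end QPM

end

section

open scoped TensorProduct

namespace QPM

open SquareGroup

/-! ### The cokernel of `∂P` -/

section coker

variable (C : QPM.{u})

/-- The cokernel of `∂P`. -/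
abbrev Coker : Type u := C.sq0.cokerP

/-- The projection `C_0 → Coker ∂P`. -/
def toCoker : C.C0 →+ C.Coker := C.sq0.toCokerP

@[simp] theorem toCoker_dP (a : C.Cee) : C.toCoker (C.d (C.P a)) = 0 := C.sq0.toCokerP_P a

theorem toCoker_surjective : Function.Surjective C.toCoker :=
  have := SquareGroup.normal_range C.sq0
  QuotientAddGroup.mk'_surjective C.sq0.P.range

/-- The homomorphism `Coker ∂P ⊗ Coker ∂P → C_ee` induced by the cross effect. -/
def crCoker : C.Coker ⊗[ℤ] C.Coker →ₗ[ℤ] C.Cee := C.sq0.crTensor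

@[simp] theorem crCoker_tmul (x y : C.C0) :
    C.crCoker (C.toCoker x ⊗ₜ C.toCoker y) = C.cr x y := rfl

theorem tmul_hom_ext {X Y : Type u} {A : Type*} [AddCommGroup X] [AddCommGroup Y] [AddCommGroup A]
    {f g : X ⊗[ℤ] Y →+ A} (h : ∀ x y, f (x ⊗ₜ y) = g (x ⊗ₜ y)) : f = g := by
  ext t
  induction t using TensorProduct.induction_on with
  | zero => rw [map_zero, map_zero]
  | tmul a b => exact h a b
  | add s t hs ht => rw [map_add, map_add, hs, ht]

theorem coker_tmul_hom_ext {A : Type*} [AddCommGroup A] {f g : C.Coker ⊗[ℤ] C.Coker →+ A}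
    (h : ∀ x y, f (C.toCoker x ⊗ₜ C.toCoker y) = g (C.toCoker x ⊗ₜ C.toCoker y)) : f = g := by
  refine tmul_hom_ext fun x y => ?_
  obtain ⟨x, rfl⟩ := C.toCoker_surjective x
  obtain ⟨y, rfl⟩ := C.toCoker_surjective y
  exact h x y

/-- The involution `a ⊗ b ↦ -b ⊗ a` of `Coker ∂P ⊗ Coker ∂P`. -/
def cokerT : C.Coker ⊗[ℤ] C.Coker →+ C.Coker ⊗[ℤ] C.Coker :=
  -(TensorProduct.comm ℤ C.Coker C.Coker).toLinearMap.toAddMonoidHom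

@[simp] theorem cokerT_tmul (a b : C.Coker) : C.cokerT (a ⊗ₜ b) = -(b ⊗ₜ[ℤ] a) := rfl

@[simp] theorem cokerT_cokerT (t : C.Coker ⊗[ℤ] C.Coker) : C.cokerT (C.cokerT t) = t :=
  DFunLike.congr_fun (tmul_hom_ext (f := C.cokerT.comp C.cokerT) (g := AddMonoidHom.id _)
    fun a b => by simp) t

theorem crCoker_cokerT (t : C.Coker ⊗[ℤ] C.Coker) :
    C.crCoker (C.cokerT t) = C.T (C.crCoker t) :=
  DFunLike.congr_fun (C.coker_tmul_hom_ext (f := C.crCoker.toAddMonoidHom.comp C.cokerT)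
    (g := C.T.comp C.crCoker.toAddMonoidHom) fun a b => by simp) t

variable {C} {D : QPM.{u}}

/-- A homomorphism on `Coker ∂P`. -/
def cokerDesc {A : Type*} [AddGroup A] (f : C.C0 →+ A) (h : ∀ a, f (C.d (C.P a)) = 0) :
    C.Coker →+ A :=
  QuotientAddGroup.lift _ f (by rintro _ ⟨a, rfl⟩; exact h a)

@[simp] theorem cokerDesc_toCoker {A : Type*} [AddGroup A] (f : C.C0 →+ A) (h) (x : C.C0) :
    cokerDesc f h (C.toCoker x) = f x := rfl

/-- The homomorphism of cokernels induced by a morphism. -/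
def cokerMap (f : C ⟶ D) : C.Coker →+ D.Coker :=
  cokerDesc (D.toCoker.comp f.f0) fun a => by simp [f.map_d, f.map_P]

@[simp] theorem cokerMap_toCoker (f : C ⟶ D) (x : C.C0) :
    cokerMap f (C.toCoker x) = D.toCoker (f.f0 x) := rfl

/-- The tensor square of the homomorphism of cokernels induced by a morphism. -/
def cokerMap₂ (f : C ⟶ D) : C.Coker ⊗[ℤ] C.Coker →+ D.Coker ⊗[ℤ] D.Coker :=
  (TensorProduct.map (cokerMap f).toIntLinearMap (cokerMap f).toIntLinearMap).toAddMonoidHom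

@[simp] theorem cokerMap₂_tmul (f : C ⟶ D) (a b : C.Coker) :
    cokerMap₂ f (a ⊗ₜ b) = cokerMap f a ⊗ₜ cokerMap f b := rfl

theorem cokerMap₂_cokerT (f : C ⟶ D) (t : C.Coker ⊗[ℤ] C.Coker) :
    cokerMap₂ f (C.cokerT t) = D.cokerT (cokerMap₂ f t) :=
  DFunLike.congr_fun (tmul_hom_ext (f := (cokerMap₂ f).comp C.cokerT)
    (g := D.cokerT.comp (cokerMap₂ f)) fun a b => by simp) t

theorem crCoker_cokerMap₂ (f : C ⟶ D) (t : C.Coker ⊗[ℤ] C.Coker) :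
    D.crCoker (cokerMap₂ f t) = f.fee (C.crCoker t) :=
  DFunLike.congr_fun (C.coker_tmul_hom_ext (f := D.crCoker.toAddMonoidHom.comp (cokerMap₂ f))
    (g := f.fee.comp C.crCoker.toAddMonoidHom) fun a b => by simp [map_cr]) t

/-- The inverse of `Coker ∂P ⊗ Coker ∂P → C_ee` for a `0`-good quadratic pair module. -/
noncomputable def crCokerEquiv (h : C.isZeroGood) : C.Coker ⊗[ℤ] C.Coker ≃ₗ[ℤ] C.Cee :=
  LinearEquiv.ofBijective C.crCoker h

@[simp] theorem crCokerEquiv_apply (h : C.isZeroGood) (t : C.Coker ⊗[ℤ] C.Coker) :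
    crCokerEquiv h t = C.crCoker t := rfl

theorem crCokerEquiv_symm_cr (h : C.isZeroGood) (x y : C.C0) :
    (crCokerEquiv h).symm (C.cr x y) = C.toCoker x ⊗ₜ C.toCoker y :=
  (crCokerEquiv h).symm_apply_eq.2 rfl

@[simp] theorem crCoker_crCokerEquiv_symm (h : C.isZeroGood) (a : C.Cee) :
    C.crCoker ((crCokerEquiv h).symm a) = a :=
  (crCokerEquiv h).apply_symm_apply a

theorem crCokerEquiv_symm_T (h : C.isZeroGood) (a : C.Cee) :
    (crCokerEquiv h).symm (C.T a) = C.cokerT ((crCokerEquiv h).symm a) := by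
  rw [LinearEquiv.symm_apply_eq, crCokerEquiv_apply, crCoker_cokerT, crCoker_crCokerEquiv_symm]

end coker

/-! ### Good quadratic pair modules -/

section good

variable (C : QPM.{u})

/-- The bilinear map `(x, y) ↦ [x] ⊗ [y]`. -/
def cokerForm : C.C0 →+ C.C0 →+ C.Coker ⊗[ℤ] C.Coker :=
  AddMonoidHom.mk' (fun x => AddMonoidHom.mk' (fun y => C.toCoker x ⊗ₜ C.toCoker y)
    fun y y' => by rw [map_add, TensorProduct.tmul_add])
    fun x x' => AddMonoidHom.ext fun y => by simp [TensorProduct.add_tmul]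

@[simp] theorem cokerForm_apply (x y : C.C0) : C.cokerForm x y = C.toCoker x ⊗ₜ C.toCoker y := rfl

/-- The bilinear map `(x, y) ↦ [∂x] ⊗ [∂y]`. -/
def cokerForm1 : C.C1 →+ C.C1 →+ C.Coker ⊗[ℤ] C.Coker :=
  (C.cokerForm.compr₂ (AddMonoidHom.id _)).compl₂ C.d |>.comp C.d

@[simp] theorem cokerForm1_apply (x y : C.C1) :
    C.cokerForm1 x y = C.toCoker (C.d x) ⊗ₜ C.toCoker (C.d y) := rfl

/-- The elements of degree `0` of the coreflection. -/
def good0 : AddSubgroup (QuadExt C.cokerForm) where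
  carrier := {p | C.H p.fst = C.crCoker p.snd}
  zero_mem' := by simp
  add_mem' {p q} hp hq := by
    simp only [Set.mem_ofPred_eq] at hp hq ⊢
    simp [H_add, hp, hq]
  neg_mem' {p} hp := by
    simp only [Set.mem_ofPred_eq] at hp ⊢
    simp [H_neg, hp]

/-- The elements of degree `1` of the coreflection. -/
def good1 : AddSubgroup (QuadExt C.cokerForm1) where
  carrier := {p | C.H (C.d p.fst) = C.crCoker p.snd}
  zero_mem' := by simp
  add_mem' {p q} hp hq := by
    simp only [Set.mem_ofPred_eq] at hp hq ⊢
    simp [H_add, hp, hq]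
  neg_mem' {p} hp := by
    simp only [Set.mem_ofPred_eq] at hp ⊢
    simp [H_neg, hp]

/-- The quadratic pair module with `ee`-part `Coker ∂P ⊗ Coker ∂P` that maps to `C`. -/
def goodCover : QPM.{u} :=
  ofCr (G₀ := C.good0) (G₁ := C.good1) (A := C.Coker ⊗[ℤ] C.Coker)
    (AddMonoidHom.mk' (fun t => ⟨⟨C.P (C.crCoker t), t + C.cokerT t⟩, by
      change C.H _ = C.crCoker (t + C.cokerT t)
      rw [H_dP, map_add, crCoker_cokerT]⟩) fun s t => by
        apply Subtype.ext
        ext1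
        · simp
        · simp; abel)
    (AddMonoidHom.mk' (fun p => ⟨⟨C.d p.1.fst, p.1.snd⟩, p.2⟩) fun p q => by
      apply Subtype.ext
      ext1 <;> simp)
    (fun p => p.1.snd)
    (AddMonoidHom.mk' (fun p => AddMonoidHom.mk' (fun q => C.cokerForm p.1.fst q.1.fst)
      fun q q' => by simp [TensorProduct.tmul_add])
      fun p p' => AddMonoidHom.ext fun q => by simp)
    (fun p q => by simp)
    (fun a y => by simp)
    (fun x a => by simp)
    (fun p q => by
      apply Subtype.ext
      ext1
      · exact C.add_comm0 p.1.fst q.1.fst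
      · simp; abel)
    (fun p q => by
      apply Subtype.ext
      ext1
      · exact C.add_comm1 p.1.fst q.1.fst
      · simp; abel)
    (fun t => by
      apply Subtype.ext
      ext1
      · simp [crCoker_cokerT]
      · simp; abel)

/-- The projection onto `C`. -/
def goodCoverπ : C.goodCover ⟶ C where
  f0 := AddMonoidHom.mk' (fun p : C.good0 => p.1.fst) fun _ _ => rfl
  f1 := AddMonoidHom.mk' (fun p : C.good1 => p.1.fst) fun _ _ => rfl
  fee := C.crCoker.toAddMonoidHom
  map_P _ := rfl
  map_d _ := rfl
  map_H p := (show C.good0 from p).2.symm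

variable {C}

theorem isZeroGood_of_section (σ : C ⟶ C.goodCover) (h : σ ≫ C.goodCoverπ = 𝟙 C) :
    C.isZeroGood := by
  have h0 (x : C.C0) : C.goodCoverπ.f0 (σ.f0 x) = x :=
    DFunLike.congr_fun (congrArg Hom.f0 h) x
  have hee (a : C.Cee) : C.crCoker (σ.fee a) = a :=
    DFunLike.congr_fun (congrArg Hom.fee h) a
  have hσ : σ.fee.comp C.crCoker.toAddMonoidHom = AddMonoidHom.id (C.Coker ⊗[ℤ] C.Coker) := by
    refine C.coker_tmul_hom_ext fun x y => ?_
    refine (map_cr σ x y).trans ((ofCr_cr ..).trans ?_)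
    exact congrArg₂ (fun a b => C.toCoker a ⊗ₜ[ℤ] C.toCoker b) (h0 x) (h0 y)
  exact ⟨fun s t hst => by
    exact (DFunLike.congr_fun hσ s).symm.trans
      ((congrArg σ.fee hst).trans (DFunLike.congr_fun hσ t)), fun a => ⟨σ.fee a, hee a⟩⟩

/-- The lift of a morphism with `0`-good source. -/
noncomputable def goodLift {D : QPM.{u}} (hD : D.isZeroGood) (f : D ⟶ C) : D ⟶ C.goodCover where
  f0 := (AddMonoidHom.mk' (fun x => ⟨⟨f.f0 x, cokerMap₂ f ((crCokerEquiv hD).symm (D.H x))⟩, by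
      change C.H _ = C.crCoker _
      rw [crCoker_cokerMap₂, crCoker_crCokerEquiv_symm, f.map_H]⟩) fun x y => by
    apply Subtype.ext
    ext1
    · simp
    · simp [H_add, crCokerEquiv_symm_cr] : D.C0 →+ C.good0)
  f1 := (AddMonoidHom.mk' (fun x =>
      ⟨⟨f.f1 x, cokerMap₂ f ((crCokerEquiv hD).symm (D.H (D.d x)))⟩, by
      change C.H _ = C.crCoker _
      rw [crCoker_cokerMap₂, crCoker_crCokerEquiv_symm, f.map_H, f.map_d]⟩) fun x y => by
    apply Subtype.ext
    ext1
    · simp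
    · simp [H_add, crCokerEquiv_symm_cr, f.map_d] : D.C1 →+ C.good1)
  fee := (cokerMap₂ f).comp (crCokerEquiv hD).symm.toLinearMap.toAddMonoidHom
  map_P a := by
    apply Subtype.ext
    refine QuadExt.ext ?_ ?_
    · refine (f.map_P a).trans (congrArg C.P ?_)
      change _ = C.crCoker (cokerMap₂ f ((crCokerEquiv hD).symm a))
      rw [crCoker_cokerMap₂, crCoker_crCokerEquiv_symm]
    · change cokerMap₂ f ((crCokerEquiv hD).symm (D.H (D.d (D.P a)))) =
        cokerMap₂ f ((crCokerEquiv hD).symm a) + C.cokerT (cokerMap₂ f ((crCokerEquiv hD).symm a))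
      rw [H_dP, map_add, map_add, crCokerEquiv_symm_T, cokerMap₂_cokerT]
  map_d x := by
    apply Subtype.ext
    exact QuadExt.ext (f.map_d x) rfl
  map_H x := rfl

theorem goodLift_π {D : QPM.{u}} (hD : D.isZeroGood) (f : D ⟶ C) :
    goodLift hD f ≫ C.goodCoverπ = f :=
  hom_ext (fun _ => rfl) (fun _ => rfl) fun a =>
    (crCoker_cokerMap₂ _ _).trans (congrArg f.fee (crCoker_crCokerEquiv_symm hD a))

theorem isZeroGood_of_isColimit {J : Type*} {F : Discrete J ⥤ QPM.{u}} {c : Cocone F}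
    (hc : IsColimit c) (hF : ∀ j, (F.obj j).isZeroGood) : c.pt.isZeroGood := by
  let s : Cocone F :=
    { pt := c.pt.goodCover
      ι := Discrete.natTrans fun j => goodLift (hF j) (c.ι.app j) }
  refine isZeroGood_of_section (hc.desc s) (hc.hom_ext fun j => ?_)
  rw [hc.fac_assoc, Category.comp_id]
  exact goodLift_π _ _

end good

end QPM

end

section

open scoped TensorProduct

namespace QPM

open SquareGroup

section goodTensor

variable {C D : QPM.{u}}

theorem coker_tensor_hom_ext {A : Type*} [AddCommGroup A] {f g : (C.tensor D).Coker →+ A}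
    (h : ∀ x y, f ((C.tensor D).toCoker (u00 C D x y)) = g ((C.tensor D).toCoker (u00 C D x y))) :
    f = g := by
  ext t
  obtain ⟨t, rfl⟩ := (C.tensor D).toCoker_surjective t
  exact DFunLike.congr_fun (tensor0_hom_ext (f := f.comp (C.tensor D).toCoker)
    (g := g.comp (C.tensor D).toCoker) h fun a b => by simp) t

theorem tmul_hom_ext_of_generators {X Y : Type u} {A ι κ : Type*} [AddCommGroup X]
    [AddCommGroup Y] [AddCommGroup A] (x : ι → X) (y : κ → Y)
    (hx : ∀ f g : X →+ A, (∀ i, f (x i) = g (x i)) → f = g)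
    (hy : ∀ f g : Y →+ A, (∀ j, f (y j) = g (y j)) → f = g) {f g : X ⊗[ℤ] Y →+ A}
    (h : ∀ i j, f (x i ⊗ₜ y j) = g (x i ⊗ₜ y j)) : f = g := by
  refine tmul_hom_ext fun s t => ?_
  refine DFunLike.congr_fun (hy (f.comp (TensorProduct.mk ℤ X Y s).toAddMonoidHom)
    (g.comp (TensorProduct.mk ℤ X Y s).toAddMonoidHom) fun j => ?_) t
  exact DFunLike.congr_fun (hx (f.comp ((TensorProduct.mk ℤ X Y).flip (y j)).toAddMonoidHom)
    (g.comp ((TensorProduct.mk ℤ X Y).flip (y j)).toAddMonoidHom) fun i => h i j) s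

variable (C D) in
/-- The homomorphism `[x] ⊗ [y] ↦ [x ⊚̲ y]`. -/
def cokerTensor : C.Coker ⊗[ℤ] D.Coker →+ (C.tensor D).Coker :=
  (TensorProduct.lift (AddMonoidHom.toIntLinearMap (AddMonoidHom.mk'
    (fun a => AddMonoidHom.toIntLinearMap (a : D.Coker →+ (C.tensor D).Coker))
    (fun _ _ => rfl) |>.comp (cokerDesc (C := C) (AddMonoidHom.mk'
      (fun x => cokerDesc ((C.tensor D).toCoker.comp ((Bilin.univ C D).v00Hom x)) fun b => by
        simp [Bilin.v00_dP]) fun x x' => by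
        ext t
        obtain ⟨y, rfl⟩ := D.toCoker_surjective t
        simp [Bilin.add_v00]) fun a => by
        ext t
        obtain ⟨y, rfl⟩ := D.toCoker_surjective t
        simp [Bilin.dP_v00])))).toAddMonoidHom

@[simp] theorem cokerTensor_tmul (x : C.C0) (y : D.C0) :
    cokerTensor C D (C.toCoker x ⊗ₜ D.toCoker y) = (C.tensor D).toCoker (u00 C D x y) := rfl

theorem isZeroGood_tensor (hC : C.isZeroGood) (hD : D.isZeroGood) :
    (C.tensor D).isZeroGood := by
  let ψ : C.Cee ⊗[ℤ] D.Cee →+ (C.tensor D).Coker ⊗[ℤ] (C.tensor D).Coker :=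
    ((TensorProduct.map (cokerTensor C D).toIntLinearMap (cokerTensor C D).toIntLinearMap ∘ₗ
      (TensorProduct.tensorTensorTensorComm ℤ _ _ _ _).toLinearMap) ∘ₗ
        TensorProduct.map (crCokerEquiv hC).symm.toLinearMap
          (crCokerEquiv hD).symm.toLinearMap).toAddMonoidHom
  have hψ (x x' : C.C0) (y y' : D.C0) : ψ (C.cr x x' ⊗ₜ D.cr y y') =
      (C.tensor D).toCoker (u00 C D x y) ⊗ₜ (C.tensor D).toCoker (u00 C D x' y') := by
    change TensorProduct.map _ _ (TensorProduct.tensorTensorTensorComm ℤ _ _ _ _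
      ((crCokerEquiv hC).symm (C.cr x x') ⊗ₜ[ℤ] (crCokerEquiv hD).symm (D.cr y y'))) = _
    rw [crCokerEquiv_symm_cr, crCokerEquiv_symm_cr]
    rfl
  have h1 : ψ.comp (C.tensor D).crCoker.toAddMonoidHom =
      AddMonoidHom.id ((C.tensor D).Coker ⊗[ℤ] (C.tensor D).Coker) := by
    refine tmul_hom_ext_of_generators
      (fun i : C.C0 × D.C0 => (C.tensor D).toCoker (u00 C D i.1 i.2))
      (fun i : C.C0 × D.C0 => (C.tensor D).toCoker (u00 C D i.1 i.2))
      (fun f g h => coker_tensor_hom_ext fun x y => h (x, y))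
      (fun f g h => coker_tensor_hom_ext fun x y => h (x, y)) ?_
    rintro ⟨x, y⟩ ⟨x', y'⟩
    exact (congrArg ψ ((Bilin.univ C D).cr_v00 x x' y y')).trans (hψ x x' y y')
  have h2 : (C.tensor D).crCoker.toAddMonoidHom.comp ψ = AddMonoidHom.id (C.Cee ⊗[ℤ] D.Cee) := by
    have h3 : ((C.tensor D).crCoker.toAddMonoidHom.comp ψ).comp
        (TensorProduct.map C.crCoker D.crCoker).toAddMonoidHom =
          (TensorProduct.map C.crCoker D.crCoker).toAddMonoidHom := by
      refine tmul_hom_ext_of_generators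
        (fun i : C.C0 × C.C0 => C.toCoker i.1 ⊗ₜ[ℤ] C.toCoker i.2)
        (fun i : D.C0 × D.C0 => D.toCoker i.1 ⊗ₜ[ℤ] D.toCoker i.2)
        (fun f g h => C.coker_tmul_hom_ext fun x y => h (x, y))
        (fun f g h => D.coker_tmul_hom_ext fun x y => h (x, y)) ?_
      rintro ⟨x, x'⟩ ⟨y, y'⟩
      exact (congrArg (C.tensor D).crCoker (hψ x x' y y')).trans
        ((Bilin.univ C D).cr_v00 x x' y y')
    ext t
    obtain ⟨t, rfl⟩ := (TensorProduct.congr (crCokerEquiv hC) (crCokerEquiv hD)).surjective t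
    exact DFunLike.congr_fun h3 t
  exact ⟨fun s t hst => (DFunLike.congr_fun h1 s).symm.trans
      ((congrArg ψ hst).trans (DFunLike.congr_fun h1 t)), fun a => ⟨ψ a, DFunLike.congr_fun h2 a⟩⟩

theorem isZeroGood_Zbar : Zbar.{u}.isZeroGood := by
  let e := Zbar.{u}.toCoker (Zbar.int0 1) ⊗ₜ[ℤ] Zbar.{u}.toCoker (Zbar.int0 1)
  have h (s : Zbar.{u}.Coker ⊗[ℤ] Zbar.{u}.Coker) :
      s = Zbar.toIntee.{u} (Zbar.{u}.crCoker s) • e := by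
    let f : ℤ →+ Zbar.{u}.Coker ⊗[ℤ] Zbar.{u}.Coker := zmultiplesHom _ e
    refine DFunLike.congr_fun (coker_tmul_hom_ext Zbar.{u} (f := AddMonoidHom.id _)
      (g := f.comp (Zbar.toIntee.comp Zbar.{u}.crCoker.toAddMonoidHom)) fun x y => ?_) s
    have h0 (n : Zbar.{u}.C0) : Zbar.{u}.toCoker n =
        Zbar.toInt0 n • Zbar.{u}.toCoker (Zbar.int0 1) := by
      rw [← map_zsmul]
      exact congrArg Zbar.{u}.toCoker (ULift.ext _ _ (mul_one (Zbar.toInt0 n)).symm)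
    have h1 : f (Zbar.toIntee (Zbar.cr x y)) =
      (Zbar.toInt0 x * Zbar.toInt0 y) • e := by
      rw [Zbar.toIntee_cr]; rfl
    refine Eq.trans ?_ h1.symm
    change Zbar.{u}.toCoker x ⊗ₜ[ℤ] Zbar.{u}.toCoker y = _
    rw [h0 x, h0 y, TensorProduct.smul_tmul_smul]
  refine ⟨fun s t hst => (h s).trans (Eq.trans ?_ (h t).symm), fun a => ?_⟩
  · exact congrArg (fun c => Zbar.toIntee.{u} c • _) hst
  · refine ⟨Zbar.toIntee a • e, ?_⟩
    refine (map_zsmul Zbar.{u}.crCoker _ _).trans ?_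
    refine (congrArg (Zbar.toIntee a • ·) (crCoker_tmul _ _ _)).trans ?_
    have : Zbar.{u}.cr (Zbar.int0 1) (Zbar.int0 1) = Zbar.intee 1 :=
      ULift.ext _ _ (Zbar.toIntee_cr _ _)
    rw [this]
    exact ULift.ext _ _ (mul_one (Zbar.toIntee a))

end goodTensor

end QPM

end

section

open scoped TensorProduct

namespace QPM

open SquareGroup

/-! ### Coproducts of quadratic pair modules -/

/-- The three levels of a quadratic pair module. -/
inductive Level
  | zero
  | one
  | ee

/-- The underlying group of a quadratic pair module at each level. -/
abbrev level (C : QPM.{u}) : Level → Type u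
  | .zero => C.C0
  | .one => C.C1
  | .ee => C.Cee

instance (C : QPM.{u}) : ∀ s, AddGroup (C.level s)
  | .zero => inferInstanceAs (AddGroup C.C0)
  | .one => inferInstanceAs (AddGroup C.C1)
  | .ee => inferInstanceAs (AddGroup C.Cee)

/-- The homomorphism induced by a morphism at each level. -/
def levelMap {C D : QPM.{u}} (f : C ⟶ D) : ∀ s, C.level s →+ D.level s
  | .zero => f.f0
  | .one => f.f1
  | .ee => f.fee

section coprod

variable {J : Type u} (C : J → QPM.{u})

/-- Terms in the operations of a quadratic pair module and the elements of a family. -/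
inductive CoprodTerm : Level → Type u
  | incl (s : Level) (j : J) (x : (C j).level s) : CoprodTerm s
  | zero (s : Level) : CoprodTerm s
  | neg (s : Level) (t : CoprodTerm s) : CoprodTerm s
  | add (s : Level) (t t' : CoprodTerm s) : CoprodTerm s
  | sub (s : Level) (t t' : CoprodTerm s) : CoprodTerm s
  | P (t : CoprodTerm .ee) : CoprodTerm .one
  | d (t : CoprodTerm .one) : CoprodTerm .zero
  | H (t : CoprodTerm .zero) : CoprodTerm .ee

variable {C}

/-- The value of a term under a family of morphisms. -/
def CoprodTerm.eval {E : QPM.{u}} (f : ∀ j, C j ⟶ E) : ∀ {s}, CoprodTerm C s → E.level s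
  | _, incl s j x => levelMap (f j) s x
  | _, zero s => (0 : E.level s)
  | _, neg s t => (-(t.eval f) : E.level s)
  | _, add s t t' => (t.eval f + t'.eval f : E.level s)
  | _, sub s t t' => (t.eval f - t'.eval f : E.level s)
  | _, P t => E.P (t.eval f)
  | _, d t => E.d (t.eval f)
  | _, H t => E.H (t.eval f)

variable (C)

/-- Terms are identified if they have the same value under all families of morphisms. -/
instance coprodSetoid (s : Level) : Setoid (CoprodTerm C s) where
  r t t' := ∀ (E : QPM.{u}) (f : ∀ j, C j ⟶ E), t.eval f = t'.eval f
  iseqv := ⟨fun _ _ _ => rfl, fun h E f => (h E f).symm, fun h h' E f => (h E f).trans (h' E f)⟩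

/-- The levels of the coproduct. -/
def CoprodLevel (s : Level) : Type u := Quotient (coprodSetoid C s)

/-- The class of a term. -/
def coprodMk {s : Level} (t : CoprodTerm C s) : CoprodLevel C s := Quotient.mk _ t

variable {C}

theorem coprodMk_eq {s : Level} {t t' : CoprodTerm C s}
    (h : ∀ (E : QPM.{u}) (f : ∀ j, C j ⟶ E), t.eval f = t'.eval f) :
    coprodMk C t = coprodMk C t' := Quotient.sound h

theorem coprodMk_surjective {s : Level} : Function.Surjective (coprodMk C (s := s)) :=
  Quotient.mk_surjective

instance (s : Level) : Add (CoprodLevel C s) where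
  add := Quotient.map₂ (.add s) fun _ _ h _ _ h' E f => congrArg₂ (· + ·) (h E f) (h' E f)

instance (s : Level) : Zero (CoprodLevel C s) where
  zero := coprodMk C (.zero s)

instance (s : Level) : Neg (CoprodLevel C s) where
  neg := Quotient.map (.neg s) fun _ _ h E f => congrArg (- ·) (h E f)

instance (s : Level) : Sub (CoprodLevel C s) where
  sub := Quotient.map₂ (.sub s) fun _ _ h _ _ h' E f => congrArg₂ (· - ·) (h E f) (h' E f)

instance (s : Level) : AddGroup (CoprodLevel C s) where
  nsmul := nsmulRec
  zsmul := zsmulRec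
  add_assoc := by
    rintro ⟨a⟩ ⟨b⟩ ⟨c⟩
    exact coprodMk_eq fun E f => add_assoc (a.eval f) (b.eval f) (c.eval f)
  zero_add := by
    rintro ⟨a⟩
    exact coprodMk_eq fun E f => zero_add (a.eval f)
  add_zero := by
    rintro ⟨a⟩
    exact coprodMk_eq fun E f => add_zero (a.eval f)
  neg_add_cancel := by
    rintro ⟨a⟩
    exact coprodMk_eq fun E f => neg_add_cancel (a.eval f)
  sub_eq_add_neg := by
    rintro ⟨a⟩ ⟨b⟩
    exact coprodMk_eq fun E f => sub_eq_add_neg (a.eval f) (b.eval f)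

instance : AddCommGroup (CoprodLevel C .ee) where
  add_comm := by
    rintro ⟨a⟩ ⟨b⟩
    exact coprodMk_eq fun E f => add_comm (a.eval f : E.Cee) (b.eval f)

variable (C)

/-- The coproduct of a family of quadratic pair modules. -/
def coprod : QPM.{u} where
  C0 := CoprodLevel C .zero
  C1 := CoprodLevel C .one
  Cee := CoprodLevel C .ee
  P := AddMonoidHom.mk' (Quotient.map .P fun _ _ h E f => congrArg E.P (h E f)) (by
    rintro ⟨a⟩ ⟨b⟩
    exact coprodMk_eq fun E f => map_add E.P (a.eval f) (b.eval f))
  d := AddMonoidHom.mk' (Quotient.map .d fun _ _ h E f => congrArg E.d (h E f)) (by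
    rintro ⟨a⟩ ⟨b⟩
    exact coprodMk_eq fun E f => map_add E.d (a.eval f) (b.eval f))
  H := Quotient.map .H fun _ _ h E f => congrArg E.H (h E f)
  isSq0 := by
    constructor
    · rintro ⟨a⟩ ⟨b⟩ ⟨c⟩
      exact coprodMk_eq fun E f => E.isSq0.cross_add_left (a.eval f) (b.eval f) (c.eval f)
    · rintro ⟨a⟩ ⟨b⟩ ⟨c⟩
      exact coprodMk_eq fun E f => E.isSq0.cross_add_right (a.eval f) (b.eval f) (c.eval f)
    · rintro ⟨a⟩ ⟨b⟩
      exact coprodMk_eq fun E f => E.isSq0.cross_P_left (a.eval f) (b.eval f)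
    · rintro ⟨a⟩ ⟨b⟩
      exact coprodMk_eq fun E f => E.isSq0.cross_P_right (a.eval f) (b.eval f)
    · rintro ⟨a⟩ ⟨b⟩
      exact coprodMk_eq fun E f => E.isSq0.P_cross (a.eval f) (b.eval f)
    · rintro ⟨a⟩
      exact coprodMk_eq fun E f => E.isSq0.P_H_P (a.eval f)
  isSq1 := by
    constructor
    · rintro ⟨a⟩ ⟨b⟩ ⟨c⟩
      exact coprodMk_eq fun E f => E.isSq1.cross_add_left (a.eval f) (b.eval f) (c.eval f)
    · rintro ⟨a⟩ ⟨b⟩ ⟨c⟩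
      exact coprodMk_eq fun E f => E.isSq1.cross_add_right (a.eval f) (b.eval f) (c.eval f)
    · rintro ⟨a⟩ ⟨b⟩
      exact coprodMk_eq fun E f => E.isSq1.cross_P_left (a.eval f) (b.eval f)
    · rintro ⟨a⟩ ⟨b⟩
      exact coprodMk_eq fun E f => E.isSq1.cross_P_right (a.eval f) (b.eval f)
    · rintro ⟨a⟩ ⟨b⟩
      exact coprodMk_eq fun E f => E.isSq1.P_cross (a.eval f) (b.eval f)
    · rintro ⟨a⟩
      exact coprodMk_eq fun E f => E.isSq1.P_H_P (a.eval f)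

/-- The inclusion of a summand. -/
def coprodι (j : J) : C j ⟶ coprod C where
  f0 := AddMonoidHom.mk' (fun x => coprodMk C (.incl .zero j x)) fun x y =>
    coprodMk_eq fun _ f => map_add (f j).f0 x y
  f1 := AddMonoidHom.mk' (fun x => coprodMk C (.incl .one j x)) fun x y =>
    coprodMk_eq fun _ f => map_add (f j).f1 x y
  fee := AddMonoidHom.mk' (fun x => coprodMk C (.incl .ee j x)) fun x y =>
    coprodMk_eq fun _ f => map_add (f j).fee x y
  map_P a := coprodMk_eq fun _ f => (f j).map_P a
  map_d x := coprodMk_eq fun _ f => (f j).map_d x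
  map_H x := coprodMk_eq fun _ f => (f j).map_H x

variable {C}

/-- The value of an element of the coproduct under a family of morphisms. -/
def coprodEval {E : QPM.{u}} (f : ∀ j, C j ⟶ E) (s : Level) : CoprodLevel C s →+ E.level s :=
  AddMonoidHom.mk' (Quotient.lift (CoprodTerm.eval f) fun _ _ h => h E f) (by
    rintro ⟨a⟩ ⟨b⟩
    rfl)

/-- The morphism from the coproduct given by a family of morphisms. -/
def coprodDesc {E : QPM.{u}} (f : ∀ j, C j ⟶ E) : coprod C ⟶ E where
  f0 := coprodEval f .zero
  f1 := coprodEval f .one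
  fee := coprodEval f .ee
  map_P := by rintro ⟨a⟩; rfl
  map_d := by rintro ⟨a⟩; rfl
  map_H := by rintro ⟨a⟩; rfl

theorem coprod_level_ext {E : QPM.{u}} {f g : coprod C ⟶ E}
    (h : ∀ j, coprodι C j ≫ f = coprodι C j ≫ g) {s : Level} (t : CoprodTerm C s) :
    (match s with
      | .zero => fun t => f.f0 (coprodMk C t) = g.f0 (coprodMk C t)
      | .one => fun t => f.f1 (coprodMk C t) = g.f1 (coprodMk C t)
      | .ee => fun t => f.fee (coprodMk C t) = g.fee (coprodMk C t) :
      CoprodTerm C s → Prop) t := by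
  induction t with
  | incl s j x =>
    cases s
    · exact DFunLike.congr_fun (congrArg Hom.f0 (h j)) x
    · exact DFunLike.congr_fun (congrArg Hom.f1 (h j)) x
    · exact DFunLike.congr_fun (congrArg Hom.fee (h j)) x
  | zero s =>
    cases s
    · exact (map_zero f.f0).trans (map_zero g.f0).symm
    · exact (map_zero f.f1).trans (map_zero g.f1).symm
    · exact (map_zero f.fee).trans (map_zero g.fee).symm
  | neg s t ih =>
    cases s
    · exact (map_neg f.f0 _).trans ((congrArg (- ·) ih).trans (map_neg g.f0 _).symm)
    · exact (map_neg f.f1 _).trans ((congrArg (- ·) ih).trans (map_neg g.f1 _).symm)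
    · exact (map_neg f.fee _).trans ((congrArg (- ·) ih).trans (map_neg g.fee _).symm)
  | add s t t' ih ih' =>
    cases s
    · exact (map_add f.f0 _ _).trans ((congrArg₂ (· + ·) ih ih').trans (map_add g.f0 _ _).symm)
    · exact (map_add f.f1 _ _).trans ((congrArg₂ (· + ·) ih ih').trans (map_add g.f1 _ _).symm)
    · exact (map_add f.fee _ _).trans ((congrArg₂ (· + ·) ih ih').trans (map_add g.fee _ _).symm)
  | sub s t t' ih ih' =>
    cases s
    · exact (map_sub f.f0 _ _).trans ((congrArg₂ (· - ·) ih ih').trans (map_sub g.f0 _ _).symm)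
    · exact (map_sub f.f1 _ _).trans ((congrArg₂ (· - ·) ih ih').trans (map_sub g.f1 _ _).symm)
    · exact (map_sub f.fee _ _).trans ((congrArg₂ (· - ·) ih ih').trans (map_sub g.fee _ _).symm)
  | P t ih => exact (f.map_P _).trans ((congrArg E.P ih).trans (g.map_P _).symm)
  | d t ih => exact (f.map_d _).trans ((congrArg E.d ih).trans (g.map_d _).symm)
  | H t ih => exact (f.map_H _).trans ((congrArg E.H ih).trans (g.map_H _).symm)

theorem coprod_hom_ext {E : QPM.{u}} {f g : coprod C ⟶ E}
    (h : ∀ j, coprodι C j ≫ f = coprodι C j ≫ g) : f = g := by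
  refine hom_ext (fun x => ?_) (fun x => ?_) (fun x => ?_)
  all_goals
    obtain ⟨t, rfl⟩ := coprodMk_surjective x
    exact coprod_level_ext h t

variable (C)

/-- The coproduct is a coproduct. -/
def coprodIsColimit : IsColimit (Cofan.mk (coprod C) (coprodι C)) :=
  Cofan.IsColimit.mk _ (fun s => coprodDesc s.inj) (fun _ _ => rfl)
    fun _ _ hm => coprod_hom_ext fun j => hm j

instance hasCoproducts : HasCoproducts.{u} QPM.{u} :=
  hasCoproducts_of_colimit_cofans (fun C => Cofan.mk (coprod C) (coprodι C)) coprodIsColimit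

end coprod

end QPM

end

section

open scoped TensorProduct

namespace QPM

open SquareGroup

/-! ### Internal homs out of good quadratic pair modules -/

theorem good_hom_ext {C : QPM.{u}} (hC : C.isZeroGood) {A : Type*} [AddCommGroup A]
    {f g : C.Cee →+ A} (h : ∀ x y, f (C.cr x y) = g (C.cr x y)) : f = g := by
  ext a
  obtain ⟨t, rfl⟩ := (crCokerEquiv hC).surjective a
  exact DFunLike.congr_fun (C.coker_tmul_hom_ext (f := f.comp C.crCoker.toAddMonoidHom)
    (g := g.comp C.crCoker.toAddMonoidHom) h) t

/-- The involution `χ ↦ -T χ T`. -/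
def homT (C E : QPM.{u}) : (C.Cee →+ E.Cee) →+ (C.Cee →+ E.Cee) :=
  AddMonoidHom.mk' (fun χ => -(E.T.comp (χ.comp C.T))) fun χ χ' => by
    ext a; simp; abel

@[simp] theorem homT_apply {C E : QPM.{u}} (χ : C.Cee →+ E.Cee) (a : C.Cee) :
    homT C E χ a = -E.T (χ (C.T a)) := rfl

@[simp] theorem homT_homT {C E : QPM.{u}} (χ : C.Cee →+ E.Cee) : homT C E (homT C E χ) = χ := by
  ext a; simp

section ihom

variable {C : QPM.{u}} (hC : C.isZeroGood) (E : QPM.{u})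

/-- The homomorphism `C_ee → E_ee` induced by two homomorphisms of cokernels. -/
noncomputable def homFormVal (f g : C.Coker →+ E.Coker) : C.Cee →+ E.Cee :=
  E.crCoker.toAddMonoidHom.comp ((TensorProduct.map f.toIntLinearMap
    g.toIntLinearMap).toAddMonoidHom.comp (crCokerEquiv hC).symm.toLinearMap.toAddMonoidHom)

theorem homFormVal_cr (f g : C.Coker →+ E.Coker) (x y : C.C0) :
    homFormVal hC E f g (C.cr x y) = E.crCoker (f (C.toCoker x) ⊗ₜ g (C.toCoker y)) := by
  change E.crCoker (TensorProduct.map _ _ ((crCokerEquiv hC).symm (C.cr x y))) = _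
  rw [crCokerEquiv_symm_cr]
  rfl

/-- The biadditive form of the previous definition. -/
noncomputable def homForm :
    (C.Coker →+ E.Coker) →+ (C.Coker →+ E.Coker) →+ (C.Cee →+ E.Cee) :=
  AddMonoidHom.mk' (fun f => AddMonoidHom.mk' (homFormVal hC E f) fun g g' =>
    good_hom_ext hC fun x y => by simp [homFormVal_cr, TensorProduct.tmul_add])
    fun f f' => AddMonoidHom.ext fun g => good_hom_ext hC fun x y => by
      simp [homFormVal_cr, TensorProduct.add_tmul]

theorem homForm_cr (f g : C.Coker →+ E.Coker) (x y : C.C0) :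
    homForm hC E f g (C.cr x y) = E.crCoker (f (C.toCoker x) ⊗ₜ g (C.toCoker y)) :=
  homFormVal_cr hC E f g x y

theorem homT_homForm (f g : C.Coker →+ E.Coker) :
    homT C E (homForm hC E f g) = -homForm hC E g f := by
  refine good_hom_ext hC fun x y => ?_
  obtain ⟨x', hx⟩ := E.toCoker_surjective (g (C.toCoker x))
  obtain ⟨y', hy⟩ := E.toCoker_surjective (f (C.toCoker y))
  simp [homForm_cr, ← hx, ← hy]

/-- The functions underlying the elements of degree `0` of the internal hom. -/
abbrev PreHom (C E : QPM.{u}) : Type u :=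
  (C.C0 → E.C0) × (C.C1 → E.C1) × (C.Coker →+ E.Coker)

/-- The cross effect of the internal hom. -/
noncomputable def preHomForm : PreHom C E →+ PreHom C E →+ (C.Cee →+ E.Cee) :=
  AddMonoidHom.mk' (fun u => AddMonoidHom.mk' (fun v => homForm hC E u.2.2 v.2.2)
    fun v v' => map_add _ _ _) fun u u' => AddMonoidHom.ext fun v => by simp

@[simp] theorem preHomForm_apply (u v : PreHom C E) :
    preHomForm hC E u v = homForm hC E u.2.2 v.2.2 := rfl

/-- The homomorphism `Δ` of the internal hom. -/
noncomputable def homΔ : QuadExt (preHomForm hC E) →+ (C.Cee →+ E.Cee) :=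
  AddMonoidHom.mk' (fun w => homForm hC E w.fst.2.2 w.fst.2.2 - w.snd + homT C E w.snd)
    fun w w' => by
      simp [homT_homForm]
      abel

theorem homΔ_apply (w : QuadExt (preHomForm hC E)) :
    homΔ hC E w = homForm hC E w.fst.2.2 w.fst.2.2 - w.snd + homT C E w.snd := rfl

variable {E}

/-- The axioms of a quadratic map in degree `0`. -/
structure IsHom0 (w : QuadExt (preHomForm hC E)) : Prop where
  coker : ∀ x, w.fst.2.2 (C.toCoker x) = E.toCoker (w.fst.1 x)
  add0 : ∀ x x', w.fst.1 (x + x') = w.fst.1 x + w.fst.1 x' + E.d (E.P (w.snd (C.cr x' x)))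
  add1 : ∀ x x', w.fst.2.1 (x + x') =
    w.fst.2.1 x + w.fst.2.1 x' + E.P (w.snd (C.cr (C.d x') (C.d x)))
  d : ∀ x, E.d (w.fst.2.1 x) = w.fst.1 (C.d x)
  P : ∀ a, w.fst.2.1 (C.P a) = E.P (homΔ hC E w a)
  H : ∀ x, E.H (w.fst.1 x) = w.snd (C.cr x x) + homΔ hC E w (C.H x)

variable {hC}

theorem IsHom0.homForm_cr {w w' : QuadExt (preHomForm hC E)} (hw : IsHom0 hC w)
    (hw' : IsHom0 hC w') (x y : C.C0) :
    homForm hC E w.fst.2.2 w'.fst.2.2 (C.cr x y) = E.cr (w.fst.1 x) (w'.fst.1 y) := by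
  rw [QPM.homForm_cr, hw.coker, hw'.coker, crCoker_tmul]

theorem add_add_add_central {G : Type*} [AddGroup G] {a b a' b' p p' q : G}
    (hp : ∀ g, p + g = g + p) (hq : ∀ g, q + g = g + q) (h : b + a' = a' + b + q) :
    a + b + p + (a' + b' + p') = a + a' + (b + b') + (p + p' + q) := by
  calc a + b + p + (a' + b' + p') = a + (b + a') + b' + p' + p := by
        rw [add_assoc (a + b), hp]; simp only [add_assoc]
    _ = a + a' + b + (q + (b' + p' + p)) := by rw [h]; simp only [add_assoc]
    _ = a + a' + (b + b') + (p + p' + q) := by 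
        rw [hq, add_assoc b', ← hp p']; simp only [add_assoc]

theorem neg_add_add_central {G : Type*} [AddGroup G] {a b p q : G}
    (hp : ∀ g, p + g = g + p) (hq : ∀ g, q + g = g + q) (h : b + a = a + b + q) :
    -(a + b + p) = -a + -b + (-p + q) := by
  have h1 : -a + -b = -q + -(a + b) := by rw [← neg_add_rev, h, neg_add_rev]
  have h2 : -(a + b) + -p = -p + -(a + b) := by rw [← neg_add_rev, hp, neg_add_rev]
  rw [neg_add_rev, ← h2, h1, add_assoc (-q), ← add_assoc _ (-p) q, ← hq, neg_add_cancel_left]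

variable (hC E)

/-- The elements of degree `0` of the internal hom. -/
noncomputable def ihom0 : AddSubgroup (QuadExt (preHomForm hC E)) where
  carrier := {w | IsHom0 hC w}
  zero_mem' := by
    constructor <;> intros <;> simp
  add_mem' {w w'} hw hw' := by
    constructor
    · intro x; simp [hw.coker, hw'.coker]
    · intro x x'
      simp only [QuadExt.add_fst, QuadExt.add_snd, Prod.fst_add, Pi.add_apply, hw.add0, hw'.add0]
      rw [add_add_add_central (E.dP_comm _) (E.dP_comm _) (E.add_comm0 _ _)]
      simp [hw.homForm_cr hw']
    · intro x x'
      simp only [QuadExt.add_fst, QuadExt.add_snd, Prod.fst_add, Prod.snd_add, Pi.add_apply,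
        hw.add1, hw'.add1]
      rw [add_add_add_central (E.P_comm _) (E.P_comm _) (E.add_comm1 _ _)]
      simp [hw.homForm_cr hw', hw.d, hw'.d]
    · intro x
      simp [hw.d, hw'.d]
    · intro a
      rw [map_add]
      simp [hw.P, hw'.P]
    · intro x
      rw [map_add]
      simp [H_add, hw.H, hw'.H, hw.homForm_cr hw']
      abel
  neg_mem' {w} hw := by
    constructor
    · intro x; simp [hw.coker]
    · intro x x'
      simp only [QuadExt.neg_fst, QuadExt.neg_snd, Prod.fst_neg, Pi.neg_apply, hw.add0]
      rw [neg_add_add_central (E.dP_comm _) (E.dP_comm _) (E.add_comm0 _ _)]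
      simp [hw.homForm_cr hw]
    · intro x x'
      simp only [QuadExt.neg_fst, QuadExt.neg_snd, Prod.fst_neg, Prod.snd_neg, Pi.neg_apply,
        hw.add1]
      rw [neg_add_add_central (E.P_comm _) (E.P_comm _) (E.add_comm1 _ _)]
      simp [hw.homForm_cr hw, hw.d]
    · intro x
      simp [hw.d]
    · intro a
      rw [map_neg]
      simp [hw.P]
    · intro x
      rw [map_neg]
      simp [H_neg, hw.H, hw.homForm_cr hw]
      abel

/-- The elements of degree `1` of the internal hom. -/
noncomputable def ihom1 : AddSubgroup (ihom0 hC E × (C.C0 → E.C1)) where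
  carrier := {w | (∀ x, E.d (w.2 x) = w.1.1.fst.1 x) ∧ (∀ x, w.2 (C.d x) = w.1.1.fst.2.1 x) ∧
    ∀ x x', w.2 (x + x') = w.2 x + w.2 x' + E.P (w.1.1.snd (C.cr x' x))}
  zero_mem' := by
    refine ⟨?_, ?_, ?_⟩ <;> intros <;> simp
  add_mem' {w w'} hw hw' := by
    refine ⟨?_, ?_, ?_⟩
    · intro x; simp [hw.1, hw'.1]
    · intro x; simp [hw.2.1, hw'.2.1]
    · intro x x'
      simp only [Prod.snd_add, Pi.add_apply, hw.2.2, hw'.2.2]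
      rw [add_add_add_central (E.P_comm _) (E.P_comm _) (E.add_comm1 _ _)]
      simp [hw.1, hw'.1, w.1.2.homForm_cr w'.1.2]
  neg_mem' {w} hw := by
    refine ⟨?_, ?_, ?_⟩
    · intro x; simp [hw.1]
    · intro x; simp [hw.2.1]
    · intro x x'
      simp only [Prod.snd_neg, Pi.neg_apply, hw.2.2]
      rw [neg_add_add_central (E.P_comm _) (E.P_comm _) (E.add_comm1 _ _)]
      simp [hw.1, w.1.2.homForm_cr w.1.2]

variable {E} in
theorem P_add_homT (χ : C.Cee →+ E.Cee) (x x' : C.C0) : E.P (χ (C.cr (x + x') (x + x'))) =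
    E.P (χ (C.cr x x)) + E.P (χ (C.cr x' x')) + E.P ((χ + homT C E χ) (C.cr x' x)) := by
  rw [← map_add, ← map_add, P_eq_P]
  simp only [map_add, AddMonoidHom.add_apply, homT_apply, T_cr, map_neg, neg_neg, toImP_T]
  abel

/-- The homomorphism `P` of the internal hom. -/
noncomputable def ihomP : (C.Cee →+ E.Cee) →+ ihom1 hC E :=
  AddMonoidHom.mk' (fun χ => ⟨⟨⟨⟨(fun x => E.d (E.P (χ (C.cr x x))),
        fun x => E.P (χ (C.cr (C.d x) (C.d x))), 0), χ + homT C E χ⟩, by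
      have hΔ : homΔ hC E ⟨(fun x => E.d (E.P (χ (C.cr x x))),
          fun x => E.P (χ (C.cr (C.d x) (C.d x))), 0), χ + homT C E χ⟩ = 0 := by
        rw [homΔ_apply]
        simp only [map_zero, map_add, homT_homT]
        abel
      constructor
      · intro x; simp
      · intro x x'
        exact (congrArg E.d (P_add_homT χ x x')).trans (by simp only [map_add])
      · intro x x'
        exact (congrArg (fun t => E.P (χ (C.cr t t))) (map_add C.d x x')).trans
          (P_add_homT χ _ _)
      · intro x; rfl
      · intro a
        rw [hΔ]
        simp
      · intro x
        rw [hΔ]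
        simp [H_dP]⟩, fun x => E.P (χ (C.cr x x))⟩, by
      refine ⟨fun x => rfl, fun x => rfl, P_add_homT χ⟩⟩) fun χ χ' => by
    apply Subtype.ext
    refine Prod.ext (Subtype.ext (QuadExt.ext ?_ ?_)) ?_
    · exact Prod.ext (funext fun x => by simp) (Prod.ext (funext fun x => by simp) (by simp))
    · simp; abel
    · funext x
      simp

variable {hC E}

theorem ihom0_ext {w w' : ihom0 hC E} (h0 : ∀ x, w.1.fst.1 x = w'.1.fst.1 x)
    (h1 : ∀ x, w.1.fst.2.1 x = w'.1.fst.2.1 x) (h : w.1.snd = w'.1.snd) : w = w' := by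
  refine Subtype.ext (QuadExt.ext (Prod.ext (funext h0) (Prod.ext (funext h1)
    (AddMonoidHom.ext fun t => ?_))) h)
  obtain ⟨x, rfl⟩ := C.toCoker_surjective t
  rw [w.2.coker, w'.2.coker, h0]

theorem ihom1_ext {w w' : ihom1 hC E} (h : w.1.1 = w'.1.1) (h' : ∀ x, w.1.2 x = w'.1.2 x) :
    w = w' :=
  Subtype.ext (Prod.ext h (funext h'))

theorem ihom0_add_comm (w w' : ihom0 hC E) :
    w + w' = w' + w + (ihomP hC E (homForm hC E w.1.fst.2.2 w'.1.fst.2.2)).1.1 := by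
  refine ihom0_ext (fun x => ?_) (fun x => ?_) ?_
  · exact (E.add_comm0 _ _).trans (congrArg (fun t => _ + E.d (E.P t))
      (w.2.homForm_cr w'.2 x x).symm)
  · refine (E.add_comm1 _ _).trans (congrArg (fun t => _ + E.P t) ?_)
    rw [w.2.d, w'.2.d]
    exact (w.2.homForm_cr w'.2 _ _).symm
  · simp [ihomP, homT_homForm]
    abel

theorem ihom1_add_comm (w w' : ihom1 hC E) :
    w + w' = w' + w + ihomP hC E (homForm hC E w.1.1.1.fst.2.2 w'.1.1.1.fst.2.2) := by
  refine ihom1_ext (ihom0_add_comm _ _) fun x => ?_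
  refine (E.add_comm1 _ _).trans (congrArg (fun t => _ + E.P t) ?_)
  rw [w.2.1, w'.2.1]
  exact (w.1.1.2.homForm_cr w'.1.1.2 _ _).symm

theorem ihomP_homT (χ : C.Cee →+ E.Cee) : ihomP hC E (homT C E χ) = ihomP hC E χ := by
  refine ihom1_ext (ihom0_ext (fun x => ?_) (fun x => ?_) ?_) (fun x => ?_)
  · simp [ihomP]
  · simp [ihomP]
  · simp [ihomP, add_comm]
  · simp [ihomP]

variable (hC E)

/-- The internal hom of quadratic pair modules out of a `0`-good one. -/
noncomputable def ihomGood : QPM.{u} :=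
  ofCr (G₀ := ihom0 hC E) (G₁ := ihom1 hC E) (A := C.Cee →+ E.Cee)
    (ihomP hC E)
    (AddMonoidHom.mk' (fun w => w.1.1) fun _ _ => rfl)
    (fun w => w.1.snd)
    (AddMonoidHom.mk' (fun w => AddMonoidHom.mk' (fun w' => homForm hC E w.1.fst.2.2 w'.1.fst.2.2)
      fun _ _ => map_add _ _ _) fun _ _ => AddMonoidHom.ext fun _ =>
        DFunLike.congr_fun (map_add (homForm hC E) _ _) _)
    (fun _ _ => rfl)
    (fun _ _ => DFunLike.congr_fun (map_zero (homForm hC E)) _)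
    (fun w _ => map_zero (homForm hC E w.1.fst.2.2))
    ihom0_add_comm
    ihom1_add_comm
    (fun χ => (map_add (ihomP hC E) _ _).trans (congrArg _ (ihomP_homT χ)))

end ihom

end QPM
end

section

open scoped TensorProduct

namespace QPM

open SquareGroup

section adjunction

variable {C : QPM.{u}} (hC : C.isZeroGood) {D E : QPM.{u}}

/-- The homomorphism underlying an element of degree `ee` of the internal hom. -/
def ihomHom (χ : (ihomGood hC E).Cee) : C.Cee →+ E.Cee := χ

theorem ihomHom_cr (w w' : (ihomGood hC E).C0) (x y : C.C0) :
    ihomHom hC ((ihomGood hC E).cr w w') (C.cr x y) =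
      E.cr ((w : ihom0 hC E).1.fst.1 x) ((w' : ihom0 hC E).1.fst.1 y) :=
  (congrArg (fun χ => ihomHom hC χ (C.cr x y)) (ofCr_cr ..)).trans
    ((w : ihom0 hC E).2.homForm_cr (w' : ihom0 hC E).2 x y)

theorem ihomHom_T (χ : (ihomGood hC E).Cee) :
    ihomHom hC ((ihomGood hC E).T χ) = homT C E (ihomHom hC χ) := by
  change ihomHom hC χ + homT C E (ihomHom hC χ) - ihomHom hC χ = _
  abel

theorem ihomHom_Δ (w : (ihomGood hC E).C0) :
    ihomHom hC ((ihomGood hC E).Δ w) = homΔ hC E (w : ihom0 hC E).1 :=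
  congrArg₂ (fun s t : C.Cee →+ E.Cee => s - (w : ihom0 hC E).1.snd + t) (ofCr_cr ..)
    (ihomHom_T hC _)

variable {hC} in
/-- The bilinear map corresponding to a morphism to the internal hom. -/
noncomputable def uncurryBilin (f : D ⟶ ihomGood hC E) : Bilin C D E where
  v00 x y := (f.f0 y : ihom0 hC E).1.fst.1 x
  v10 x y := (f.f0 y : ihom0 hC E).1.fst.2.1 x
  v01 x z := (f.f1 z : ihom1 hC E).1.2 x
  p := (f.fee : D.Cee →+ C.Cee →+ E.Cee).flip
  v00_add x y y' := congrArg (fun w : ihom0 hC E => w.1.fst.1 x) (map_add f.f0 y y')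
  v10_add x y y' := congrArg (fun w : ihom0 hC E => w.1.fst.2.1 x) (map_add f.f0 y y')
  v01_add x y y' := congrArg (fun w : ihom1 hC E => w.1.2 x) (map_add f.f1 y y')
  add_v00 x x' y := ((f.f0 y : ihom0 hC E).2.add0 x x').trans
    (congrArg (fun χ : C.Cee →+ E.Cee => _ + E.d (E.P (χ (C.cr x' x)))) (f.map_H y).symm)
  add_v10 x x' y := ((f.f0 y : ihom0 hC E).2.add1 x x').trans
    (congrArg (fun χ : C.Cee →+ E.Cee => _ + E.P (χ (C.cr (C.d x') (C.d x)))) (f.map_H y).symm)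
  add_v01 x x' z := ((f.f1 z : ihom1 hC E).2.2.2 x x').trans
    (congrArg (fun χ : C.Cee →+ E.Cee => _ + E.P (χ (C.cr x' x)))
      ((f.map_H (D.d z)).trans (congrArg (ihomGood hC E).H (f.map_d z))).symm)
  d_v10 x y := (f.f0 y : ihom0 hC E).2.d x
  d_v01 x z := ((f.f1 z : ihom1 hC E).2.1 x).trans
    (congrArg (fun w : ihom0 hC E => w.1.fst.1 x) (f.map_d z).symm)
  v10_d x z := (congrArg (fun w : ihom0 hC E => w.1.fst.2.1 x) (f.map_d z)).trans
    ((f.f1 z : ihom1 hC E).2.2.1 x).symm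
  P_v10 a y := ((f.f0 y : ihom0 hC E).2.P a).trans
    (congrArg (fun χ : C.Cee →+ E.Cee => E.P (χ a))
      ((congrArg (ihomHom hC) (map_Δ f y)).trans (ihomHom_Δ hC _)).symm)
  v01_P x b := congrArg (fun w : ihom1 hC E => w.1.2 x) (f.map_P b)
  T_p a b := by
    have h : ihomHom hC (f.fee (D.T b)) = homT C E (ihomHom hC (f.fee b)) :=
      (congrArg (ihomHom hC) (map_T f b)).trans (ihomHom_T hC _)
    change E.T (ihomHom hC (f.fee b) a) = -ihomHom hC (f.fee (D.T b)) (C.T a)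
    rw [h]
    simp
  cr_v00 x x' y y' := (ihomHom_cr hC _ _ x x').symm.trans
    (congrArg (fun χ : C.Cee →+ E.Cee => χ (C.cr x x')) (map_cr f y y').symm)
  H_v00 x y := ((f.f0 y : ihom0 hC E).2.H x).trans
    (congrArg₂ (fun χ χ' : C.Cee →+ E.Cee => χ (C.cr x x) + χ' (C.H x)) (f.map_H y).symm
      ((congrArg (ihomHom hC) (map_Δ f y)).trans (ihomHom_Δ hC _)).symm)

variable (B : Bilin C D E)

/-- The element of degree `0` of the internal hom given by a bilinear map. -/
noncomputable def curryPre (y : D.C0) : QuadExt (preHomForm hC E) :=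
  ⟨(fun x => B.v00 x y, fun x => B.v10 x y, cokerDesc (AddMonoidHom.mk' (fun x =>
    E.toCoker (B.v00 x y)) fun x x' => by simp [B.add_v00]) fun a => by simp [B.dP_v00]),
    B.p.flip (D.H y)⟩

theorem homForm_curryPre (y y' : D.C0) :
    homForm hC E (curryPre hC B y).fst.2.2 (curryPre hC B y').fst.2.2 = B.p.flip (D.cr y y') := by
  refine good_hom_ext hC fun x x' => ?_
  refine (homForm_cr ..).trans ?_
  exact (crCoker_tmul ..).trans (B.cr_v00 x x' y y')

theorem homΔ_curryPre (y : D.C0) : homΔ hC E (curryPre hC B y) = B.p.flip (D.Δ y) := by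
  have h : homT C E (B.p.flip (D.H y)) = B.p.flip (D.T (D.H y)) := by
    ext a
    simp [B.T_p]
  rw [homΔ_apply, homForm_curryPre, Δ_apply, map_add, map_sub, ← h]
  rfl

theorem isHom0_curryPre (y : D.C0) : IsHom0 hC (curryPre hC B y) where
  coker _ := rfl
  add0 x x' := B.add_v00 x x' y
  add1 x x' := B.add_v10 x x' y
  d x := B.d_v10 x y
  P a := by
    rw [homΔ_curryPre]
    exact B.P_v10 a y
  H x := by
    rw [homΔ_curryPre]
    exact B.H_v00 x y

/-- The homomorphism in degree `0` given by a bilinear map. -/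
noncomputable def curry0 : D.C0 →+ ihom0 hC E :=
  AddMonoidHom.mk' (fun y => ⟨curryPre hC B y, isHom0_curryPre hC B y⟩) fun y y' => by
    refine ihom0_ext (fun x => B.v00_add x y y') (fun x => B.v10_add x y y') ?_
    change B.p.flip (D.H (y + y')) = B.p.flip (D.H y) + B.p.flip (D.H y') +
      homForm hC E (curryPre hC B y).fst.2.2 (curryPre hC B y').fst.2.2
    rw [homForm_curryPre, H_add, map_add, map_add]

/-- The morphism to the internal hom given by a bilinear map. -/
noncomputable def curryBilin : D ⟶ ihomGood hC E where
  f0 := curry0 hC B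
  f1 := (AddMonoidHom.mk' (fun z => ⟨(curry0 hC B (D.d z), fun x => B.v01 x z),
    fun x => B.d_v01 x z, fun x => (B.v10_d x z).symm, fun x x' => B.add_v01 x x' z⟩)
    fun z z' => ihom1_ext (by simp) fun x => B.v01_add x z z' : D.C1 →+ ihom1 hC E)
  fee := B.p.flip
  map_P b := by
    refine ihom1_ext (ihom0_ext (fun x => B.v00_dP x b) (fun x => B.v10_dP x b) ?_)
      (fun x => B.v01_P x b)
    change B.p.flip (D.H (D.d (D.P b))) = B.p.flip b + homT C E (B.p.flip b)
    rw [H_dP, map_add]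
    ext a
    simp [B.T_p]
  map_d _ := rfl
  map_H _ := rfl

theorem ihomGood_hom_ext {f g : D ⟶ ihomGood hC E}
    (h00 : ∀ x y, (uncurryBilin f).v00 x y = (uncurryBilin g).v00 x y)
    (h10 : ∀ x y, (uncurryBilin f).v10 x y = (uncurryBilin g).v10 x y)
    (h01 : ∀ x y, (uncurryBilin f).v01 x y = (uncurryBilin g).v01 x y)
    (hee : ∀ a b, (uncurryBilin f).p a b = (uncurryBilin g).p a b) : f = g := by
  have h (b : D.Cee) : f.fee b = g.fee b := AddMonoidHom.ext fun a => hee a b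
  have h0 (y : D.C0) : f.f0 y = g.f0 y :=
    ihom0_ext (fun x => h00 x y) (fun x => h10 x y)
      ((f.map_H y).symm.trans ((h _).trans (g.map_H y)))
  exact hom_ext h0 (fun z => ihom1_ext
    ((f.map_d z).symm.trans ((h0 _).trans (g.map_d z))) fun x => h01 x z) h

/-- Morphisms out of a tensor product and morphisms to the internal hom. -/
noncomputable def curryEquiv (D E : QPM.{u}) :
    (C.tensorLeft.obj D ⟶ E) ≃ (D ⟶ ihomGood hC E) where
  toFun f := curryBilin hC ((Bilin.univ C D).comp f)
  invFun f := (uncurryBilin f).desc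
  left_inv _ := tensor_hom_ext (fun _ _ => Bilin.desc_u00 ..) (fun _ _ => Bilin.desc_u10 ..)
    (fun _ _ => Bilin.desc_u01 ..) (fun _ _ => Bilin.desc_tee ..)
  right_inv _ := ihomGood_hom_ext hC (fun _ _ => Bilin.desc_u00 ..) (fun _ _ => Bilin.desc_u10 ..)
    (fun _ _ => Bilin.desc_u01 ..) (fun _ _ => rfl)

theorem curryEquiv_naturality {D' D E : QPM.{u}} (f : D' ⟶ D) (g : C.tensorLeft.obj D ⟶ E) :
    curryEquiv hC D' E (C.tensorLeft.map f ≫ g) = f ≫ curryEquiv hC D E g :=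
  ihomGood_hom_ext hC
    (fun _ _ => congrArg g.f0 (tensorMap_u00 ..))
    (fun _ _ => congrArg g.f1 (tensorMap_u10 ..))
    (fun _ _ => congrArg g.f1 (tensorMap_u01 ..))
    (fun _ _ => congrArg g.fee (tensorMap_tee ..))

/-- The functor `C ⊙ -` for a `0`-good `C` is a left adjoint. -/
noncomputable def tensorLeftAdjunction :
    C.tensorLeft ⊣ Adjunction.rightAdjointOfEquiv (curryEquiv hC)
      (fun _ _ _ f g => curryEquiv_naturality hC f g) :=
  Adjunction.adjunctionOfEquivRight _ _

theorem preservesColimits_tensorLeft {C : QPM.{u}} (hC : C.isZeroGood) :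
    PreservesColimits C.tensorLeft :=
  (tensorLeftAdjunction hC).leftAdjoint_preservesColimits

end adjunction

end QPM

end

section

open scoped TensorProduct

namespace QPM

open SquareGroup

/-! ### The monoidal category of graded good quadratic pair modules -/

section graded

universe w

instance : isZeroGood.{u}.IsMonoidal where
  prop_unit := isZeroGood_Zbar
  prop_tensor _ _ hC hD := isZeroGood_tensor hC hD

instance (J : Type w) : isZeroGood.{u}.IsClosedUnderColimitsOfShape (Discrete J) where
  colimitsOfShape_le := by
    rintro _ ⟨h⟩
    exact isZeroGood_of_isColimit h.isColimit h.prop_diag_obj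

instance (J : Type u) : HasColimitsOfShape (Discrete J) QPM0.{u} :=
  hasColimitsOfShape_of_closedUnderColimits (Discrete J) isZeroGood.{u}

theorem preservesCoproducts_tensorLeft0 (J : Type w) [HasColimitsOfShape (Discrete J) QPM.{u}]
    (C : QPM0.{u}) : PreservesColimitsOfShape (Discrete J) (MonoidalCategory.tensorLeft C) := by
  have h : PreservesColimitsOfShape (Discrete J) C.obj.tensorLeft :=
    (tensorLeftAdjunction C.property).leftAdjoint_preservesColimits.preservesColimitsOfShape
  have : PreservesColimitsOfShape (Discrete J)
      (MonoidalCategory.tensorLeft C ⋙ isZeroGood.{u}.ι) :=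
    inferInstanceAs (PreservesColimitsOfShape (Discrete J) (isZeroGood.{u}.ι ⋙ C.obj.tensorLeft))
  exact preservesColimitsOfShape_of_reflects_of_preserves _ isZeroGood.{u}.ι

/-- The symmetry on `0`-good quadratic pair modules. -/
noncomputable def tensorRight0Iso (C : QPM0.{u}) :
    MonoidalCategory.tensorLeft C ≅ MonoidalCategory.tensorRight C :=
  NatIso.ofComponents (fun D => isZeroGood.{u}.isoMk (braidIso C.obj D.obj))
    fun f => by
      ext1
      exact braid_naturality (𝟙 C.obj) f.hom

instance (J : Type w) [HasColimitsOfShape (Discrete J) QPM.{u}] (C : QPM0.{u}) :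
    PreservesColimitsOfShape (Discrete J) ((MonoidalCategory.curriedTensor QPM0.{u}).obj C) :=
  preservesCoproducts_tensorLeft0 J C

instance (J : Type w) [HasColimitsOfShape (Discrete J) QPM.{u}] (C : QPM0.{u}) :
    PreservesColimitsOfShape (Discrete J) ((MonoidalCategory.curriedTensor QPM0.{u}).flip.obj C) :=
  have := preservesCoproducts_tensorLeft0 J C
  preservesColimitsOfShape_of_natIso (tensorRight0Iso C)

instance : HasColimitsOfShape (Discrete PEmpty.{1}) QPM.{u} :=
  hasColimitsOfShape_of_equivalence (Discrete.equivalence (Equiv.equivPEmpty PEmpty.{u + 1}))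

instance : HasInitial QPM0.{u} :=
  hasColimitsOfShape_of_closedUnderColimits (Discrete PEmpty.{1}) isZeroGood.{u}

open Classical in
noncomputable instance gradedMonoidalCategory (M : Type u) [AddMonoid M] :
    MonoidalCategory (GradedQPM0.{u} M) :=
  GradedObject.monoidalCategory

variable {M : Type u} [AddMonoid M]

/-- The inclusion of `D_p ⊙ E_q` into the tensor product of graded objects. -/
noncomputable def gradedι (D E : GradedQPM0.{u} M) (p q n : M) (h : p + q = n) :
    (D p).obj.tensor (E q).obj ⟶ ((D ⊗ E) n).obj :=
  (GradedObject.Monoidal.ιTensorObj D E p q n h).hom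

theorem isColimit_gradedι (D E : GradedQPM0.{u} M) (n : M) :
    Nonempty (IsColimit (Cofan.mk ((D ⊗ E) n).obj
      fun i : {i : M × M // i.1 + i.2 = n} => gradedι D E i.1.1 i.1.2 n i.2)) :=
  ⟨isColimitCofanMkObjOfIsColimit isZeroGood.{u}.ι
    (fun i : {i : M × M // i.1 + i.2 = n} => D i.1.1 ⊗ E i.1.2)
    (fun i => GradedObject.Monoidal.ιTensorObj D E i.1.1 i.1.2 n i.2)
    (Cofan.IsColimit.mk _
      (fun s => GradedObject.Monoidal.tensorObjDesc fun p q h => s.inj ⟨(p, q), h⟩)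
      (fun _ i => GradedObject.Monoidal.ι_tensorObjDesc _ i.1.1 i.1.2 i.2)
      (fun s _ hm => GradedObject.Monoidal.tensorObj_ext _ _ fun p q h =>
        (hm ⟨(p, q), h⟩).trans (GradedObject.Monoidal.ι_tensorObjDesc
          (fun p q h => s.inj ⟨(p, q), h⟩) p q h).symm))⟩

theorem gradedι_tensorHom (D D' E E' : GradedQPM0.{u} M) (f : D ⟶ D') (g : E ⟶ E') (p q n : M)
    (h : p + q = n) : gradedι D E p q n h ≫ ((f ⊗ₘ g) n).hom =
      tensorMap (f p).hom (g q).hom ≫ gradedι D' E' p q n h :=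
  congrArg (·.hom) (GradedObject.Monoidal.ι_tensorHom f g p q n h)

variable (M) in
open Classical in
/-- The degree `0` part of the unit. -/
noncomputable def gradedUnitIso : Zbar.{u} ≅ ((𝟙_ (GradedQPM0.{u} M)) 0).obj :=
  isZeroGood.{u}.ι.mapIso (GradedObject.Monoidal.tensorUnit₀ (I := M) (C := QPM0.{u})).symm

open Classical in
theorem isInitial_gradedUnit (n : M) (hn : n ≠ 0) :
    Nonempty (IsInitial ((𝟙_ (GradedQPM0.{u} M)) n).obj) :=
  ⟨(GradedObject.Monoidal.isInitialTensorUnitApply (C := QPM0.{u}) n hn).isInitialObj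
    isZeroGood.{u}.ι _⟩

theorem gradedι_associator (D E F : GradedQPM0.{u} M) (p q s : M) :
    tensorMap (gradedι D E p q (p + q) rfl) (𝟙 (F s).obj) ≫
        gradedι (D ⊗ E) F (p + q) s (p + q + s) rfl ≫ ((α_ D E F).hom (p + q + s)).hom =
      (assocIso (D p).obj (E q).obj (F s).obj).hom ≫
        tensorMap (𝟙 (D p).obj) (gradedι E F q s (q + s) rfl) ≫
          gradedι D (E ⊗ F) p (q + s) (p + q + s) (add_assoc p q s).symm :=
  congrArg (·.hom) (GradedObject.Monoidal.ιTensorObj₃'_associator_hom D E F p q s (p + q + s) rfl)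

theorem gradedι_leftUnitor (D : GradedQPM0.{u} M) (n : M) :
    tensorMap (gradedUnitIso M).hom (𝟙 (D n).obj) ≫ gradedι (𝟙_ _) D 0 n n (zero_add n) ≫
      ((λ_ D).hom n).hom = (leftUnit (D n).obj).hom := by
  classical
  have h : (λ_ (D n)).inv ≫ GradedObject.Monoidal.tensorUnit₀.inv ▷ D n ≫
      GradedObject.Monoidal.ιTensorObj _ D 0 n n (zero_add n) ≫ (λ_ D).hom n = 𝟙 (D n) :=
    (by simp only [Category.assoc] : _ = ((λ_ (D n)).inv ≫
      GradedObject.Monoidal.tensorUnit₀.inv ▷ D n ≫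
        GradedObject.Monoidal.ιTensorObj _ D 0 n n (zero_add n)) ≫ (λ_ D).hom n).trans
      (congrFun (λ_ D).inv_hom_id n)
  exact congrArg (·.hom) ((Iso.inv_comp_eq _).1 h |>.trans (Category.comp_id _))

theorem gradedι_rightUnitor (D : GradedQPM0.{u} M) (n : M) :
    tensorMap (𝟙 (D n).obj) (gradedUnitIso M).hom ≫ gradedι D (𝟙_ _) n 0 n (add_zero n) ≫
      ((ρ_ D).hom n).hom = (rightUnit (D n).obj).hom := by
  classical
  have h : (ρ_ (D n)).inv ≫ D n ◁ GradedObject.Monoidal.tensorUnit₀.inv ≫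
      GradedObject.Monoidal.ιTensorObj D _ n 0 n (add_zero n) ≫ (ρ_ D).hom n = 𝟙 (D n) :=
    (by simp only [Category.assoc] : _ = ((ρ_ (D n)).inv ≫
      D n ◁ GradedObject.Monoidal.tensorUnit₀.inv ≫
        GradedObject.Monoidal.ιTensorObj D _ n 0 n (add_zero n)) ≫ (ρ_ D).hom n).trans
      (congrFun (ρ_ D).inv_hom_id n)
  exact congrArg (·.hom) ((Iso.inv_comp_eq _).1 h |>.trans (Category.comp_id _))

end graded

end QPM

end

theorem mainTheorem12 (M : Type u) [AddMonoid M] :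
    -- the functor `C ⊙ -` preserves coproducts if `C` is `0`-good
    (∀ J : Type u, HasColimitsOfShape (Discrete J) QPM.{u} ∧
      ∀ C : QPM.{u}, C.isZeroGood → PreservesColimitsOfShape (Discrete J) C.tensorLeft) ∧
    -- the canonical associativity and unit isomorphisms of `0`-good quadratic pair modules
    ∃ (α : ∀ C D E : QPM0.{u},
        (C.obj.tensor D.obj).tensor E.obj ≅ C.obj.tensor (D.obj.tensor E.obj))
      (l : ∀ C : QPM0.{u}, QPM.Zbar.tensor C.obj ≅ C.obj)
      (r : ∀ C : QPM0.{u}, C.obj.tensor QPM.Zbar ≅ C.obj),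
      (∀ C D E : QPM0.{u}, QPM.IsAssociator C.obj D.obj E.obj (α C D E).hom) ∧
      (∀ C : QPM0.{u}, QPM.IsLeftUnitor C.obj (l C).hom) ∧
      (∀ C : QPM0.{u}, QPM.IsRightUnitor C.obj (r C).hom) ∧
    -- the monoidal structure, with the inclusions of `D_p ⊙ E_q` into `(D ⊙ E)_n` for `p + q = n`,
    -- and the identification of the degree `0` part of the unit
    ∃ (_ : MonoidalCategory (GradedQPM0.{u} M))
      (ι : ∀ (D E : GradedQPM0.{u} M) (p q n : M), p + q = n →
        ((D p).obj.tensor (E q).obj ⟶ ((D ⊗ E) n).obj))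
      (η : QPM.Zbar.{u} ≅ ((𝟙_ (GradedQPM0.{u} M)) 0).obj),
      -- `(D ⊙ E)_n` is the coproduct of the `D_p ⊙ E_q` with `p + q = n`
      (∀ (D E : GradedQPM0.{u} M) (n : M),
        Nonempty (IsColimit (Cofan.mk ((D ⊗ E) n).obj
          fun i : {i : M × M // i.1 + i.2 = n} => ι D E i.1.1 i.1.2 n i.2))) ∧
      -- `f ⊙ g` is the coproduct of the `f_p ⊙ g_q`
      (∀ (D D' E E' : GradedQPM0.{u} M) (f : D ⟶ D') (g : E ⟶ E') (p q n : M) (h : p + q = n),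
        ι D E p q n h ≫ ((f ⊗ₘ g) n).hom =
          QPM.tensorMap (f p).hom (g q).hom ≫ ι D' E' p q n h) ∧
      -- the unit is concentrated in degree `0`
      (∀ n : M, n ≠ 0 → Nonempty (IsInitial ((𝟙_ (GradedQPM0.{u} M)) n).obj)) ∧
      -- the associativity and unit isomorphisms are those of quadratic pair modules
      (∀ (D E F : GradedQPM0.{u} M) (p q s : M),
        QPM.tensorMap (ι D E p q (p + q) rfl) (𝟙 (F s).obj) ≫
            ι (D ⊗ E) F (p + q) s (p + q + s) rfl ≫ ((α_ D E F).hom (p + q + s)).hom =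
          (α (D p) (E q) (F s)).hom ≫ QPM.tensorMap (𝟙 (D p).obj) (ι E F q s (q + s) rfl) ≫
            ι D (E ⊗ F) p (q + s) (p + q + s) (add_assoc p q s).symm) ∧
      (∀ (D : GradedQPM0.{u} M) (n : M),
        QPM.tensorMap η.hom (𝟙 (D n).obj) ≫ ι (𝟙_ _) D 0 n n (zero_add n) ≫
          ((λ_ D).hom n).hom = (l (D n)).hom) ∧
      (∀ (D : GradedQPM0.{u} M) (n : M),
        QPM.tensorMap (𝟙 (D n).obj) η.hom ≫ ι D (𝟙_ _) n 0 n (add_zero n) ≫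
          ((ρ_ D).hom n).hom = (r (D n)).hom) := by
  refine ⟨fun J => ⟨QPM.hasCoproducts J, fun C hC =>
    (QPM.preservesColimits_tensorLeft hC).preservesColimitsOfShape⟩,
    fun C D E => QPM.assocIso C.obj D.obj E.obj, fun C => QPM.leftUnit C.obj,
    fun C => QPM.rightUnit C.obj, fun C D E => QPM.isAssociator_assocIso,
    fun C => QPM.isLeftUnitor_leftUnit _, fun C => QPM.isRightUnitor_rightUnit _,
    QPM.gradedMonoidalCategory M,
    fun D E p q n h => QPM.gradedι D E p q n h, QPM.gradedUnitIso M,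
    QPM.isColimit_gradedι, QPM.gradedι_tensorHom, QPM.isInitial_gradedUnit,
    QPM.gradedι_associator, QPM.gradedι_leftUnitor, QPM.gradedι_rightUnitor⟩
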